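/- Let $\tau,\delta,\sigma>0$. Notation. $|\cdot|$ is the Euclidean norm, $|\cdot|_\infty$ the maximum norm, $\langle\xi\rangle=\sqrt{1+|\xi|^2}$, and $\widehat f(\xi)=(2\pi)^{-n/2}\int_{\mathbb R^n}e^{-ix\cdot\xi}f(x)\,dx$, extended by duality to the dual $\mathcal S_{\mathrm{G-S}}'$ of the Beurling-type Gelfand–Shilov space $\mathcal S_{\mathrm{G-S}}=\{f\in\mathcal S:\ \sup_x e^{\lambda|x|}|f(x)|+\sup_\xi e^{\lambda|\xi|}|\widehat f(\xi)|<\infty\ \text{for all }\lambda>0\}$. For $\alpha,r\in\mathbb R$ let $E^\alpha_r$ be the space of $f\in\mathcal S_{\mathrm{G-S}}'$ such that $\widehat f$ is a function and $\|f\|_{E^\alpha_r}=\|\langle\xi\rangle^r2^{\alpha|\xi|}\widehat f\|_{L^2}<\infty$. With $\widehat{\square_kf}=\chi_{k+[0,1)^n}\widehat f$ for $k\in\mathbb Z^n$, let $$\|g\|_{\widetilde L^\gamma(\mathbb R_+,E^{\alpha,r}_{2,2})}=\Big(\sum_{k\in\mathbb Z^n}\big(\langle k\rangle^r2^{\alpha|k|}\|\square_kg\|_{L^\gamma_tL^2_x}\big)^2\Big)^{1/2}.$$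 For $R\ge0$ let $\mathbb R^n_{\mathrm{Oct},R}=\{\xi\in\mathbb R^n:\ \xi_j\ge0\text{ for all }j,\ |\xi|_\infty\ge R\}$. For $f,g$ with locally square integrable Fourier transforms supported in the octant $\mathbb R^n_{\mathrm{Oct},0}$, the product is defined by $\widehat{fg}=(2\pi)^{-n/2}\,\widehat f*\widehat g$. For $j\in\{0,1,2\}$ let $\widehat{\mathcal K}_j(t,r)$ be the solution of $\tau y'''+y''+(\delta+\tau)r^{2\sigma}y'+r^{2\sigma}y=0$ in $t$ with $\partial_t^m\widehat{\mathcal K}_j(0,r)=\delta_{mj}$ for $m=0,1,2$, and let $\partial_t^m\mathcal K_j(t,|D|)$ be the Fourier multiplier with symbol $\partial_t^m\widehat{\mathcal K}_j(t,|\xi|)$. For $B/A>0$ consider the complex-valued JMGT equation of Westervelt type, with $\mathcal A=(-\Delta)^\sigma$, $$\tau\partial_t^3\psi+\partial_t^2\psi+\mathcal A\psi+(\delta+\tau)\mathcal A\partial_t\psi=\big(1+\tfrac{B}{2A}\big)\partial_t[(\partial_t\psi)^2]\ \text{ on }\mathbb R_+\times\mathbb R^n,\qquad \partial_t^j\psi(0)=\psi_j\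 \ (j=0,1,2).$$ A global mild solution, in the time-derivative sense, is a curve $v=\partial_t\psi$ on $\mathbb R_+=[0,\infty)$ such that, for all $t\ge0$, with the integral taken weakly in $\mathcal S_{\mathrm{G-S}}'$, $$v(t)=\sum_{j=0}^2\partial_t\mathcal K_j(t,|D|)\psi_j+\tfrac1\tau\big(1+\tfrac{B}{2A}\big)\Big(-\partial_t\mathcal K_2(t,|D|)[\psi_1^2]+\int_0^t\partial_t^2\mathcal K_2(t-\theta,|D|)[v(\theta)^2]\,d\theta\Big).$$ Theorem. There is $N_0=N_0(\tau,\delta,\sigma)>0$ such that the following holds for all $n\ge1$, $B/A>0$, $\alpha\le0$ and $s\ge\frac n2-\sigma$. There is $\varepsilon>0$, independent of the data, such that for all data with $(\psi_0,\psi_1,\psi_2)\in E^\alpha_{s+\sigma}\times E^\alpha_{s+\sigma}\times E^\alpha_s$, $\psi_1^2\in E^\alpha_s$ and $\operatorname{supp}\widehat\psi_j\subset\mathbb R^n_{\mathrm{Oct},N_0}$ for $j=0,1,2$: if either - $\alpha<0$ (data of any size), or - $\alpha=0$ and $\|\psi_0\|_{E^\alpha_{s+\sigma}}+\|\psi_1\|_{E^\alpha_{s+\sigma}}+\|\psi_2\|_{E^\alpha_s}+\|\psi_1^2\|_{E^\alpha_s}\le\varepsilon$,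 then there is $\alpha_0\le\alpha$, with $\alpha_0=0$ when $\alpha=0$ and $s>\frac n2-\sigma$, for which there is a global mild solution $$\partial_t\psi\in\mathcal C(\mathbb R_+,E^{\alpha_0}_{s+\sigma})\cap\widetilde L^1(\mathbb R_+,E^{\alpha_0,s+\sigma}_{2,2})\cap\widetilde L^\infty(\mathbb R_+,E^{\alpha_0,s+\sigma}_{2,2})$$ with $\operatorname{supp}\widehat{\partial_t\psi}(t)\subset\mathbb R^n_{\mathrm{Oct},N_0}$ for all $t\ge0$, and it is the only global mild solution in this space whose Fourier transform is supported in the octant $\mathbb R^n_{\mathrm{Oct},0}$ for all $t\ge0$. -/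

import Mathlib

open MeasureTheory Filter Topology Set
open scoped ENNReal

noncomputable section

namespace JMGT

/-- The space `ℝⁿ` with its Euclidean norm. -/
abbrev V (n : ℕ) : Type := EuclideanSpace ℝ (Fin n)

/-! ### Fourier transform and Gelfand-Shilov (Beurling type) distributions -/

/-- The dilation `ξ ↦ (2π)⁻¹ ξ`, which converts ordinary frequencies to angular frequencies. -/
def freqScale (n : ℕ) : V n ≃L[ℝ] V n :=
  ContinuousLinearEquiv.smulLeft (Units.mk0 (2 * Real.pi)⁻¹ (inv_ne_zero Real.two_pi_pos.ne'))

/-- The normalising constant `(2π)^(-n/2)`. -/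
def fourierConst (n : ℕ) : ℝ := (2 * Real.pi) ^ (-(n : ℝ) / 2)

/-- The unitary Fourier transform on Schwartz functions with angular frequencies,
`φ̂(ξ) = (2π)^(-n/2) ∫ e^{-i x·ξ} φ(x) dx` (see `hat_apply`), so that `-Δ` has symbol `|ξ|²`. -/
def hat {n : ℕ} : SchwartzMap (V n) ℂ →ₗ[ℂ] SchwartzMap (V n) ℂ :=
  ((fourierConst n : ℂ)) •
    ((SchwartzMap.compCLMOfContinuousLinearEquiv ℂ (freqScale n)).toLinearMap ∘ₗ
      (FourierTransform.fourierCLM ℂ (SchwartzMap (V n) ℂ)).toLinearMap)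

theorem hat_eq_fourier {n : ℕ} (φ : SchwartzMap (V n) ℂ) (ξ : V n) :
    hat φ ξ = (fourierConst n : ℂ) *
      FourierTransform.fourier (φ : V n → ℂ) ((2 * Real.pi)⁻¹ • ξ) := by
  rfl

theorem hat_apply {n : ℕ} (φ : SchwartzMap (V n) ℂ) (ξ : V n) :
    hat φ ξ = (fourierConst n : ℂ) *
      ∫ x : V n, Complex.exp (-Complex.I * (inner ℝ x ξ : ℝ)) * φ x := by
  rw [hat_eq_fourier, Real.fourier_eq']
  congr 1
  refine integral_congr_ae (Eventually.of_forall fun x => ?_)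
  simp only [smul_eq_mul, inner_smul_right]
  congr 2
  have : (Real.pi : ℂ) ≠ 0 := by exact_mod_cast Real.pi_ne_zero
  push_cast
  field_simp

/-- Fourier inversion in the form `(φ̂)^ (x) = φ(-x)`. -/
theorem hat_hat {n : ℕ} (φ : SchwartzMap (V n) ℂ) (x : V n) : hat (hat φ) x = φ (-x) := by
  have hinv : FourierTransform.fourier (FourierTransform.fourier (φ : V n → ℂ)) x = φ (-x) := by
    have h1 := φ.continuous.fourierInv_fourier_eq φ.integrable
      (by rw [← SchwartzMap.fourier_coe]; exact (FourierTransform.fourier φ).integrable)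
    have h2 := congrFun h1 (-x)
    rwa [Real.fourierInv_eq_fourier_neg, neg_neg] at h2
  have hint : FourierTransform.fourier (hat φ : V n → ℂ) ((2 * Real.pi)⁻¹ • x) =
      ((2 * Real.pi) ^ n : ℝ) * ((fourierConst n : ℂ) *
        FourierTransform.fourier (FourierTransform.fourier (φ : V n → ℂ)) x) := by
    rw [Real.fourier_eq', Real.fourier_eq']
    have h := MeasureTheory.Measure.integral_comp_smul (volume : Measure (V n))
      (fun η : V n => (fourierConst n : ℂ) *
        (Complex.exp (((-2 * Real.pi * inner ℝ η x : ℝ) : ℂ) * Complex.I) *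
          FourierTransform.fourier (φ : V n → ℂ) η)) ((2 * Real.pi)⁻¹)
    rw [finrank_euclideanSpace_fin] at h
    have hc : |(((2 * Real.pi)⁻¹ ^ n : ℝ))⁻¹| = (2 * Real.pi) ^ n := by
      rw [inv_pow, inv_inv, abs_of_nonneg (pow_nonneg Real.two_pi_pos.le n)]
    rw [hc, Complex.real_smul] at h
    simp only [smul_eq_mul]
    rw [← integral_const_mul (fourierConst n : ℂ), ← h]
    refine integral_congr_ae (Eventually.of_forall fun ξ => ?_)
    simp only [hat_eq_fourier, inner_smul_left, inner_smul_right]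
    simp only [conj_trivial]
    ring
  have hconst : (fourierConst n : ℂ) *
      ((((2 * Real.pi) ^ n : ℝ) : ℂ) * (fourierConst n : ℂ)) = 1 := by
    have : fourierConst n * ((2 * Real.pi) ^ n * fourierConst n) = 1 := by
      rw [fourierConst, ← Real.rpow_natCast (2 * Real.pi) n, ← Real.rpow_add Real.two_pi_pos,
        ← Real.rpow_add Real.two_pi_pos]
      ring_nf
      simp
    exact_mod_cast this
  rw [hat_eq_fourier, hint, hinv]
  linear_combination (φ (-x)) * hconst

/-- Membership in the Gelfand-Shilov space of Beurling type: for every `a > 0`,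
`sup e^{a|x|} |φ(x)| + sup e^{a|ξ|} |φ̂(ξ)| < ∞`. -/
def IsGS {n : ℕ} (φ : SchwartzMap (V n) ℂ) : Prop :=
  ∀ a : ℝ, 0 < a →
    BddAbove (range fun x : V n => Real.exp (a * ‖x‖) * ‖φ x‖) ∧
    BddAbove (range fun ξ : V n => Real.exp (a * ‖ξ‖) * ‖hat φ ξ‖)

/-- The norms `sup e^{a|x|} |φ(x)| + sup e^{a|ξ|} |φ̂(ξ)|`, `a > 0`, that define the Fréchet
topology of the Gelfand-Shilov space; they increase with `a`. -/
def gsNorm {n : ℕ} (a : ℝ) (φ : SchwartzMap (V n) ℂ) : ℝ :=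
  (⨆ x : V n, Real.exp (a * ‖x‖) * ‖φ x‖) + ⨆ ξ : V n, Real.exp (a * ‖ξ‖) * ‖hat φ ξ‖

theorem bddAbove_weight_add {n : ℕ} {a : ℝ} {f g : V n → ℂ}
    (hf : BddAbove (range fun x : V n => Real.exp (a * ‖x‖) * ‖f x‖))
    (hg : BddAbove (range fun x : V n => Real.exp (a * ‖x‖) * ‖g x‖)) :
    BddAbove (range fun x : V n => Real.exp (a * ‖x‖) * ‖f x + g x‖) := by
  obtain ⟨A, hA⟩ := hf
  obtain ⟨B, hB⟩ := hg
  refine ⟨A + B, ?_⟩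
  rintro _ ⟨x, rfl⟩
  have h1 := hA ⟨x, rfl⟩
  have h2 := hB ⟨x, rfl⟩
  have h3 := mul_le_mul_of_nonneg_left (norm_add_le (f x) (g x)) (Real.exp_pos (a * ‖x‖)).le
  simp only at h1 h2 ⊢
  linarith

theorem bddAbove_weight_smul {n : ℕ} {a : ℝ} (c : ℂ) {f : V n → ℂ}
    (hf : BddAbove (range fun x : V n => Real.exp (a * ‖x‖) * ‖f x‖)) :
    BddAbove (range fun x : V n => Real.exp (a * ‖x‖) * ‖c * f x‖) := by
  obtain ⟨A, hA⟩ := hf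
  refine ⟨‖c‖ * A, ?_⟩
  rintro _ ⟨x, rfl⟩
  have h1 := mul_le_mul_of_nonneg_left (hA ⟨x, rfl⟩) (norm_nonneg c)
  simp only [norm_mul] at h1 ⊢
  linarith

/-- The Gelfand-Shilov space of Beurling type. -/
def GS (n : ℕ) : Submodule ℂ (SchwartzMap (V n) ℂ) where
  carrier := {φ | IsGS φ}
  zero_mem' := fun a _ => by
    constructor <;> simp
  add_mem' := fun {φ ψ} hφ hψ a ha => by
    refine ⟨bddAbove_weight_add (hφ a ha).1 (hψ a ha).1, ?_⟩
    rw [map_add]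
    exact bddAbove_weight_add (hφ a ha).2 (hψ a ha).2
  smul_mem' := fun c φ hφ a ha => by
    refine ⟨bddAbove_weight_smul c (hφ a ha).1, ?_⟩
    rw [map_smul]
    exact bddAbove_weight_smul c (hφ a ha).2

theorem hat_mem {n : ℕ} {φ : SchwartzMap (V n) ℂ} (hφ : φ ∈ GS n) : hat φ ∈ GS n := by
  intro a ha
  refine ⟨(hφ a ha).2, ?_⟩
  obtain ⟨A, hA⟩ := (hφ a ha).1
  refine ⟨A, ?_⟩
  rintro _ ⟨x, rfl⟩
  have := hA ⟨-x, rfl⟩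
  simpa [hat_hat] using this

/-- The Fourier transform on the Gelfand-Shilov space. -/
def gsHat {n : ℕ} : GS n →ₗ[ℂ] GS n :=
  hat.restrict fun _ hφ => hat_mem hφ

theorem gsNorm_hat {n : ℕ} (a : ℝ) (φ : GS n) :
    gsNorm a (gsHat φ : SchwartzMap (V n) ℂ) = gsNorm a (φ : SchwartzMap (V n) ℂ) := by
  have h : (⨆ ξ : V n, Real.exp (a * ‖ξ‖) * ‖hat (hat (φ : SchwartzMap (V n) ℂ)) ξ‖) =
      ⨆ x : V n, Real.exp (a * ‖x‖) * ‖(φ : SchwartzMap (V n) ℂ) x‖ := by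
    rw [← (Equiv.neg (V n)).iSup_comp]
    simp [hat_hat]
  change (⨆ x : V n, Real.exp (a * ‖x‖) * ‖hat (φ : SchwartzMap (V n) ℂ) x‖) +
    (⨆ ξ : V n, Real.exp (a * ‖ξ‖) * ‖hat (hat (φ : SchwartzMap (V n) ℂ)) ξ‖) = _
  rw [h, add_comm, gsNorm]

theorem gsNorm_nonneg {n : ℕ} (a : ℝ) (φ : SchwartzMap (V n) ℂ) : 0 ≤ gsNorm a φ :=
  add_nonneg (Real.iSup_nonneg fun _ => by positivity) (Real.iSup_nonneg fun _ => by positivity)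

theorem gsNorm_mono {n : ℕ} {a b : ℝ} (hb : 0 < b) (hab : a ≤ b) (φ : GS n) :
    gsNorm a (φ : SchwartzMap (V n) ℂ) ≤ gsNorm b (φ : SchwartzMap (V n) ℂ) := by
  refine add_le_add (ciSup_mono (φ.2 b hb).1 fun x => ?_) (ciSup_mono (φ.2 b hb).2 fun x => ?_) <;>
  gcongr

/-- The dual of the Gelfand-Shilov space: linear functionals that are continuous, i.e. bounded by
one of the (directed) norms `gsNorm a`, `a > 0`. -/
def GSDual (n : ℕ) : Submodule ℂ (GS n →ₗ[ℂ] ℂ) where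
  carrier := {f | ∃ a : ℝ, 0 < a ∧ ∃ C : ℝ, ∀ φ : GS n,
    ‖f φ‖ ≤ C * gsNorm a (φ : SchwartzMap (V n) ℂ)}
  zero_mem' := ⟨1, one_pos, 0, fun φ => by simp⟩
  add_mem' := by
    rintro f g ⟨a, ha, C, hf⟩ ⟨b, hb, D, hg⟩
    have hm : 0 < max a b := lt_max_of_lt_left ha
    refine ⟨max a b, hm, |C| + |D|, fun φ => ?_⟩
    have h1 : ‖f φ‖ ≤ |C| * gsNorm (max a b) (φ : SchwartzMap (V n) ℂ) :=
      (hf φ).trans (mul_le_mul (le_abs_self C) (gsNorm_mono hm (le_max_left a b) φ)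
        (gsNorm_nonneg _ _) (abs_nonneg C))
    have h2 : ‖g φ‖ ≤ |D| * gsNorm (max a b) (φ : SchwartzMap (V n) ℂ) :=
      (hg φ).trans (mul_le_mul (le_abs_self D) (gsNorm_mono hm (le_max_right a b) φ)
        (gsNorm_nonneg _ _) (abs_nonneg D))
    rw [LinearMap.add_apply, add_mul]
    exact (norm_add_le _ _).trans (add_le_add h1 h2)
  smul_mem' := by
    rintro c f ⟨a, ha, C, hf⟩
    refine ⟨a, ha, ‖c‖ * C, fun φ => ?_⟩
    rw [LinearMap.smul_apply, norm_smul, mul_assoc]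
    exact mul_le_mul_of_nonneg_left (hf φ) (norm_nonneg c)

/-- The value `⟨f, φ⟩`. -/
def pair {n : ℕ} (f : GSDual n) (φ : GS n) : ℂ := (f : GS n →ₗ[ℂ] ℂ) φ

/-- The Fourier transform on the dual, by duality: `⟨f̂, φ⟩ = ⟨f, φ̂⟩`. -/
def fourierDual {n : ℕ} (f : GSDual n) : GSDual n :=
  ⟨(f : GS n →ₗ[ℂ] ℂ) ∘ₗ gsHat, by
    obtain ⟨a, ha, C, hf⟩ := f.2
    refine ⟨a, ha, C, fun φ => ?_⟩
    have := hf (gsHat φ)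
    rwa [gsNorm_hat] at this⟩

/-- The Fourier transform of `f` is (the regular distribution given by) the function `F`. -/
def HasFourier {n : ℕ} (f : GSDual n) (F : V n → ℂ) : Prop :=
  ∀ φ : GS n, Integrable (fun ξ : V n => F ξ * (φ : SchwartzMap (V n) ℂ) ξ) ∧
    pair (fourierDual f) φ = ∫ ξ : V n, F ξ * (φ : SchwartzMap (V n) ℂ) ξ

open Classical in
/-- The function `f̂`, determined almost everywhere, when the Fourier transform of `f` is a
function (and `0` otherwise). -/
def fhat {n : ℕ} (f : GSDual n) : V n → ℂ :=
  if h : ∃ F : V n → ℂ, HasFourier f F then h.choose else 0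

open Classical in
/-- The inverse Fourier transform: the distribution whose Fourier transform is the function `F`
(and `0` if there is none). -/
def ofFourier {n : ℕ} (F : V n → ℂ) : GSDual n :=
  if h : ∃ f : GSDual n, HasFourier f F then h.choose else 0

/-! ### The spaces `E^α_s` and `L̃^γ(ℝ₊, E^{α,s}_{2,2})` -/

/-- The weight `⟨ξ⟩^s 2^{α|ξ|}`. -/
def weight {n : ℕ} (α s : ℝ) (ξ : V n) : ℝ :=
  Real.sqrt (1 + ‖ξ‖ ^ 2) ^ s * (2 : ℝ) ^ (α * ‖ξ‖)

/-- The norm `‖⟨ξ⟩^s 2^{α|ξ|} f̂(ξ)‖_{L²}` of `E^α_s`. -/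
def normE {n : ℕ} (α s : ℝ) (f : GSDual n) : ℝ≥0∞ :=
  eLpNorm (fun ξ : V n => (weight α s ξ : ℂ) * fhat f ξ) 2 volume

/-- Membership in `E^α_s`: the Fourier transform is a function and
`⟨ξ⟩^s 2^{α|ξ|} f̂(ξ) ∈ L²`. -/
def MemE {n : ℕ} (α s : ℝ) (f : GSDual n) : Prop :=
  HasFourier f (fhat f) ∧ MemLp (fun ξ : V n => (weight α s ξ : ℂ) * fhat f ξ) 2 volume

/-- The cube `k + [0,1)ⁿ`. -/
def cube {n : ℕ} (k : Fin n → ℤ) : Set (V n) :=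
  {ξ | ∀ i, (k i : ℝ) ≤ ξ i ∧ ξ i < (k i : ℝ) + 1}

/-- The frequency-uniform decomposition operator `□_k f = 𝓕⁻¹(χ_{k+[0,1)ⁿ} f̂)`; as the frequency
is localised in a bounded set, this is the function
`x ↦ (2π)^(-n/2) ∫_{k+[0,1)ⁿ} e^{i x·ξ} f̂(ξ) dξ`. -/
def box {n : ℕ} (k : Fin n → ℤ) (f : GSDual n) : V n → ℂ := fun x =>
  (fourierConst n : ℂ) *
    ∫ ξ in cube k, Complex.exp (Complex.I * (inner ℝ x ξ : ℝ)) * fhat f ξ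

/-- The norm of `L̃^γ(ℝ₊, E^{α,s}_{2,2})`,
`(∑_{k ∈ ℤⁿ} (⟨k⟩^s 2^{α|k|} ‖□_k g‖_{L^γ_t L²_x})²)^{1/2}`. -/
def normTilde {n : ℕ} (γ : ℝ≥0∞) (α s : ℝ) (g : ℝ → GSDual n) : ℝ≥0∞ :=
  (∑' k : Fin n → ℤ,
    (ENNReal.ofReal (weight α s (WithLp.toLp 2 fun i => (k i : ℝ) : V n)) *
      eLpNorm (fun t : ℝ => eLpNorm (box k (g t)) 2 volume) γ (volume.restrict (Ioi 0))) ^ 2)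
    ^ (1 / 2 : ℝ)

/-- The curve `v` belongs to
`C(ℝ₊, E^α_r) ∩ L̃¹(ℝ₊, E^{α,r}_{2,2}) ∩ L̃^∞(ℝ₊, E^{α,r}_{2,2})`, with `ℝ₊ = [0,∞)`
(only the values `v t`, `t ≥ 0`, matter). -/
structure InSolutionSpace {n : ℕ} (α r : ℝ) (v : ℝ → GSDual n) : Prop where
  mem : ∀ t, 0 ≤ t → MemE α r (v t)
  cont : ∀ t₀, 0 ≤ t₀ → Tendsto (fun t => normE α r (v t - v t₀)) (𝓝[Ici 0] t₀) (𝓝 0)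
  tilde_one : normTilde 1 α r v < ∞
  tilde_top : normTilde ∞ α r v < ∞

/-! ### Fourier supports, products, Fourier multipliers -/

/-- The part `{ξ : ξ_j ≥ 0 for all j, |ξ|_∞ ≥ R}` of the first octant (the full octant if
`R = 0`). -/
def octant (n : ℕ) (R : ℝ) : Set (V n) :=
  {ξ | (∀ j, 0 ≤ ξ j) ∧ R ≤ ‖WithLp.ofLp ξ‖}

/-- `supp f̂ ⊆ S` for a closed set `S`, when `f̂` is a function. -/
def FourierSupportedIn {n : ℕ} (S : Set (V n)) (f : GSDual n) : Prop :=
  ∀ᵐ ξ : V n, fhat f ξ ≠ 0 → ξ ∈ S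

/-- The product of two distributions, through `(fg)^ = (2π)^(-n/2) f̂ ∗ ĝ`. If `f̂`, `ĝ` are
locally square integrable and supported in the first octant, the convolution integral at `ξ` only
involves the bounded set `{η : 0 ≤ η ≤ ξ}` and converges. -/
def mul {n : ℕ} (f g : GSDual n) : GSDual n :=
  ofFourier fun ξ => (fourierConst n : ℂ) * ∫ η : V n, fhat f η * fhat g (ξ - η)

/-- The Fourier multiplier `m(|D|)` with real radial symbol `m(|ξ|)`. -/
def mult {n : ℕ} (m : ℝ → ℝ) (f : GSDual n) : GSDual n :=
  ofFourier fun ξ => (m ‖ξ‖ : ℂ) * fhat f ξ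

/-! ### Kernels of the linear equation and mild solutions -/

/-- The companion matrix of `τ y''' + y'' + (δ+τ) r^{2σ} y' + r^{2σ} y = 0`. -/
def companion (τ δ σ r : ℝ) : Matrix (Fin 3) (Fin 3) ℝ :=
  !![0, 1, 0; 0, 0, 1; -(r ^ (2 * σ)) / τ, -((δ + τ) * r ^ (2 * σ)) / τ, -1 / τ]

/-- `kernel τ δ σ m j t r = ∂_t^m K̂_j(t, r)`, where `K̂_j(·, r)` solves
`τ y''' + y'' + r^{2σ} y + (δ+τ) r^{2σ} y' = 0` with `∂_t^m K̂_j(0, r) = δ_{mj}`, `m, j ≤ 2`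
(see `kernel_zero`, `kernel_hasDerivAt` and `kernel_ode`). -/
def kernel (τ δ σ : ℝ) (m j : Fin 3) (t r : ℝ) : ℝ :=
  NormedSpace.exp (t • companion τ δ σ r) m j

theorem kernel_zero (τ δ σ : ℝ) (m j : Fin 3) (r : ℝ) :
    kernel τ δ σ m j 0 r = if m = j then 1 else 0 := by
  simp [kernel, Matrix.one_apply]

section
attribute [local instance] Matrix.linftyOpNormedRing Matrix.linftyOpNormedAlgebra

theorem kernel_hasDerivAt_row (τ δ σ : ℝ) (m j : Fin 3) (t r : ℝ) :
    HasDerivAt (fun t => kernel τ δ σ m j t r)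
      (∑ i, companion τ δ σ r m i * kernel τ δ σ i j t r) t := by
  have h := hasDerivAt_exp_smul_const' (𝕂 := ℝ) (companion τ δ σ r) t
  have h2 := (hasDerivAt_pi.1 ((hasDerivAt_pi.1 h) m)) j
  simp only [Matrix.mul_apply] at h2
  exact h2
end

theorem kernel_hasDerivAt (τ δ σ : ℝ) (j : Fin 3) (t r : ℝ) :
    HasDerivAt (fun t => kernel τ δ σ 0 j t r) (kernel τ δ σ 1 j t r) t ∧
    HasDerivAt (fun t => kernel τ δ σ 1 j t r) (kernel τ δ σ 2 j t r) t := by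
  constructor
  · simpa [companion, Fin.sum_univ_three] using kernel_hasDerivAt_row τ δ σ 0 j t r
  · simpa [companion, Fin.sum_univ_three] using kernel_hasDerivAt_row τ δ σ 1 j t r

theorem kernel_ode {τ : ℝ} (hτ : τ ≠ 0) (δ σ : ℝ) (j : Fin 3) (t r : ℝ) :
    ∃ y : ℝ, HasDerivAt (fun t => kernel τ δ σ 2 j t r) y t ∧
      τ * y + kernel τ δ σ 2 j t r + r ^ (2 * σ) * kernel τ δ σ 0 j t r +
        (δ + τ) * r ^ (2 * σ) * kernel τ δ σ 1 j t r = 0 := by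
  refine ⟨_, kernel_hasDerivAt_row τ δ σ 2 j t r, ?_⟩
  simp [companion, Fin.sum_univ_three]
  field_simp
  ring

/-- The part of the mild formulation that depends on the data only, at time `t`:
`∑_j ∂_t K_j(t,|D|) ψ_j - c ∂_t K₂(t,|D|) ψ₁²`, with `c = (1 + B/(2A))/τ`. -/
def dataTerm {n : ℕ} (τ δ σ c : ℝ) (ψ₀ ψ₁ ψ₂ : GSDual n) (t : ℝ) : GSDual n :=
  mult (kernel τ δ σ 1 0 t) ψ₀ + mult (kernel τ δ σ 1 1 t) ψ₁ + mult (kernel τ δ σ 1 2 t) ψ₂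
    - (c : ℂ) • mult (kernel τ δ σ 1 2 t) (mul ψ₁ ψ₁)

/-- `v = ∂_t ψ` is (the time derivative of) a global mild solution of
`τ ψ_ttt + ψ_tt + 𝒜ψ + (δ+τ) 𝒜ψ_t = (1 + B/(2A)) ∂_t (ψ_t²)`, `𝒜 = (-Δ)^σ`, with data
`ψ₀, ψ₁, ψ₂` and `BA = B/A`: for all `t ≥ 0`
`v(t) = ∑_j ∂_t K_j(t,|D|) ψ_j - c ∂_t K₂(t,|D|) ψ₁² + c ∫_0^t ∂_t² K₂(t-θ,|D|) v(θ)² dθ`,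
`c = (1 + B/(2A))/τ`. This is Duhamel's formula for `ψ`, differentiated in time and integrated by
parts; the time integral of distributions is taken weakly. -/
def IsMildSolution {n : ℕ} (τ δ σ BA : ℝ) (ψ₀ ψ₁ ψ₂ : GSDual n) (v : ℝ → GSDual n) : Prop :=
  ∀ t, 0 ≤ t → ∀ φ : GS n,
    IntervalIntegrable
      (fun θ => pair (mult (kernel τ δ σ 2 2 (t - θ)) (mul (v θ) (v θ))) φ) volume 0 t ∧
    pair (v t) φ = pair (dataTerm τ δ σ ((1 + BA / 2) / τ) ψ₀ ψ₁ ψ₂ t) φ +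
      (((1 + BA / 2) / τ : ℝ) : ℂ) *
        ∫ θ in (0 : ℝ)..t, pair (mult (kernel τ δ σ 2 2 (t - θ)) (mul (v θ) (v θ))) φ

/-- The size of the data: `‖ψ₀‖_{E^α_{s+σ}} + ‖ψ₁‖_{E^α_{s+σ}} + ‖ψ₂‖_{E^α_s} + ‖ψ₁²‖_{E^α_s}`. -/
def dataSize {n : ℕ} (α s σ : ℝ) (ψ₀ ψ₁ ψ₂ : GSDual n) : ℝ≥0∞ :=
  normE α (s + σ) ψ₀ + normE α (s + σ) ψ₁ + normE α s ψ₂ + normE α s (mul ψ₁ ψ₁)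

end JMGT

end

/-! Three facts carry the proof. The first is damping. At frequencies `|ξ| ≥ 1` the linear equation
has a Lyapunov functional (`energy_decay`), so the kernels are bounded by `C e^{-ct}`, and `∂_t K₂`
gains a factor `|ξ|^{-σ}` that lifts `ψ₂` and `ψ₁²` from weight `s` to weight `s + σ`
(`kernel_decay`). Convolution preserves supports in `octant n 1`, so the low frequencies, where
uniform decay fails, never enter; hence `N₀ = 1`.

The second is a weight that makes large data small. On the octant `|ξ| ≤ ∑ ξ_i ≤ n|ξ|`, and `2^{β ∑
ξ_i}` is multiplicative. Weighted `L¹` is therefore a convolution algebra with constant one for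
every `β` (`eExp_mul_lconvolution`). Since `∑ ξ_i ≥ 1` on the supports, lowering `β` makes the
weighted `L¹` norm of the source as small as desired (`lintegral_eExp_le`); the price is the final
exponent `α₀ = nβ`. If `α = 0` and `s + σ > n/2`, then `⟨ξ⟩^{-(s+σ)}` is square integrable, so `β =
0` works for small data.

The third is a majorant. Once the weighted `L¹` norm is small, the iterates of `M = D + A M ∗ M`
stay bounded in weighted `L¹` and `L²`, and the Picard iterates are dominated by `e^{-ct} M`
(`enorm_picard_le`). They need no contraction to converge: each convolution raises `∑ ξ_i` by at
least one, so at a fixed frequency they become stationary (`picard_succ_eq`). The bound by `e^{-ct}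
M` yields all the norms of the solution space.

Uniqueness is a Gronwall argument in the `L¹` space with weight `2^{(α₀-1) ∑ ξ_i}`, into which the
solution space embeds on the octant. It needs no smallness and no decay, only kernels bounded on
finite time intervals (`IsMildSolution.unique`). -/

noncomputable section

namespace JMGT

open scoped SchwartzMap ContDiff FourierTransform

/-! ### Translated Gaussians as test functions -/

theorem exp_quadratic_le (a C : ℝ) (k : ℕ) :
    ∃ B : ℝ, ∀ u : ℝ, 0 ≤ u → C * (1 + u) ^ k * Real.exp (a * u) * Real.exp (-u ^ 2 / 4) ≤ B := by
  refine ⟨|C| * (k.factorial * Real.exp (1 + (a + 1) ^ 2)), fun u hu => ?_⟩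
  have h1 : (1 + u) ^ k ≤ k.factorial * Real.exp (1 + u) := by
    have := Real.pow_div_factorial_le_exp (1 + u) (by positivity) k
    rwa [div_le_iff₀ (by positivity), mul_comm] at this
  have h2 : C * (1 + u) ^ k * Real.exp (a * u) * Real.exp (-u ^ 2 / 4) ≤
      |C| * (k.factorial * Real.exp (1 + u)) * Real.exp (a * u) * Real.exp (-u ^ 2 / 4) := by
    have := le_abs_self C
    gcongr
  refine h2.trans ?_
  have h3 : |C| * (k.factorial * Real.exp (1 + u)) * Real.exp (a * u) * Real.exp (-u ^ 2 / 4) =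
      |C| * (k.factorial * Real.exp (1 + u + a * u + -u ^ 2 / 4)) := by
    rw [Real.exp_add (1 + u + a * u), Real.exp_add (1 + u)]; ring
  rw [h3]
  refine mul_le_mul_of_nonneg_left (mul_le_mul_of_nonneg_left (Real.exp_le_exp.2 ?_)
    (by positivity)) (abs_nonneg C)
  nlinarith [sq_nonneg (u / 2 - (a + 1))]

theorem norm_iteratedFDeriv_realExp (i : ℕ) (u : ℝ) :
    ‖iteratedFDeriv ℝ i Real.exp u‖ = Real.exp u := by
  rw [norm_iteratedFDeriv_eq_norm_iteratedDeriv, iteratedDeriv_eq_iterate, Real.iter_deriv_exp,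
    Real.norm_eq_abs, Real.abs_exp]

/-- The Gaussian `x ↦ exp (-|x - y|²)` as a Schwartz function. -/
def gaussianAt {n : ℕ} (y : V n) : 𝓢(V n, ℂ) where
  toFun x := (Real.exp (-‖x - y‖ ^ 2) : ℝ)
  smooth' := by
    have h : ContDiff ℝ ∞ fun x : V n => Real.exp (-‖x - y‖ ^ 2) :=
      Real.contDiff_exp.comp ((contDiff_id.sub contDiff_const).norm_sq ℝ).neg
    exact Complex.ofRealCLM.contDiff.comp h
  decay' k m := by
    have hf : Function.HasTemperateGrowth fun x : V n => -‖x - y‖ ^ 2 := by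
      have h1 : Function.HasTemperateGrowth fun x : V n => x - y :=
        Function.HasTemperateGrowth.id'.sub (Function.HasTemperateGrowth.const y)
      exact ((Function.hasTemperateGrowth_norm_sq (H := V n)).comp h1).neg
    obtain ⟨p, C, hC, hb⟩ := hf.norm_iteratedFDeriv_le_uniform m
    obtain ⟨B, hB⟩ := exp_quadratic_le 0
      ((1 + ‖y‖) ^ k * (m.factorial * ((1 + C) * (1 + ‖y‖) ^ p) ^ m)) (k + p * m)
    refine ⟨B, fun x => ?_⟩
    have hsm : ContDiff ℝ ∞ fun x : V n => -‖x - y‖ ^ 2 :=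
      ((contDiff_id.sub contDiff_const).norm_sq ℝ).neg
    have h1 : ‖iteratedFDeriv ℝ m (fun x : V n => ((Real.exp (-‖x - y‖ ^ 2) : ℝ) : ℂ)) x‖ =
        ‖iteratedFDeriv ℝ m (Real.exp ∘ fun x : V n => -‖x - y‖ ^ 2) x‖ :=
      Complex.ofRealLI.norm_iteratedFDeriv_comp_left (n := ∞)
        (f := Real.exp ∘ fun x : V n => -‖x - y‖ ^ 2)
        (Real.contDiff_exp.comp hsm).contDiffAt (by exact_mod_cast le_top)
    have hD : 1 ≤ (1 + C) * (1 + ‖x‖) ^ p := by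
      have : 1 ≤ (1 + ‖x‖) ^ p := one_le_pow₀ (by linarith [norm_nonneg x])
      nlinarith
    -- Faà di Bruno: every derivative of `exp` at the point has the size of the Gaussian itself, and
    -- `D ≥ 1` lets one bound for the derivatives of the exponent serve as its powers `D ^ i`.
    have h2 := norm_iteratedFDeriv_comp_le (N := ∞) (n := m) Real.contDiff_exp hsm
      (by exact_mod_cast le_top) x (C := Real.exp (-‖x - y‖ ^ 2))
      (D := (1 + C) * (1 + ‖x‖) ^ p)
      (fun i _ => (norm_iteratedFDeriv_realExp i _).le) (fun i hi him => by
        refine ((hb i him x).trans ?_).trans (le_self_pow₀ hD (by omega))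
        gcongr; linarith)
    rw [h1]
    have hx : 1 + ‖x‖ ≤ (1 + ‖y‖) * (1 + ‖x - y‖) := by
      have := norm_add_le (x - y) y
      rw [sub_add_cancel] at this
      nlinarith [norm_nonneg y, norm_nonneg (x - y)]
    have hx' : ‖x‖ ≤ (1 + ‖y‖) * (1 + ‖x - y‖) := by linarith
    have h3 := hB ‖x - y‖ (norm_nonneg _)
    refine le_trans (mul_le_mul_of_nonneg_left h2 (by positivity)) (le_trans ?_ h3)
    have h4 : Real.exp (-‖x - y‖ ^ 2) ≤ Real.exp (0 * ‖x - y‖) * Real.exp (-‖x - y‖ ^ 2 / 4) := by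
      rw [← Real.exp_add]
      gcongr
      nlinarith [sq_nonneg ‖x - y‖]
    calc ‖x‖ ^ k * (m.factorial * Real.exp (-‖x - y‖ ^ 2) * ((1 + C) * (1 + ‖x‖) ^ p) ^ m)
        ≤ ((1 + ‖y‖) * (1 + ‖x - y‖)) ^ k * (m.factorial *
            (Real.exp (0 * ‖x - y‖) * Real.exp (-‖x - y‖ ^ 2 / 4)) *
            ((1 + C) * ((1 + ‖y‖) * (1 + ‖x - y‖)) ^ p) ^ m) := by gcongr
      _ = _ := by
        simp only [mul_pow, pow_add, pow_mul]
        ring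

/-- Translation turns into modulation, with one constant for all centres. Pairing with these
transforms therefore computes a classical Fourier transform at an arbitrary point, which is how
`HasFourier.ae_eq` detects functions. -/
theorem hat_gaussianAt (n : ℕ) :
    ∃ c : ℂ, c ≠ 0 ∧ ∀ y ξ : V n, hat (gaussianAt y) ξ =
      c * (Complex.exp (-Complex.I * (inner ℝ y ξ : ℝ)) * (Real.exp (-‖ξ‖ ^ 2 / 4) : ℝ)) := by
  refine ⟨(fourierConst n : ℂ) * (Real.pi / 1) ^ (Module.finrank ℝ (V n) / 2 : ℂ), ?_,
    fun y ξ => ?_⟩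
  · refine mul_ne_zero ?_ ?_
    · exact_mod_cast (Real.rpow_pos_of_pos Real.two_pi_pos _).ne'
    · rw [Complex.cpow_ne_zero_iff]
      left; simp
  · have h := fourier_gaussian_innerProductSpace (V := V n) (b := 1) (by simp)
      ((2 * Real.pi)⁻¹ • ξ)
    have h2 : FourierTransform.fourier (gaussianAt y : V n → ℂ) ((2 * Real.pi)⁻¹ • ξ) =
        Complex.exp (-Complex.I * (inner ℝ y ξ : ℝ)) *
        FourierTransform.fourier (fun v : V n => Complex.exp (-1 * ‖v‖ ^ 2))
          ((2 * Real.pi)⁻¹ • ξ) := by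
      rw [Real.fourier_eq', Real.fourier_eq',
        ← integral_sub_right_eq_self (fun v : V n => Complex.exp
          (((-2 * Real.pi * inner ℝ v ((2 * Real.pi)⁻¹ • ξ) : ℝ) : ℂ) * Complex.I) •
            Complex.exp (-1 * ‖v‖ ^ 2)) y,
        ← integral_const_mul]
      refine integral_congr_ae (Eventually.of_forall fun x => ?_)
      have hg : gaussianAt y x = Complex.exp (-1 * ‖x - y‖ ^ 2) := by
        change ((Real.exp (-‖x - y‖ ^ 2) : ℝ) : ℂ) = _
        push_cast
        ring_nf
      have hpi : (Real.pi : ℂ) ≠ 0 := by exact_mod_cast Real.pi_ne_zero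
      simp only [hg, smul_eq_mul, inner_smul_right, inner_sub_left, ← Complex.exp_add]
      congr 1
      push_cast
      field_simp
      ring
    rw [hat_eq_fourier, h2, h]
    have : Complex.exp (-Real.pi ^ 2 * ‖(2 * Real.pi)⁻¹ • ξ‖ ^ 2 / 1) =
        (Real.exp (-‖ξ‖ ^ 2 / 4) : ℝ) := by
      push_cast
      congr 1
      rw [norm_smul]
      have : (Real.pi : ℂ) ≠ 0 := by exact_mod_cast Real.pi_ne_zero
      simp only [norm_inv, norm_mul, Real.norm_eq_abs, abs_two, abs_of_pos Real.pi_pos]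
      push_cast
      field_simp
      ring
    rw [this]
    ring

theorem gaussianAt_mem {n : ℕ} (y : V n) : gaussianAt y ∈ GS n := by
  intro a ha
  constructor
  · obtain ⟨B, hB⟩ := exp_quadratic_le a (Real.exp (a * ‖y‖)) 0
    refine ⟨B, ?_⟩
    rintro _ ⟨x, rfl⟩
    refine le_trans ?_ (hB ‖x - y‖ (norm_nonneg _))
    have h : ‖gaussianAt y x‖ = Real.exp (-‖x - y‖ ^ 2) := by
      change ‖((Real.exp (-‖x - y‖ ^ 2) : ℝ) : ℂ)‖ = _
      rw [Complex.norm_real, Real.norm_eq_abs, Real.abs_exp]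
    simp only [h, pow_zero, mul_one, ← Real.exp_add]
    rw [Real.exp_le_exp]
    have := norm_add_le (x - y) y
    rw [sub_add_cancel] at this
    nlinarith [sq_nonneg ‖x - y‖, norm_nonneg (x - y)]
  · obtain ⟨c, -, hc⟩ := hat_gaussianAt n
    obtain ⟨B, hB⟩ := exp_quadratic_le a ‖c‖ 0
    refine ⟨B, ?_⟩
    rintro _ ⟨ξ, rfl⟩
    refine le_trans ?_ (hB ‖ξ‖ (norm_nonneg _))
    have h : ‖hat (gaussianAt y) ξ‖ = ‖c‖ * Real.exp (-‖ξ‖ ^ 2 / 4) := by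
      rw [hc, norm_mul, norm_mul, Complex.norm_real, Real.norm_eq_abs, Real.abs_exp,
        Complex.norm_exp]
      simp
    simp only [h]
    apply le_of_eq
    ring

/-! ### Regular distributions -/

/-- An integrable function whose Fourier transform vanishes is zero almost everywhere. -/
theorem ae_eq_zero_of_fourier_eq_zero {n : ℕ} {h : V n → ℂ} (hi : Integrable h)
    (hz : ∀ w, FourierTransform.fourier h w = 0) : h =ᵐ[volume] 0 := by
  refine ae_eq_zero_of_integral_contDiff_smul_eq_zero hi.locallyIntegrable fun g hg hc => ?_
  have hc' : HasCompactSupport fun x => (g x : ℂ) :=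
    hc.comp_left (g := ((↑) : ℝ → ℂ)) Complex.ofReal_zero
  let G : 𝓢(V n, ℂ) := hc'.toSchwartzMap (Complex.ofRealCLM.contDiff.comp hg)
  have hG : ∀ x, G x = (g x : ℂ) := fun x => rfl
  let P : 𝓢(V n, ℂ) := FourierTransform.fourierInv G
  have hP : ∀ x, FourierTransform.fourier (P : V n → ℂ) x = G x := fun x => by
    rw [← SchwartzMap.fourier_coe, FourierTransform.fourier_fourierInv_eq]
  have := VectorFourier.integral_fourierIntegral_smul_eq_flip (L := innerₗ (V n))
    (μ := volume) (ν := volume) (f := (P : V n → ℂ)) (g := h)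
    Real.continuous_fourierChar continuous_inner P.integrable hi
  calc ∫ x, g x • h x = ∫ x, FourierTransform.fourier (P : V n → ℂ) x • h x := by
        refine integral_congr_ae (Eventually.of_forall fun x => ?_)
        simp [hP, hG]
    _ = ∫ x, P x • FourierTransform.fourier h x := by
        convert! this using 3
        simp [FourierTransform.fourier, flip_innerₗ]
    _ = 0 := by simp [hz]

theorem fourierDual_apply {n : ℕ} (f : GSDual n) (φ : GS n) :
    pair (fourierDual f) φ = pair f (gsHat φ) := rfl

/-- The fourth power of the transform is the identity. Hence distributions may be tested on
transforms `gsHat Φ` only, and the third power serves as the inverse. -/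
theorem gsHat_surjective (n : ℕ) : Function.Surjective (gsHat (n := n)) := by
  intro φ
  refine ⟨gsHat (gsHat (gsHat φ)), Subtype.ext ?_⟩
  ext x
  change hat (hat (hat (hat (φ : 𝓢(V n, ℂ))))) x = _
  rw [hat_hat, hat_hat, neg_neg]

/-- Tested on transforms of translated Gaussians, the difference `F - G` times a fixed Gaussian is
integrable with vanishing Fourier transform. This makes the choice inside `fhat` harmless up to null
sets. -/
theorem HasFourier.ae_eq {n : ℕ} {f : GSDual n} {F G : V n → ℂ} (hF : HasFourier f F)
    (hG : HasFourier f G) : F =ᵐ[volume] G := by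
  obtain ⟨c, hc0, hc⟩ := hat_gaussianAt n
  let γ : V n → ℂ := fun ξ => (Real.exp (-‖ξ‖ ^ 2 / 4) : ℝ)
  have hγ : ∀ ξ, γ ξ ≠ 0 := fun ξ => by
    simp [γ]
  let T : V n → GS n := fun y => gsHat ⟨gaussianAt y, gaussianAt_mem y⟩
  have hT : ∀ y ξ, (T y : 𝓢(V n, ℂ)) ξ =
      c * (Complex.exp (-Complex.I * (inner ℝ y ξ : ℝ)) * γ ξ) := fun y ξ => hc y ξ
  have hint : Integrable fun ξ => (F ξ - G ξ) * (c * γ ξ) := by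
    refine ((hF (T 0)).1.sub (hG (T 0)).1).congr (Eventually.of_forall fun ξ => ?_)
    simp [hT]
    ring
  have hz : ∀ w, FourierTransform.fourier (fun ξ => (F ξ - G ξ) * (c * γ ξ)) w = 0 := by
    intro w
    have h1 := (hF (T ((2 * Real.pi) • w))).2.symm.trans (hG (T ((2 * Real.pi) • w))).2
    rw [← sub_eq_zero, ← integral_sub (hF _).1 (hG _).1] at h1
    rw [Real.fourier_eq', ← h1]
    refine integral_congr_ae (Eventually.of_forall fun ξ => ?_)
    simp only [hT, smul_eq_mul, inner_smul_left, real_inner_comm w ξ]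
    have : ((-2 * Real.pi * inner ℝ w ξ : ℝ) : ℂ) * Complex.I =
        -Complex.I * (((starRingEnd ℝ) (2 * Real.pi) * inner ℝ w ξ : ℝ) : ℂ) := by
      simp only [conj_trivial]
      push_cast
      ring
    rw [this]
    ring
  filter_upwards [ae_eq_zero_of_fourier_eq_zero hint hz] with ξ hξ
  have := (mul_eq_zero.1 hξ).resolve_right (mul_ne_zero hc0 (hγ ξ))
  exact sub_eq_zero.1 this

/-- The product with a test function is measurable by integrability, and the Gaussian test function
vanishes nowhere, so it can be divided out. -/
theorem HasFourier.aestronglyMeasurable {n : ℕ} {f : GSDual n} {F : V n → ℂ}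
    (hF : HasFourier f F) : AEStronglyMeasurable F := by
  let T : GS n := ⟨gaussianAt 0, gaussianAt_mem 0⟩
  have h0 : ∀ ξ, (T : 𝓢(V n, ℂ)) ξ ≠ 0 := fun ξ => by
    change ((Real.exp (-‖ξ - 0‖ ^ 2) : ℝ) : ℂ) ≠ 0
    exact_mod_cast (Real.exp_pos _).ne'
  have h1 := (hF T).1.aestronglyMeasurable
  have h2 : AEStronglyMeasurable (fun ξ => ((T : 𝓢(V n, ℂ)) ξ)⁻¹) :=
    ((T : 𝓢(V n, ℂ)).continuous.inv₀ h0).aestronglyMeasurable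
  refine (h1.mul h2).congr (Eventually.of_forall fun ξ => ?_)
  change F ξ * _ * _ = _
  rw [mul_assoc, mul_inv_cancel₀ (h0 ξ), mul_one]

theorem HasFourier.congr {n : ℕ} {f : GSDual n} {F G : V n → ℂ} (hF : HasFourier f F)
    (h : F =ᵐ[volume] G) : HasFourier f G := by
  intro φ
  have h' : (fun ξ => F ξ * (φ : 𝓢(V n, ℂ)) ξ) =ᵐ[volume]
      fun ξ => G ξ * (φ : 𝓢(V n, ℂ)) ξ := by
    filter_upwards [h] with ξ hξ
    rw [hξ]
  exact ⟨(hF φ).1.congr h', (hF φ).2.trans (integral_congr_ae h')⟩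

theorem HasFourier.fhat {n : ℕ} {f : GSDual n} {F : V n → ℂ} (hF : HasFourier f F) :
    HasFourier f (JMGT.fhat f) := by
  have h : ∃ F : V n → ℂ, HasFourier f F := ⟨F, hF⟩
  rw [JMGT.fhat, dif_pos h]
  exact h.choose_spec

theorem HasFourier.fhat_ae {n : ℕ} {f : GSDual n} {F : V n → ℂ} (hF : HasFourier f F) :
    JMGT.fhat f =ᵐ[volume] F :=
  hF.fhat.ae_eq hF

theorem HasFourier.eq {n : ℕ} {f g : GSDual n} {F : V n → ℂ} (hf : HasFourier f F)
    (hg : HasFourier g F) : f = g := by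
  apply Subtype.ext
  ext φ
  obtain ⟨Φ, rfl⟩ := gsHat_surjective n φ
  exact (hf Φ).2.trans (hg Φ).2.symm

theorem HasFourier.add {n : ℕ} {f g : GSDual n} {F G : V n → ℂ} (hf : HasFourier f F)
    (hg : HasFourier g G) : HasFourier (f + g) (F + G) := by
  intro φ
  simp only [Pi.add_apply, add_mul]
  refine ⟨(hf φ).1.add (hg φ).1, ?_⟩
  rw [integral_add (hf φ).1 (hg φ).1, ← (hf φ).2, ← (hg φ).2]
  rfl

theorem HasFourier.smul {n : ℕ} (c : ℂ) {f : GSDual n} {F : V n → ℂ} (hf : HasFourier f F) :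
    HasFourier (c • f) (c • F) := by
  intro φ
  simp only [Pi.smul_apply, smul_eq_mul, mul_assoc]
  refine ⟨(hf φ).1.const_mul c, ?_⟩
  rw [integral_const_mul, ← (hf φ).2]
  rfl

theorem HasFourier.sub {n : ℕ} {f g : GSDual n} {F G : V n → ℂ} (hf : HasFourier f F)
    (hg : HasFourier g G) : HasFourier (f - g) (F - G) := by
  intro φ
  simp only [Pi.sub_apply, sub_mul]
  refine ⟨(hf φ).1.sub (hg φ).1, ?_⟩
  rw [integral_sub (hf φ).1 (hg φ).1, ← (hf φ).2, ← (hg φ).2]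
  rfl

theorem GS.norm_le {n : ℕ} (φ : GS n) {a : ℝ} (ha : 0 < a) (ξ : V n) :
    ‖(φ : 𝓢(V n, ℂ)) ξ‖ ≤ gsNorm a (φ : 𝓢(V n, ℂ)) * Real.exp (-(a * ‖ξ‖)) := by
  have h := le_ciSup (φ.2 a ha).1 ξ
  have h2 : Real.exp (a * ‖ξ‖) * ‖(φ : 𝓢(V n, ℂ)) ξ‖ ≤ gsNorm a (φ : 𝓢(V n, ℂ)) :=
    h.trans (le_add_of_nonneg_right (Real.iSup_nonneg fun _ => by positivity))
  rw [Real.exp_neg, ← div_eq_mul_inv, le_div_iff₀ (Real.exp_pos _), mul_comm]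
  exact h2

/-- Integrability against some decaying exponential. -/
def ExpIntegrable {n : ℕ} (F : V n → ℂ) : Prop :=
  ∃ a : ℝ, 0 < a ∧ Integrable fun ξ => (Real.exp (-(a * ‖ξ‖)) : ℂ) * F ξ

theorem ExpIntegrable.integrable_mul {n : ℕ} {F : V n → ℂ} {a : ℝ} (ha : 0 < a)
    (hF : Integrable fun ξ => (Real.exp (-(a * ‖ξ‖)) : ℂ) * F ξ) (φ : GS n) :
    Integrable (fun ξ => F ξ * (φ : 𝓢(V n, ℂ)) ξ) ∧
      ‖∫ ξ, F ξ * (φ : 𝓢(V n, ℂ)) ξ‖ ≤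
        (∫ ξ, ‖(Real.exp (-(a * ‖ξ‖)) : ℂ) * F ξ‖) * gsNorm a (φ : 𝓢(V n, ℂ)) := by
  have hm : AEStronglyMeasurable F := by
    have h2 : AEStronglyMeasurable (fun ξ : V n => (Real.exp (a * ‖ξ‖) : ℂ)) :=
      Continuous.aestronglyMeasurable (by fun_prop)
    refine (h2.mul hF.1).congr (Eventually.of_forall fun ξ => ?_)
    change (Real.exp (a * ‖ξ‖) : ℂ) * ((Real.exp (-(a * ‖ξ‖)) : ℂ) * F ξ) = F ξ
    rw [← mul_assoc, ← Complex.ofReal_mul, ← Real.exp_add]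
    simp
  have hb : ∀ ξ, ‖F ξ * (φ : 𝓢(V n, ℂ)) ξ‖ ≤
      ‖(Real.exp (-(a * ‖ξ‖)) : ℂ) * F ξ‖ * gsNorm a (φ : 𝓢(V n, ℂ)) := fun ξ => by
    rw [norm_mul, norm_mul, Complex.norm_real, Real.norm_eq_abs, Real.abs_exp]
    have := mul_le_mul_of_nonneg_left (GS.norm_le φ ha ξ) (norm_nonneg (F ξ))
    linarith
  have hi := hF.norm.mul_const (gsNorm a (φ : 𝓢(V n, ℂ)))
  refine ⟨hi.mono' (hm.mul (φ : 𝓢(V n, ℂ)).continuous.aestronglyMeasurable)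
    (Eventually.of_forall hb), ?_⟩
  rw [← integral_mul_const]
  exact norm_integral_le_of_norm_le hi (Eventually.of_forall hb)

theorem ExpIntegrable.exists_hasFourier {n : ℕ} {F : V n → ℂ} (hF : ExpIntegrable F) :
    ∃ f : GSDual n, HasFourier f F := by
  obtain ⟨a, ha, hF⟩ := hF
  have hint := ExpIntegrable.integrable_mul ha hF
  let f : GS n →ₗ[ℂ] ℂ :=
    -- The threefold transform is the inverse transform, so this functional is the distribution with
    -- symbol `F`.
    { toFun := fun φ => ∫ ξ, F ξ * (gsHat (gsHat (gsHat φ)) : 𝓢(V n, ℂ)) ξ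
      map_add' := fun φ ψ => by
        rw [← integral_add (hint _).1 (hint _).1]
        simp [mul_add]
      map_smul' := fun c φ => by
        rw [RingHom.id_apply, smul_eq_mul, ← integral_const_mul]
        refine integral_congr_ae (Eventually.of_forall fun ξ => ?_)
        simp
        ring }
  refine ⟨⟨f, a, ha, ∫ ξ, ‖(Real.exp (-(a * ‖ξ‖)) : ℂ) * F ξ‖, fun φ => ?_⟩, fun φ =>
    ⟨(hint φ).1, ?_⟩⟩
  · have := (hint (gsHat (gsHat (gsHat φ)))).2
    rw [gsNorm_hat, gsNorm_hat, gsNorm_hat] at this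
    exact this
  · change ∫ ξ, F ξ * hat (hat (hat (hat (φ : 𝓢(V n, ℂ))))) ξ = _
    simp only [hat_hat, neg_neg]

theorem ExpIntegrable.ofFourier {n : ℕ} {F : V n → ℂ} (hF : ExpIntegrable F) :
    HasFourier (JMGT.ofFourier F) F := by
  rw [JMGT.ofFourier, dif_pos hF.exists_hasFourier]
  exact hF.exists_hasFourier.choose_spec

end JMGT
end

noncomputable section

namespace JMGT

/-! ### Decay of the kernels -/

theorem abs_mul_le_energy {s P z w : ℝ} (hs : 1 ≤ s) :
    |P * z| ≤ 1 / 2 * (z ^ 2 + s * w ^ 2 + s * P ^ 2) := by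
  have h1 : P ^ 2 ≤ s * P ^ 2 := le_mul_of_one_le_left (sq_nonneg P) hs
  have h2 : 0 ≤ s * w ^ 2 := by positivity
  have h3 := sq_nonneg (P + z)
  have h4 := sq_nonneg (P - z)
  rw [abs_le]
  constructor <;> linarith

/-- With `z = p + τq` and `w = u + τp` the equation reads `w' = z`, `z' = -ρ²w - δρ²p`. The energy
`(z² + ρ²w² + δτρ²p²)/2` then has derivative `-δρ²p²`, which damps `p` only. The small cross terms
`-ε p z` and `(ε/2τ) w z` add damping of `z` and `w`. All constants are uniform in `ρ ≥ 1`. -/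
theorem energy_decay {τ δ : ℝ} (hτ : 0 < τ) (hδ : 0 < δ) :
    ∃ C c : ℝ, 0 < C ∧ 0 < c ∧ ∀ ρ : ℝ, 1 ≤ ρ → ∀ u p q : ℝ → ℝ,
      (∀ t, HasDerivAt u (p t) t) → (∀ t, HasDerivAt p (q t) t) →
      (∀ t, ∃ y, HasDerivAt q y t ∧
        τ * y + q t + ρ ^ 2 * u t + (δ + τ) * ρ ^ 2 * p t = 0) →
      ∀ t, 0 ≤ t →
        (p t + τ * q t) ^ 2 + ρ ^ 2 * (u t + τ * p t) ^ 2 + ρ ^ 2 * p t ^ 2 ≤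
          C * Real.exp (-(2 * c * t)) * ((p 0 + τ * q 0) ^ 2 +
            ρ ^ 2 * (u 0 + τ * p 0) ^ 2 + ρ ^ 2 * p 0 ^ 2) := by
  -- The coefficient of `ε ρ² p w` left in the derivative of `L` by the two cross terms.
  obtain ⟨k, hk⟩ : ∃ k, k = 1 - δ / (2 * τ) := ⟨_, rfl⟩
  obtain ⟨lam, hlam⟩ : ∃ l, l = min 1 (δ * τ) / 4 := ⟨_, rfl⟩
  have hlam0 : 0 < lam := by rw [hlam]; positivity
  have hl1 : lam ≤ 1 / 4 := by rw [hlam]; linarith [min_le_left 1 (δ * τ)]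
  have hl2 : lam ≤ δ * τ / 4 := by rw [hlam]; linarith [min_le_right 1 (δ * τ)]
  -- The first bound on `ε` lets half of the damping `δρ²p²` absorb the errors of the cross terms;
  -- the second keeps `L` comparable to the energy.
  obtain ⟨ε, hε⟩ : ∃ ε, ε = min (δ / 2 / (δ + 1 / τ + τ * k ^ 2)) (lam / (1 / 2 + 1 / (4 * τ))) :=
    ⟨_, rfl⟩
  have hε0 : 0 < ε := by rw [hε]; positivity
  have he1 : ε * (δ + 1 / τ + τ * k ^ 2) ≤ δ / 2 := by
    rw [← le_div_iff₀ (by positivity), hε]; exact min_le_left _ _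
  have he2 : ε * (1 / 2 + 1 / (4 * τ)) ≤ lam := by
    rw [← le_div_iff₀ (by positivity), hε]; exact min_le_right _ _
  obtain ⟨m, hm⟩ : ∃ m, m = min (δ / 2) (ε / (4 * τ)) := ⟨_, rfl⟩
  have hm0 : 0 < m := by rw [hm]; positivity
  have hm1 : m ≤ δ / 2 := hm ▸ min_le_left _ _
  have hm2 : m ≤ ε / (4 * τ) := hm ▸ min_le_right _ _
  obtain ⟨Lam, hLam⟩ : ∃ L, L = 1 + δ * τ := ⟨_, rfl⟩
  have hLam0 : 0 < Lam := by rw [hLam]; positivity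
  refine ⟨Lam / lam, m / Lam / 2, by positivity, by positivity, fun ρ hρ u p q hu hp hq => ?_⟩
  have hρ2 : 1 ≤ ρ ^ 2 := one_le_pow₀ hρ
  let N : ℝ → ℝ := fun t =>
    (p t + τ * q t) ^ 2 + ρ ^ 2 * (u t + τ * p t) ^ 2 + ρ ^ 2 * p t ^ 2
  let L : ℝ → ℝ := fun t => ((p t + τ * q t) ^ 2 + ρ ^ 2 * (u t + τ * p t) ^ 2 +
    δ * τ * ρ ^ 2 * p t ^ 2) / 2 - ε * (p t * (p t + τ * q t)) +
      ε / (2 * τ) * ((u t + τ * p t) * (p t + τ * q t))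
  have hcross : ∀ t, |L t - ((p t + τ * q t) ^ 2 + ρ ^ 2 * (u t + τ * p t) ^ 2 +
      δ * τ * ρ ^ 2 * p t ^ 2) / 2| ≤ lam * N t := by
    intro t
    have hN : 0 ≤ N t := by positivity
    have h1 : |p t * (p t + τ * q t)| ≤ 1 / 2 * N t :=
      abs_mul_le_energy hρ2
    have h2 : |(u t + τ * p t) * (p t + τ * q t)| ≤ 1 / 2 * N t := by
      have := abs_mul_le_energy (P := u t + τ * p t) (z := p t + τ * q t) (w := p t) hρ2
      simp only [N]
      linarith
    calc _ = |-(ε * (p t * (p t + τ * q t))) +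
          ε / (2 * τ) * ((u t + τ * p t) * (p t + τ * q t))| := by
            congr 1; simp only [L]; ring
      _ ≤ ε * (1 / 2 * N t) + ε / (2 * τ) * (1 / 2 * N t) := by
        refine (abs_add_le _ _).trans (add_le_add ?_ ?_)
        · rw [abs_neg, abs_mul, abs_of_pos hε0]; gcongr
        · rw [abs_mul, abs_of_pos (by positivity : 0 < ε / (2 * τ))]; gcongr
      _ = ε * (1 / 2 + 1 / (4 * τ)) * N t := by field_simp; ring
      _ ≤ _ := by gcongr
  have hlow : ∀ t, lam * N t ≤ L t := by
    intro t
    have h1 := (abs_le.1 (hcross t)).1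
    have h2 : 4 * lam * N t ≤ (p t + τ * q t) ^ 2 + ρ ^ 2 * (u t + τ * p t) ^ 2 +
        δ * τ * ρ ^ 2 * p t ^ 2 := by
      have a1 := mul_le_mul_of_nonneg_right hl1 (sq_nonneg (p t + τ * q t))
      have a2 := mul_le_mul_of_nonneg_right hl1
        (mul_nonneg (zero_le_one.trans hρ2) (sq_nonneg (u t + τ * p t)))
      have a3 := mul_le_mul_of_nonneg_right hl2
        (mul_nonneg (zero_le_one.trans hρ2) (sq_nonneg (p t)))
      simp only [N]
      linarith
    linarith
  have hup : ∀ t, L t ≤ Lam * N t := by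
    intro t
    have h1 := (abs_le.1 (hcross t)).2
    have b1 := sq_nonneg (p t + τ * q t)
    have b2 := mul_nonneg (zero_le_one.trans hρ2) (sq_nonneg (u t + τ * p t))
    have b3 := mul_nonneg (zero_le_one.trans hρ2) (sq_nonneg (p t))
    have a1 := mul_le_mul_of_nonneg_right hl1 (add_nonneg (add_nonneg b1 b2) b3)
    have a4 := mul_nonneg (mul_pos hδ hτ).le (add_nonneg b1 b2)
    have a5 := mul_nonneg (mul_pos hδ hτ).le b3
    simp only [N, hLam] at h1 ⊢
    linarith
  have hder : ∀ t, ∃ d, HasDerivAt L d t ∧ d ≤ -(m * N t) := by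
    intro t
    obtain ⟨y, hy, hode⟩ := hq t
    have hz : HasDerivAt (fun t => p t + τ * q t) (q t + τ * y) t := (hp t).add (hy.const_mul τ)
    have hw : HasDerivAt (fun t => u t + τ * p t) (p t + τ * q t) t :=
      (hu t).add ((hp t).const_mul τ)
    have hd := (((((hz.fun_pow 2).add ((hw.fun_pow 2).const_mul (ρ ^ 2))).add
      (((hp t).fun_pow 2).const_mul (δ * τ * ρ ^ 2))).div_const 2).sub
      (((hp t).mul hz).const_mul ε)).add ((hw.mul hz).const_mul (ε / (2 * τ)))
    refine ⟨_, hd, ?_⟩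
    obtain ⟨z, hz'⟩ : ∃ z, z = p t + τ * q t := ⟨_, rfl⟩
    obtain ⟨w, hw'⟩ : ∃ w, w = u t + τ * p t := ⟨_, rfl⟩
    have hqz : q t = (z - p t) / τ := by rw [hz']; field_simp; ring
    have hyz : q t + τ * y = -(ρ ^ 2 * w) - δ * ρ ^ 2 * p t := by rw [hw']; linarith
    simp only [N, hyz, ← hz', ← hw']
    simp only [hqz]
    generalize p t = P
    have e1 : ε / τ * (P * z) ≤ ε / (4 * τ) * z ^ 2 + ε * (1 / τ) * P ^ 2 := by
      have : 0 ≤ ε / τ * (z / 2 - P) ^ 2 := by positivity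
      have h : ε / τ * (z / 2 - P) ^ 2 =
        ε / (4 * τ) * z ^ 2 + ε * (1 / τ) * P ^ 2 - ε / τ * (P * z) := by field_simp; ring
      linarith
    have e2 : ε * k * (P * w) ≤ ε / (4 * τ) * w ^ 2 + ε * (τ * k ^ 2) * P ^ 2 := by
      have : 0 ≤ ε / τ * (w / 2 - τ * k * P) ^ 2 := by positivity
      have h : ε / τ * (w / 2 - τ * k * P) ^ 2 =
        ε / (4 * τ) * w ^ 2 + ε * (τ * k ^ 2) * P ^ 2 - ε * k * (P * w) := by field_simp; ring
      linarith
    have e3 := mul_le_mul_of_nonneg_left e2 (zero_le_one.trans hρ2)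
    have e4 : ε * (1 / τ) * P ^ 2 ≤ ε * (1 / τ) * (ρ ^ 2 * P ^ 2) := by
      have : P ^ 2 ≤ ρ ^ 2 * P ^ 2 := le_mul_of_one_le_left (sq_nonneg P) hρ2
      gcongr
    have e5 := mul_le_mul_of_nonneg_right he1 (mul_nonneg (zero_le_one.trans hρ2) (sq_nonneg P))
    have e6 := mul_le_mul_of_nonneg_right hm1 (mul_nonneg (zero_le_one.trans hρ2) (sq_nonneg P))
    have e7 := mul_le_mul_of_nonneg_right hm2 (sq_nonneg z)
    have e8 := mul_le_mul_of_nonneg_right hm2 (mul_nonneg (zero_le_one.trans hρ2) (sq_nonneg w))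
    -- The left side is the derivative of `L` in the variables `P, z, w`. Half of the `z²` and `w²`
    -- damping pays for the mixed products through `e1` and `e2`.
    have key : -δ * ρ ^ 2 * P ^ 2 - 2 * (ε / (4 * τ)) * z ^ 2 - 2 * (ε / (4 * τ)) * (ρ ^ 2 * w ^ 2)
        + ε * δ * (ρ ^ 2 * P ^ 2) + ε / τ * (P * z) + ρ ^ 2 * (ε * k * (P * w)) ≤
        -(m * (z ^ 2 + ρ ^ 2 * w ^ 2 + ρ ^ 2 * P ^ 2)) := by
      linarith
    refine le_trans (le_of_eq ?_) key
    rw [hk]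
    field_simp
    ring
  have hanti : Antitone fun t => L t * Real.exp (m / Lam * t) := by
    have hd : ∀ t, ∃ d, HasDerivAt (fun t => L t * Real.exp (m / Lam * t)) d t ∧ d ≤ 0 := by
      intro t
      obtain ⟨d, hd, hle⟩ := hder t
      have he : HasDerivAt (fun t => Real.exp (m / Lam * t))
          (Real.exp (m / Lam * t) * (m / Lam * 1)) t :=
        ((hasDerivAt_id t).const_mul (m / Lam)).exp
      refine ⟨_, hd.mul he, ?_⟩
      have h1 : m / Lam * L t ≤ m * N t := by
        rw [div_mul_eq_mul_div, div_le_iff₀ hLam0, mul_assoc, mul_comm (N t)]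
        exact mul_le_mul_of_nonneg_left (hup t) hm0.le
      have h2 : d + m / Lam * L t ≤ 0 := by linarith
      nlinarith [Real.exp_pos (m / Lam * t)]
    refine antitone_of_deriv_nonpos (fun t => (hd t).choose_spec.1.differentiableAt) fun t => ?_
    rw [(hd t).choose_spec.1.deriv]
    exact (hd t).choose_spec.2
  intro t ht
  have h1 := hanti ht
  simp only [mul_zero, Real.exp_zero, mul_one] at h1
  have h2 : lam * N t * Real.exp (m / Lam * t) ≤ Lam * N 0 :=
    (mul_le_mul_of_nonneg_right (hlow t) (Real.exp_pos _).le).trans (h1.trans (hup 0))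
  have h3 : Real.exp (-(2 * (m / Lam / 2) * t)) = (Real.exp (m / Lam * t))⁻¹ := by
    rw [← Real.exp_neg]; ring_nf
  change N t ≤ Lam / lam * _ * N 0
  rw [h3, div_mul_eq_mul_div, div_mul_eq_mul_div, le_div_iff₀ hlam0,
    mul_right_comm, ← div_eq_mul_inv, le_div_iff₀ (Real.exp_pos _)]
  linarith

/-- `energy_decay` is applied with `ρ = r^σ`. For `j = 0, 1` the initial energy is of order `ρ²` and
controls `ρ²(∂_t K̂_j)²`, which gives plain decay. For `j = 2` it is `τ²` without a factor `ρ²`, and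
this is the gain of `r^σ`. -/
theorem kernel_decay {τ δ σ : ℝ} (hτ : 0 < τ) (hδ : 0 < δ) (hσ : 0 < σ) :
    ∃ C c : ℝ, 0 < C ∧ 0 < c ∧ ∀ t r : ℝ, 0 ≤ t → 1 ≤ r →
      |kernel τ δ σ 1 0 t r| ≤ C * Real.exp (-(c * t)) ∧
      |kernel τ δ σ 1 1 t r| ≤ C * Real.exp (-(c * t)) ∧
      r ^ σ * |kernel τ δ σ 1 2 t r| ≤ C * Real.exp (-(c * t)) ∧
      |kernel τ δ σ 2 2 t r| ≤ C * Real.exp (-(c * t)) := by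
  obtain ⟨C, c, hC, hc, h⟩ := energy_decay hτ hδ
  obtain ⟨C', hC'⟩ : ∃ C', C' = Real.sqrt (2 * C * (2 + τ ^ 2)) := ⟨_, rfl⟩
  have hsq : C' ^ 2 = 2 * C * (2 + τ ^ 2) := hC' ▸ Real.sq_sqrt (by positivity)
  have hC'0 : 0 < C' := hC' ▸ Real.sqrt_pos.2 (by positivity)
  refine ⟨C', c, hC'0, hc, fun t r ht hr => ?_⟩
  have hρ : 1 ≤ r ^ σ := Real.one_le_rpow hr hσ.le
  have hρ2 : (1 : ℝ) ≤ (r ^ σ) ^ 2 := one_le_pow₀ hρ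
  have hr2 : r ^ (2 * σ) = (r ^ σ) ^ 2 := by
    rw [mul_comm, Real.rpow_mul (by linarith), Real.rpow_two]
  have H := fun j : Fin 3 => h (r ^ σ) hρ (fun t => kernel τ δ σ 0 j t r)
    (fun t => kernel τ δ σ 1 j t r) (fun t => kernel τ δ σ 2 j t r)
    (fun t => (kernel_hasDerivAt τ δ σ j t r).1) (fun t => (kernel_hasDerivAt τ δ σ j t r).2)
    (fun t => by
      obtain ⟨y, hy, ho⟩ := kernel_ode hτ.ne' δ σ j t r
      exact ⟨y, hy, hr2 ▸ ho⟩) t ht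
  have hexp : (C' * Real.exp (-(c * t))) ^ 2 =
      2 * (2 + τ ^ 2) * (C * Real.exp (-(2 * c * t))) := by
    rw [mul_pow, hsq, ← Real.exp_nat_mul]
    have : ((2 : ℕ) : ℝ) * -(c * t) = -(2 * c * t) := by push_cast; ring
    rw [this]; ring
  have hE : 0 < C * Real.exp (-(2 * c * t)) := by positivity
  have hpos : 0 ≤ C' * Real.exp (-(c * t)) := by positivity
  generalize C * Real.exp (-(2 * c * t)) = E at *
  generalize C' * Real.exp (-(c * t)) = B at *
  generalize r ^ σ = ρ at *
  have hρ0 : (0 : ℝ) < ρ ^ 2 := by linarith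
  have H0 := H 0
  have H1 := H 1
  have H2 := H 2
  simp [kernel_zero, show (2 : Fin 3) ≠ 0 by decide, show (2 : Fin 3) ≠ 1 by decide,
    show (1 : Fin 3) ≠ 2 by decide, show (0 : Fin 3) ≠ 2 by decide] at H0 H1 H2
  have hEτ : 0 ≤ E * τ ^ 2 := by positivity
  refine ⟨abs_le_of_sq_le_sq ?_ hpos, abs_le_of_sq_le_sq ?_ hpos, ?_, abs_le_of_sq_le_sq ?_ hpos⟩
  · rw [hexp]
    refine le_of_mul_le_mul_left (a := ρ ^ 2) ?_ hρ0
    have h1 := sq_nonneg (kernel τ δ σ 1 0 t r + τ * kernel τ δ σ 2 0 t r)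
    have h2 := mul_nonneg hρ0.le (sq_nonneg (kernel τ δ σ 0 0 t r + τ * kernel τ δ σ 1 0 t r))
    have h3 := mul_nonneg hρ0.le hEτ
    have h4 := mul_nonneg hρ0.le hE.le
    linarith
  · rw [hexp]
    refine le_of_mul_le_mul_left (a := ρ ^ 2) ?_ hρ0
    have h1 := sq_nonneg (kernel τ δ σ 1 1 t r + τ * kernel τ δ σ 2 1 t r)
    have h2 := mul_nonneg hρ0.le (sq_nonneg (kernel τ δ σ 0 1 t r + τ * kernel τ δ σ 1 1 t r))
    have h3 := mul_nonneg hρ0.le hEτ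
    have h4 := mul_le_mul_of_nonneg_right hρ2 hE.le
    linarith
  · rw [← abs_of_pos (zero_lt_one.trans_le hρ), ← abs_mul]
    refine abs_le_of_sq_le_sq ?_ hpos
    rw [hexp]
    have h1 := sq_nonneg (kernel τ δ σ 1 2 t r + τ * kernel τ δ σ 2 2 t r)
    have h2 := mul_nonneg hρ0.le (sq_nonneg (kernel τ δ σ 0 2 t r + τ * kernel τ δ σ 1 2 t r))
    linarith
  · rw [hexp]
    refine le_of_mul_le_mul_left (a := τ ^ 2) ?_ (by positivity)
    -- This square is exactly the gap in `τ²q² ≤ 2(p + τq)² + 2p²`, which isolates the second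
    -- derivative.
    have h1 := sq_nonneg (2 * kernel τ δ σ 1 2 t r + τ * kernel τ δ σ 2 2 t r)
    have h2 := mul_nonneg hρ0.le (sq_nonneg (kernel τ δ σ 0 2 t r + τ * kernel τ δ σ 1 2 t r))
    have h3 := mul_le_mul_of_nonneg_right hρ2 (sq_nonneg (kernel τ δ σ 1 2 t r))
    have h4 : 0 ≤ E * τ ^ 2 * τ ^ 2 := by positivity
    linarith

attribute [local instance] Matrix.linftyOpNormedRing Matrix.linftyOpNormedAlgebra in
theorem continuous_kernel (τ δ : ℝ) {σ : ℝ} (hσ : 0 < σ) (m j : Fin 3) :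
    Continuous fun x : ℝ × ℝ => kernel τ δ σ m j x.1 x.2 := by
  have h1 : Continuous fun r : ℝ => r ^ (2 * σ) := Real.continuous_rpow_const (by positivity)
  have h2 : Continuous fun r : ℝ => companion τ δ σ r := by
    refine continuous_matrix fun a b => ?_
    fin_cases a <;> fin_cases b <;> simp [companion] <;> fun_prop
  have h3 : Continuous fun x : ℝ × ℝ => NormedSpace.exp (x.1 • companion τ δ σ x.2) :=
    NormedSpace.exp_continuous.comp (continuous_fst.smul (h2.comp continuous_snd))
  exact h3.matrix_elem m j

/-- Needed for uniqueness, where competing solutions may have frequencies below one: there decay is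
replaced by compactness of the time and frequency range. -/
theorem kernel_bounded {τ δ σ : ℝ} (hτ : 0 < τ) (hδ : 0 < δ) (hσ : 0 < σ) (T : ℝ) :
    ∃ C : ℝ, 0 < C ∧ ∀ t r : ℝ, 0 ≤ t → t ≤ T → 0 ≤ r → |kernel τ δ σ 2 2 t r| ≤ C := by
  obtain ⟨C, c, hC, hc, h⟩ := kernel_decay hτ hδ hσ
  obtain ⟨B, hB⟩ := (isCompact_Icc.prod isCompact_Icc :
    IsCompact (Icc (0 : ℝ) T ×ˢ Icc (0 : ℝ) 1)).exists_bound_of_continuousOn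
    (continuous_kernel τ δ hσ 2 2).continuousOn
  refine ⟨max C B, lt_max_of_lt_left hC, fun t r ht htT hr => ?_⟩
  rcases le_total r 1 with hr1 | hr1
  · exact (hB (t, r) ⟨⟨ht, htT⟩, hr, hr1⟩).trans (le_max_right _ _)
  · refine ((h t r ht hr1).2.2.2.trans ?_).trans (le_max_left _ _)
    refine mul_le_of_le_one_right hC.le (Real.exp_le_one_iff.2 ?_)
    have := mul_nonneg hc.le ht
    linarith

end JMGT
end

noncomputable section

namespace JMGT

open scoped SchwartzMap

/-! ### Plancherel on frequency cubes -/

/-- Plancherel's identity for the Fourier integral of functions in `L¹ ∩ L²`. -/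
theorem eLpNorm_fourier_eq {n : ℕ} {g : V n → ℂ} (h1 : Integrable g) (h2 : MemLp g 2) :
    eLpNorm (FourierTransform.fourier g) 2 volume = eLpNorm g 2 volume := by
  let G : Lp ℂ 2 (volume : Measure (V n)) := h2.toLp g
  have hG : (G : V n → ℂ) =ᵐ[volume] g := h2.coeFn_toLp
  let H : Lp ℂ 2 (volume : Measure (V n)) := FourierTransform.fourier G
  have hcont : Continuous (FourierTransform.fourier g) :=
    VectorFourier.fourierIntegral_continuous Real.continuous_fourierChar
      (by exact continuous_inner) h1
  -- The `L²` transform, defined by density, is identified with the Fourier integral by moving both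
  -- onto a smooth compactly supported test function.
  have hHg : (H : V n → ℂ) =ᵐ[volume] FourierTransform.fourier g := by
    refine ae_eq_of_integral_contDiff_smul_eq
      ((Lp.memLp H).locallyIntegrable (by norm_num)) hcont.locallyIntegrable fun f hf hc => ?_
    have hc' : HasCompactSupport fun x => (f x : ℂ) :=
      hc.comp_left (g := ((↑) : ℝ → ℂ)) Complex.ofReal_zero
    let φ : 𝓢(V n, ℂ) := hc'.toSchwartzMap (Complex.ofRealCLM.contDiff.comp hf)
    have hφ : ∀ x, φ x = (f x : ℂ) := fun x => rfl
    have e1 := congrArg (fun T : 𝓢'(V n, ℂ) => T φ) (Lp.fourier_toTemperedDistribution_eq G)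
    simp only [TemperedDistribution.fourier_apply, Lp.toTemperedDistribution_apply] at e1
    have e2 := VectorFourier.integral_fourierIntegral_smul_eq_flip (L := innerₗ (V n))
      (μ := volume) (ν := volume) (f := (φ : V n → ℂ)) (g := g)
      Real.continuous_fourierChar continuous_inner φ.integrable h1
    calc ∫ x, f x • (H : V n → ℂ) x = ∫ x, φ x • (H : V n → ℂ) x := by
          refine integral_congr_ae (Eventually.of_forall fun x => ?_)
          simp [hφ]
      _ = ∫ x, (FourierTransform.fourier φ : 𝓢(V n, ℂ)) x • (G : V n → ℂ) x := e1.symm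
      _ = ∫ x, FourierTransform.fourier (φ : V n → ℂ) x • g x := by
          refine integral_congr_ae ?_
          filter_upwards [hG] with x hx
          rw [hx, SchwartzMap.fourier_coe]
      _ = ∫ x, φ x • FourierTransform.fourier g x := by
          convert! e2 using 3
          simp [FourierTransform.fourier, flip_innerₗ]
      _ = _ := by
          refine integral_congr_ae (Eventually.of_forall fun x => ?_)
          simp [hφ]
  rw [← eLpNorm_congr_ae hHg, ← eLpNorm_congr_ae hG, ← ENNReal.toReal_eq_toReal_iff'
    (Lp.memLp H).2.ne (Lp.memLp G).2.ne, ← Lp.norm_def, ← Lp.norm_def]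
  exact Lp.norm_fourier_eq G

theorem lintegral_comp_smul {n : ℕ} {f : V n → ℝ≥0∞} (hf : Measurable f) {R : ℝ} (hR : R ≠ 0) :
    ∫⁻ x, f (R • x) = ENNReal.ofReal |(R ^ n)⁻¹| * ∫⁻ x, f x := by
  have h := Measure.map_addHaar_smul (volume : Measure (V n)) hR
  rw [finrank_euclideanSpace_fin] at h
  rw [← lintegral_map hf (measurable_const_smul R), h, lintegral_smul_measure, smul_eq_mul]

theorem measurableSet_cube {n : ℕ} (k : Fin n → ℤ) : MeasurableSet (cube k) := by
  have : cube k = ⋂ i, {ξ : V n | (k i : ℝ) ≤ ξ i} ∩ {ξ : V n | ξ i < (k i : ℝ) + 1} := by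
    ext ξ; simp [cube]
  rw [this]
  refine MeasurableSet.iInter fun i => ?_
  have hi : Measurable fun ξ : V n => ξ i := (EuclideanSpace.proj (𝕜 := ℝ) i).continuous.measurable
  exact (measurableSet_le measurable_const hi).inter (measurableSet_lt hi measurable_const)

theorem norm_le_sum_abs {n : ℕ} (ξ : V n) : ‖ξ‖ ≤ ∑ i, |ξ i| := by
  rw [EuclideanSpace.norm_eq]
  refine Real.sqrt_le_iff.2 ⟨Finset.sum_nonneg fun i _ => abs_nonneg _, ?_⟩
  simp only [Real.norm_eq_abs]
  exact Finset.sum_sq_le_sq_sum_of_nonneg fun i _ => abs_nonneg _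

theorem norm_sub_corner_le {n : ℕ} {k : Fin n → ℤ} {ξ : V n} (hξ : ξ ∈ cube k) :
    ‖(WithLp.toLp 2 fun i => (k i : ℝ) : V n) - ξ‖ ≤ n := by
  refine (norm_le_sum_abs _).trans ?_
  have : ∀ i ∈ Finset.univ, |((WithLp.toLp 2 fun i => (k i : ℝ) : V n) - ξ) i| ≤ 1 := fun i _ => by
    have := hξ i
    simp only [PiLp.sub_apply]
    rw [abs_le]
    constructor <;> linarith
  simpa using Finset.sum_le_sum this

theorem volume_cube_lt_top {n : ℕ} (k : Fin n → ℤ) : volume (cube k) < ∞ := by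
  refine (measure_mono (t := Metric.closedBall (WithLp.toLp 2 fun i => (k i : ℝ) : V n) n)
    fun ξ hξ => ?_).trans_lt measure_closedBall_lt_top
  rw [Metric.mem_closedBall, dist_comm, dist_eq_norm]
  exact norm_sub_corner_le hξ

theorem disjoint_cube {n : ℕ} : Pairwise (Function.onFun Disjoint (cube (n := n))) := by
  intro k l hkl
  rw [Function.onFun, Set.disjoint_left]
  intro ξ hk hl
  refine hkl (funext fun i => ?_)
  rw [← (Int.floor_eq_iff.2 (hk i)), ← (Int.floor_eq_iff.2 (hl i))]

/-- On a bounded cube square integrability gives integrability, so `box k f` is a Fourier integral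
evaluated at `-x/(2π)`. The Jacobian of this dilation cancels the square of `fourierConst`. -/
theorem eLpNorm_box_eq {n : ℕ} (k : Fin n → ℤ) (f : GSDual n)
    (hf : MemLp (fhat f) 2 (volume.restrict (cube k))) :
    eLpNorm (box k f) 2 volume = eLpNorm (fhat f) 2 (volume.restrict (cube k)) := by
  have hm := measurableSet_cube k
  let g : V n → ℂ := (cube k).indicator (fhat f)
  have h2 : MemLp g 2 volume := (memLp_indicator_iff_restrict hm).2 hf
  have h1 : Integrable g := by
    have : IsFiniteMeasure (volume.restrict (cube k)) := ⟨by simpa using volume_cube_lt_top k⟩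
    rw [← memLp_one_iff_integrable]
    exact (memLp_indicator_iff_restrict hm).2 (hf.mono_exponent (by norm_num))
  have hcont : Continuous (FourierTransform.fourier g) :=
    VectorFourier.fourierIntegral_continuous Real.continuous_fourierChar
      (by exact continuous_inner) h1
  have hbox : ∀ x, box k f x =
      (fourierConst n : ℂ) * FourierTransform.fourier g ((-(2 * Real.pi)⁻¹) • x) := by
    intro x
    rw [box, Real.fourier_eq', ← integral_indicator hm]
    congr 1
    refine integral_congr_ae (Eventually.of_forall fun ξ => ?_)
    by_cases hξ : ξ ∈ cube k
    · simp only [g, Set.indicator_of_mem hξ, smul_eq_mul, inner_smul_right, real_inner_comm x ξ]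
      congr 2
      have : (Real.pi : ℂ) ≠ 0 := by exact_mod_cast Real.pi_ne_zero
      push_cast
      field_simp
    · simp [g, Set.indicator_of_notMem hξ]
  rw [← eLpNorm_indicator_eq_eLpNorm_restrict hm, ← eLpNorm_fourier_eq h1 h2]
  rw [eLpNorm_eq_lintegral_rpow_enorm_toReal (by norm_num) (by norm_num),
    eLpNorm_eq_lintegral_rpow_enorm_toReal (by norm_num) (by norm_num)]
  congr 1
  have hF : Measurable fun x => ‖FourierTransform.fourier g x‖ₑ ^ (2 : ℝ≥0∞).toReal :=
    hcont.measurable.enorm.pow_const _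
  simp only [hbox, enorm_mul, ENNReal.mul_rpow_of_nonneg _ _ ENNReal.toReal_nonneg]
  rw [lintegral_const_mul' _ _ (by simp), lintegral_comp_smul hF (by
    have := Real.two_pi_pos; simp), ← mul_assoc]
  have hconst : ‖(fourierConst n : ℂ)‖ₑ ^ (2 : ℝ≥0∞).toReal *
      ENNReal.ofReal |((-(2 * Real.pi)⁻¹) ^ n)⁻¹| = 1 := by
    have hp : 0 ≤ fourierConst n := (Real.rpow_pos_of_pos Real.two_pi_pos _).le
    rw [← ofReal_norm, Complex.norm_real, Real.norm_of_nonneg hp,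
      ENNReal.toReal_ofNat, ENNReal.ofReal_rpow_of_nonneg hp (by norm_num),
      ← ENNReal.ofReal_mul (by positivity), abs_inv, abs_pow, abs_neg, abs_inv,
      abs_of_pos Real.two_pi_pos, inv_pow, inv_inv, fourierConst, ← Real.rpow_mul
      Real.two_pi_pos.le, ← Real.rpow_natCast (2 * Real.pi) n, ← Real.rpow_add Real.two_pi_pos]
    ring_nf
    simp
  rw [hconst, one_mul]

/-! ### Weights on cubes and the norms of a dominated curve -/

theorem weight_pos {n : ℕ} (α r : ℝ) (ξ : V n) : 0 < weight α r ξ := by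
  unfold weight; positivity

theorem continuous_weight {n : ℕ} (α r : ℝ) : Continuous (weight (n := n) α r) := by
  unfold weight
  refine Continuous.mul (Continuous.rpow_const (by fun_prop) fun ξ => ?_)
    (Continuous.rpow continuous_const (by fun_prop) fun ξ => ?_)
  · left
    positivity
  · left; norm_num

/-- Slow variation of the weight: the corner weight in `normTilde` may be exchanged for the weight
at any point of the cube, at the cost of a constant. -/
theorem weight_le_of_norm_sub_le {n : ℕ} {α r R : ℝ} (hr : 0 ≤ r) {η ξ : V n}
    (h : ‖η - ξ‖ ≤ R) :
    weight α r η ≤ (1 + R) ^ r * 2 ^ (|α| * R) * weight α r ξ := by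
  have hR : 0 ≤ R := (norm_nonneg _).trans h
  have h1 : ‖η‖ ≤ ‖ξ‖ + R := by
    have := norm_add_le (η - ξ) ξ
    rw [sub_add_cancel] at this
    linarith
  have h2 : ‖ξ‖ ≤ ‖η‖ + R := by
    have := norm_sub_le η (η - ξ)
    rw [sub_sub_cancel] at this
    linarith
  have e1 : Real.sqrt (1 + ‖η‖ ^ 2) ≤ (1 + R) * Real.sqrt (1 + ‖ξ‖ ^ 2) := by
    refine Real.sqrt_le_iff.2 ⟨by positivity, ?_⟩
    rw [mul_pow, Real.sq_sqrt (by positivity)]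
    have : ‖η‖ ^ 2 ≤ (‖ξ‖ + R) ^ 2 := by gcongr
    nlinarith [mul_nonneg hR (sq_nonneg (‖ξ‖ - 1)), sq_nonneg (R * ‖ξ‖),
      mul_nonneg hR (sq_nonneg ‖ξ‖)]
  have e2 : (2 : ℝ) ^ (α * ‖η‖) ≤ 2 ^ (|α| * R) * 2 ^ (α * ‖ξ‖) := by
    rw [← Real.rpow_add (by norm_num)]
    refine Real.rpow_le_rpow_of_exponent_le (by norm_num) ?_
    have : α * (‖η‖ - ‖ξ‖) ≤ |α| * R := by
      refine (le_abs_self _).trans ?_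
      rw [abs_mul]
      gcongr
      rw [abs_le]
      constructor <;> linarith
    linarith
  calc weight α r η ≤ ((1 + R) * Real.sqrt (1 + ‖ξ‖ ^ 2)) ^ r *
        (2 ^ (|α| * R) * 2 ^ (α * ‖ξ‖)) := by unfold weight; gcongr
    _ = _ := by
      rw [Real.mul_rpow (by positivity) (by positivity), weight]
      ring

theorem eLpNorm_two_sq {X : Type*} [MeasurableSpace X] {E : Type*} [TopologicalSpace E]
    [ContinuousENorm E] (f : X → E) (μ : Measure X) :
    eLpNorm f 2 μ ^ 2 = ∫⁻ x, ‖f x‖ₑ ^ 2 ∂μ := by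
  rw [eLpNorm_eq_lintegral_rpow_enorm_toReal (by norm_num) (by norm_num)]
  simp only [ENNReal.toReal_ofNat, one_div]
  rw [← ENNReal.rpow_natCast, ← ENNReal.rpow_mul]
  simp

theorem weight_mul_eLpNorm_sq_le {n : ℕ} {α r : ℝ} (hr : 0 ≤ r) (M : V n → ℝ≥0∞)
    (k : Fin n → ℤ) :
    (ENNReal.ofReal (weight α r (WithLp.toLp 2 fun i => (k i : ℝ) : V n)) *
      eLpNorm M 2 (volume.restrict (cube k))) ^ 2 ≤
    ENNReal.ofReal ((1 + n) ^ r * 2 ^ (|α| * n)) ^ 2 *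
      ∫⁻ ξ in cube k, (ENNReal.ofReal (weight α r ξ) * M ξ) ^ 2 := by
  rw [mul_pow, eLpNorm_two_sq, ← lintegral_const_mul' _ _ (by simp),
    ← lintegral_const_mul' _ _ (by simp)]
  refine setLIntegral_mono' (measurableSet_cube k) fun ξ hξ => ?_
  rw [enorm_eq_self, ← mul_pow, ← mul_pow, ← mul_assoc, ← ENNReal.ofReal_mul (by positivity)]
  gcongr
  exact weight_le_of_norm_sub_le hr (norm_sub_corner_le hξ)

theorem normTilde_lt_top_of_le {n : ℕ} {α r : ℝ} (hr : 0 ≤ r) {γ : ℝ≥0∞} {g : ℝ → GSDual n}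
    {M : V n → ℝ≥0∞} {B : ℝ≥0∞} (hB : B ≠ ∞)
    (hM : ∫⁻ ξ, (ENNReal.ofReal (weight α r ξ) * M ξ) ^ 2 < ∞)
    (h : ∀ k, eLpNorm (fun t : ℝ => eLpNorm (box k (g t)) 2 volume) γ (volume.restrict (Ioi 0)) ≤
      B * eLpNorm M 2 (volume.restrict (cube k))) :
    normTilde γ α r g < ∞ := by
  refine ENNReal.rpow_lt_top_of_nonneg (by norm_num) (ne_of_lt ?_)
  calc _ ≤ ∑' k : Fin n → ℤ, B ^ 2 * (ENNReal.ofReal ((1 + n) ^ r * 2 ^ (|α| * n)) ^ 2 *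
          ∫⁻ ξ in cube k, (ENNReal.ofReal (weight α r ξ) * M ξ) ^ 2) := by
        refine ENNReal.tsum_le_tsum fun k => ?_
        refine le_trans ?_ (mul_le_mul_right (weight_mul_eLpNorm_sq_le hr M k) _)
        rw [← mul_pow]
        gcongr ?_ ^ 2
        rw [mul_left_comm]
        exact mul_le_mul_right (h k) _
    _ = B ^ 2 * (ENNReal.ofReal ((1 + n) ^ r * 2 ^ (|α| * n)) ^ 2 *
          ∑' k : Fin n → ℤ, ∫⁻ ξ in cube k, (ENNReal.ofReal (weight α r ξ) * M ξ) ^ 2) := by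
        rw [ENNReal.tsum_mul_left, ENNReal.tsum_mul_left]
    _ ≤ B ^ 2 * (ENNReal.ofReal ((1 + n) ^ r * 2 ^ (|α| * n)) ^ 2 *
          ∫⁻ ξ, (ENNReal.ofReal (weight α r ξ) * M ξ) ^ 2) := by
        rw [← lintegral_iUnion measurableSet_cube disjoint_cube]
        gcongr
        exact Measure.restrict_le_self
    _ < ∞ := by
        exact ENNReal.mul_lt_top (by simp [hB, lt_top_iff_ne_top])
          (ENNReal.mul_lt_top (by simp) hM)

/-- A bound with time and frequency separated settles both norms at once: the exponential is
integrable and at most one on the half line, and the cubes partition the weighted `L²` norm of `M`.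
-/
theorem normTilde_lt_top {n : ℕ} {α r c : ℝ} (hr : 0 ≤ r) (hc : 0 < c) {g : ℝ → GSDual n}
    {M : V n → ℝ≥0∞} (hM : ∫⁻ ξ, (ENNReal.ofReal (weight α r ξ) * M ξ) ^ 2 < ∞)
    (hm : ∀ t, 0 ≤ t → AEStronglyMeasurable (fhat (g t)))
    (h : ∀ t, 0 ≤ t → ∀ᵐ ξ, ‖fhat (g t) ξ‖ₑ ≤ ENNReal.ofReal (Real.exp (-(c * t))) * M ξ) :
    normTilde 1 α r g < ∞ ∧ normTilde ∞ α r g < ∞ := by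
  have hA : ∀ k : Fin n → ℤ, eLpNorm M 2 (volume.restrict (cube k)) < ∞ := by
    intro k
    have h1 := (weight_mul_eLpNorm_sq_le (α := α) hr M k).trans_lt (ENNReal.mul_lt_top (by simp)
      ((setLIntegral_le_lintegral _ _).trans_lt hM))
    have h2 := (ENNReal.pow_lt_top_iff.1 h1).resolve_right (by norm_num)
    by_contra h3
    rw [not_lt, top_le_iff] at h3
    rw [h3, ENNReal.mul_top (by simpa using weight_pos α r _)] at h2
    exact lt_irrefl _ h2
  have hbox : ∀ k, ∀ t, 0 ≤ t → eLpNorm (box k (g t)) 2 volume ≤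
      ENNReal.ofReal (Real.exp (-(c * t))) * eLpNorm M 2 (volume.restrict (cube k)) := by
    intro k t ht
    have h1 : eLpNorm (fhat (g t)) 2 (volume.restrict (cube k)) ≤
        ENNReal.ofReal (Real.exp (-(c * t))) * eLpNorm M 2 (volume.restrict (cube k)) := by
      rw [← ENNReal.pow_le_pow_left_iff (n := 2) (by norm_num), mul_pow, eLpNorm_two_sq,
        eLpNorm_two_sq, ← lintegral_const_mul' _ _ (by simp)]
      refine lintegral_mono_ae (ae_restrict_of_ae ?_)
      filter_upwards [h t ht] with ξ hξ
      rw [enorm_eq_self, ← mul_pow]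
      gcongr
    rw [eLpNorm_box_eq]
    · exact h1
    · exact ⟨(hm t ht).restrict, h1.trans_lt (ENNReal.mul_lt_top (by simp) (hA k))⟩
  constructor
  · refine normTilde_lt_top_of_le hr
      (B := ∫⁻ t in Ioi (0 : ℝ), ENNReal.ofReal (Real.exp (-(c * t)))) ?_ hM fun k => ?_
    · have := (exp_neg_integrableOn_Ioi 0 hc).lintegral_lt_top
      simp only [neg_mul] at this
      exact this.ne
    · rw [eLpNorm_one_eq_lintegral_enorm, ← lintegral_mul_const' _ _ (hA k).ne]
      refine setLIntegral_mono' measurableSet_Ioi fun t ht => ?_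
      rw [enorm_eq_self]
      exact hbox k t (le_of_lt ht)
  · refine normTilde_lt_top_of_le hr (B := 1) (by simp) hM fun k => ?_
    rw [one_mul, eLpNorm_exponent_top]
    refine essSup_le_of_ae_le _ ?_
    filter_upwards [ae_restrict_mem measurableSet_Ioi] with t ht
    rw [enorm_eq_self]
    refine (hbox k t (le_of_lt ht)).trans (mul_le_of_le_one_left' ?_)
    rw [← ENNReal.ofReal_one]
    refine ENNReal.ofReal_le_ofReal (Real.exp_le_one_iff.2 ?_)
    have := mul_pos hc (Set.mem_Ioi.1 ht)
    linarith

end JMGT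
end

noncomputable section

namespace JMGT

/-! ### Convolution estimates for nonnegative functions -/

theorem eLpNorm_two_const_mul {X : Type*} [MeasurableSpace X] {μ : Measure X} {A : ℝ≥0∞}
    (hA : A ≠ ∞) (f : X → ℝ≥0∞) :
    eLpNorm (fun x => A * f x) 2 μ = A * eLpNorm f 2 μ := by
  refine (ENNReal.pow_right_strictMono two_ne_zero).injective ?_
  rw [mul_pow, eLpNorm_two_sq, eLpNorm_two_sq,
    ← lintegral_const_mul' _ _ (by simp [hA])]
  simp [mul_pow]

section Convolution

variable {n : ℕ}

theorem lintegral_lconvolution {f g : V n → ℝ≥0∞} (hf : AEMeasurable f) (hg : AEMeasurable g) :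
    ∫⁻ x, (f ⋆ₗ g) x = (∫⁻ x, f x) * ∫⁻ x, g x := by
  simp only [lconvolution_def]
  rw [lintegral_lintegral_swap (by fun_prop), ← lintegral_mul_const'' _ hf]
  refine lintegral_congr fun y => ?_
  rw [lintegral_const_mul'' _ (by fun_prop), lintegral_add_left_eq_self]

/-- Cauchy–Schwarz for the measure `f(y) dy`, by splitting `f` into two square roots. Integrated in
`x` it is Young's inequality `L¹ ∗ L² ⊆ L²`. -/
theorem lconvolution_sq_le {f g : V n → ℝ≥0∞} (hf : AEMeasurable f) (hg : AEMeasurable g)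
    (x : V n) : (f ⋆ₗ g) x ^ 2 ≤ (∫⁻ y, f y) * (f ⋆ₗ fun y => g y ^ 2) x := by
  have hp : ∀ a : ℝ≥0∞, (a ^ (1 / 2 : ℝ)) ^ (2 : ℝ) = a := fun a => by
    rw [← ENNReal.rpow_mul]; norm_num
  have hp' : ∀ a : ℝ≥0∞, (a ^ (1 / 2 : ℝ)) ^ 2 = a := fun a => by
    rw [← ENNReal.rpow_natCast]; exact hp a
  have hg' : AEMeasurable fun y => g (-y + x) := by fun_prop
  have h := ENNReal.lintegral_mul_le_Lp_mul_Lq (volume : Measure (V n)) (p := 2) (q := 2)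
    ⟨by norm_num, by norm_num, by norm_num⟩ (hf.pow_const (1 / 2 : ℝ))
    ((hf.pow_const (1 / 2 : ℝ)).mul hg')
  simp only [Pi.mul_apply, ENNReal.mul_rpow_of_nonneg _ _ (by norm_num : (0 : ℝ) ≤ 2), hp] at h
  have e : ∀ y, f y ^ (1 / 2 : ℝ) * (f y ^ (1 / 2 : ℝ) * g (-y + x)) = f y * g (-y + x) := by
    intro y
    rw [← mul_assoc, ← pow_two, hp']
  simp only [e] at h
  have h2 := pow_le_pow_left₀ zero_le h 2
  rw [mul_pow, hp', hp'] at h2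
  simp only [lconvolution_def]
  simpa using h2

theorem lintegral_lconvolution_sq_le {f g : V n → ℝ≥0∞} (hf : AEMeasurable f)
    (hg : AEMeasurable g) :
    ∫⁻ x, (f ⋆ₗ g) x ^ 2 ≤ (∫⁻ x, f x) ^ 2 * ∫⁻ x, g x ^ 2 := by
  refine (lintegral_mono fun x => lconvolution_sq_le hf hg x).trans ?_
  rw [lintegral_const_mul'' _ (aemeasurable_lconvolution hf (hg.pow_const 2)),
    lintegral_lconvolution hf (hg.pow_const 2), pow_two, mul_assoc]

end Convolution

/-! ### The weights `2^{β ∑ ξ_i}` and `⟨ξ⟩^r` -/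

section Weights

variable {n : ℕ}

/-- The linear form `∑ ξ_i`, which is comparable to `|ξ|` on the first octant. -/
def coordSum (ξ : V n) : ℝ := ∑ i, ξ i

theorem coordSum_add (η ξ : V n) : coordSum (η + ξ) = coordSum η + coordSum ξ := by
  simp [coordSum, Finset.sum_add_distrib]

theorem continuous_coordSum : Continuous (coordSum (n := n)) := by
  unfold coordSum
  fun_prop

theorem abs_coordSum_le (ξ : V n) : |coordSum ξ| ≤ n * ‖ξ‖ := by
  refine (Finset.abs_sum_le_sum_abs _ _).trans ?_
  have : ∀ i ∈ Finset.univ, |ξ i| ≤ ‖ξ‖ := fun i _ => PiLp.norm_apply_le ξ i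
  simpa using Finset.sum_le_sum this

theorem norm_le_coordSum {ξ : V n} (h : ∀ j, 0 ≤ ξ j) : ‖ξ‖ ≤ coordSum ξ := by
  refine (norm_le_sum_abs ξ).trans_eq ?_
  exact Finset.sum_congr rfl fun i _ => abs_of_nonneg (h i)

/-- The multiplicative weight `2^{β ∑ ξ_i}`. -/
def expWeight (β : ℝ) (ξ : V n) : ℝ := (2 : ℝ) ^ (β * coordSum ξ)

theorem expWeight_pos (β : ℝ) (ξ : V n) : 0 < expWeight β ξ := by
  unfold expWeight; positivity

theorem expWeight_add (β : ℝ) (η ξ : V n) :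
    expWeight β (η + ξ) = expWeight β η * expWeight β ξ := by
  rw [expWeight, coordSum_add, mul_add, Real.rpow_add (by norm_num)]
  rfl

theorem continuous_expWeight (β : ℝ) : Continuous (expWeight (n := n) β) := by
  unfold expWeight
  refine Continuous.rpow continuous_const (continuous_const.mul continuous_coordSum) fun ξ => ?_
  left; norm_num

/-- The weight `⟨ξ⟩^r`. -/
def japWeight (r : ℝ) (ξ : V n) : ℝ := Real.sqrt (1 + ‖ξ‖ ^ 2) ^ r

theorem japWeight_pos (r : ℝ) (ξ : V n) : 0 < japWeight r ξ := by
  unfold japWeight; positivity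

theorem continuous_japWeight (r : ℝ) : Continuous (japWeight (n := n) r) := by
  unfold japWeight
  refine Continuous.rpow_const (by fun_prop) fun ξ => ?_
  left
  positivity

/-- The bracket `⟨·⟩` is subadditive, and the sum is at most twice the larger term. -/
theorem japWeight_add_le {r : ℝ} (hr : 0 ≤ r) (η ξ : V n) :
    japWeight r (η + ξ) ≤ 2 ^ r * (japWeight r η + japWeight r ξ) := by
  have h0 : Real.sqrt (1 + ‖η + ξ‖ ^ 2) ≤
      Real.sqrt (1 + ‖η‖ ^ 2) + Real.sqrt (1 + ‖ξ‖ ^ 2) := by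
    refine Real.sqrt_le_iff.2 ⟨by positivity, ?_⟩
    have h1 := Real.sq_sqrt (by positivity : 0 ≤ 1 + ‖η‖ ^ 2)
    have h2 := Real.sq_sqrt (by positivity : 0 ≤ 1 + ‖ξ‖ ^ 2)
    have h3 : ‖η‖ ≤ Real.sqrt (1 + ‖η‖ ^ 2) := Real.le_sqrt_of_sq_le (by linarith)
    have h4 : ‖ξ‖ ≤ Real.sqrt (1 + ‖ξ‖ ^ 2) := Real.le_sqrt_of_sq_le (by linarith)
    have h5 := mul_le_mul h3 h4 (norm_nonneg _) (Real.sqrt_nonneg _)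
    have h6 : ‖η + ξ‖ ^ 2 ≤ (‖η‖ + ‖ξ‖) ^ 2 := by
      gcongr; exact norm_add_le _ _
    nlinarith
  have key : ∀ a b : ℝ, 0 ≤ a → 0 ≤ b → a ≤ b → (a + b) ^ r ≤ 2 ^ r * (a ^ r + b ^ r) := by
    intro a b ha hb hab
    calc (a + b) ^ r ≤ (2 * b) ^ r := by gcongr; linarith
      _ = 2 ^ r * b ^ r := Real.mul_rpow (by norm_num) hb
      _ ≤ _ := by
        gcongr
        have := Real.rpow_nonneg ha r
        linarith
  unfold japWeight
  refine (Real.rpow_le_rpow (Real.sqrt_nonneg _) h0 hr).trans ?_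
  rcases le_total (Real.sqrt (1 + ‖η‖ ^ 2)) (Real.sqrt (1 + ‖ξ‖ ^ 2)) with h | h
  · exact key _ _ (Real.sqrt_nonneg _) (Real.sqrt_nonneg _) h
  · rw [add_comm, add_comm (Real.sqrt (1 + ‖η‖ ^ 2) ^ r)]
    exact key _ _ (Real.sqrt_nonneg _) (Real.sqrt_nonneg _) h

/-- `2^{β ∑ ξ_i}` as an extended nonnegative number. -/
def eExp (β : ℝ) (ξ : V n) : ℝ≥0∞ := ENNReal.ofReal (expWeight β ξ)

/-- `⟨ξ⟩^r` as an extended nonnegative number. -/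
def eJap (r : ℝ) (ξ : V n) : ℝ≥0∞ := ENNReal.ofReal (japWeight r ξ)

@[fun_prop]
theorem measurable_eExp (β : ℝ) : Measurable (eExp (n := n) β) :=
  (continuous_expWeight β).measurable.ennreal_ofReal

@[fun_prop]
theorem measurable_eJap (r : ℝ) : Measurable (eJap (n := n) r) :=
  (continuous_japWeight r).measurable.ennreal_ofReal

theorem eExp_add (β : ℝ) (η ξ : V n) : eExp β (η + ξ) = eExp β η * eExp β ξ := by
  rw [eExp, expWeight_add, ENNReal.ofReal_mul (expWeight_pos β η).le]
  rfl

theorem eJap_add_le {r : ℝ} (hr : 0 ≤ r) (η ξ : V n) :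
    eJap r (η + ξ) ≤ ENNReal.ofReal (2 ^ r) * (eJap r η + eJap r ξ) := by
  rw [eJap, eJap, eJap, ← ENNReal.ofReal_add (japWeight_pos r η).le (japWeight_pos r ξ).le,
    ← ENNReal.ofReal_mul (by positivity)]
  exact ENNReal.ofReal_le_ofReal (japWeight_add_le hr η ξ)

/-- The exact distribution of the weight over a convolution is the reason for using `coordSum`
instead of the norm: no constant depending on `β` appears, so `β` can be lowered freely. -/
theorem eExp_mul_lconvolution (β : ℝ) {f g : V n → ℝ≥0∞} (x : V n) :
    eExp β x * (f ⋆ₗ g) x =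
      ((fun y => eExp β y * f y) ⋆ₗ (fun y => eExp β y * g y)) x := by
  simp only [lconvolution_def]
  rw [← lintegral_const_mul' _ _ (by simp [eExp])]
  refine lintegral_congr fun y => ?_
  have : eExp β x = eExp β y * eExp β (-y + x) := by rw [← eExp_add]; simp
  rw [this]
  ring

theorem eJap_mul_lconvolution_le {r : ℝ} (hr : 0 ≤ r) {f g : V n → ℝ≥0∞} (hf : Measurable f)
    (hg : Measurable g) (x : V n) :
    eJap r x * (f ⋆ₗ g) x ≤ ENNReal.ofReal (2 ^ r) *
      (((fun y => eJap r y * f y) ⋆ₗ g) x + (f ⋆ₗ fun y => eJap r y * g y) x) := by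
  simp only [lconvolution_def]
  rw [← lintegral_const_mul' _ _ (by simp [eJap]), ← lintegral_add_left (by fun_prop),
    ← lintegral_const_mul' _ _ (by simp)]
  refine lintegral_mono fun y => ?_
  have : eJap r x ≤ ENNReal.ofReal (2 ^ r) * (eJap r y + eJap r (-y + x)) := by
    have := eJap_add_le hr y (-y + x)
    rwa [add_neg_cancel_left] at this
  calc eJap r x * (f y * g (-y + x)) ≤
      ENNReal.ofReal (2 ^ r) * (eJap r y + eJap r (-y + x)) * (f y * g (-y + x)) := by gcongr
    _ = _ := by ring

theorem lintegral_eExp_mul_lconvolution (β : ℝ) {f g : V n → ℝ≥0∞} (hf : Measurable f)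
    (hg : Measurable g) :
    ∫⁻ x, eExp β x * (f ⋆ₗ g) x = (∫⁻ x, eExp β x * f x) * ∫⁻ x, eExp β x * g x := by
  simp only [eExp_mul_lconvolution]
  exact lintegral_lconvolution (by fun_prop) (by fun_prop)

/-- A tame estimate: `⟨ξ⟩^r` falls on one factor and the other is measured in weighted `L¹` only.
The bound is linear in the `L²` norm, so that norm never has to be small. -/
theorem eLpNorm_weight_mul_lconvolution_self_le (β : ℝ) {r : ℝ} (hr : 0 ≤ r) {f : V n → ℝ≥0∞}
    (hf : Measurable f) :
    eLpNorm (fun x => eJap r x * (eExp β x * (f ⋆ₗ f) x)) 2 volume ≤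
      ENNReal.ofReal (2 ^ r) * (2 * ((∫⁻ x, eExp β x * f x) *
        eLpNorm (fun x => eJap r x * (eExp β x * f x)) 2 volume)) := by
  let g : V n → ℝ≥0∞ := fun x => eExp β x * f x
  have hg : Measurable g := by fun_prop
  let h : V n → ℝ≥0∞ := fun x => eJap r x * g x
  have hh : Measurable h := by fun_prop
  have h1 : ∀ x, eJap r x * (eExp β x * (f ⋆ₗ f) x) ≤
      ENNReal.ofReal (2 ^ r) * (2 * (g ⋆ₗ h) x) := fun x => by
    rw [eExp_mul_lconvolution, two_mul]
    refine (eJap_mul_lconvolution_le hr hg hg x).trans_eq ?_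
    change _ * ((h ⋆ₗ g) x + _) = _
    rw [lconvolution_comm (f := h)]
  have h2 : ENNReal.ofReal (2 ^ r) ≠ ∞ := by simp
  rw [← ENNReal.pow_le_pow_left_iff (n := 2) (by norm_num), eLpNorm_two_sq, mul_pow, mul_pow]
  calc _ ≤ ∫⁻ x, ENNReal.ofReal (2 ^ r) ^ 2 * (2 ^ 2 * (g ⋆ₗ h) x ^ 2) := by
        refine lintegral_mono fun x => ?_
        rw [enorm_eq_self, ← mul_pow, ← mul_pow]
        exact pow_le_pow_left₀ zero_le (h1 x) 2
    _ = ENNReal.ofReal (2 ^ r) ^ 2 * (2 ^ 2 * ∫⁻ x, (g ⋆ₗ h) x ^ 2) := by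
        rw [lintegral_const_mul' _ _ (by simp), lintegral_const_mul' _ _ (by simp)]
    _ ≤ _ := by
        gcongr
        refine (lintegral_lconvolution_sq_le hg.aemeasurable hh.aemeasurable).trans_eq ?_
        rw [mul_pow, eLpNorm_two_sq]
        simp [g, h]

end Weights

/-! ### The majorant equation `M = D + A M ∗ M` -/

section Majorant

variable {n : ℕ}

/-- The iterates of `M ↦ D + A M ∗ M`. -/
def majorant (A : ℝ≥0∞) (D : V n → ℝ≥0∞) : ℕ → V n → ℝ≥0∞
  | 0 => 0
  | k + 1 => fun ξ => D ξ + A * (majorant A D k ⋆ₗ majorant A D k) ξ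

theorem measurable_majorant (A : ℝ≥0∞) {D : V n → ℝ≥0∞} (hD : Measurable D) (k : ℕ) :
    Measurable (majorant A D k) := by
  induction k with
  | zero => exact measurable_const
  | succ k ih =>
    simp only [majorant]
    exact hD.add ((measurable_lconvolution _ ih ih).const_mul A)

theorem monotone_majorant (A : ℝ≥0∞) (D : V n → ℝ≥0∞) : Monotone (majorant A D) := by
  refine monotone_nat_of_le_succ fun k => ?_
  induction k with
  | zero => exact fun ξ => zero_le
  | succ k ih =>
    intro ξ
    simp only [majorant, lconvolution_def] at ih ⊢
    gcongr with y
    · exact ih y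
    · exact ih (-y + ξ)

/-- The ball of radius `2a` is stable: `a + A(2a)² = a + (4Aa)a ≤ 2a`. -/
theorem lintegral_majorant_le (β : ℝ) {A : ℝ≥0∞} (hA : A ≠ ∞) {D : V n → ℝ≥0∞}
    (hD : Measurable D) (h : A * (4 * ∫⁻ ξ, eExp β ξ * D ξ) ≤ 1) (k : ℕ) :
    ∫⁻ ξ, eExp β ξ * majorant A D k ξ ≤ 2 * ∫⁻ ξ, eExp β ξ * D ξ := by
  induction k with
  | zero => simp [majorant]
  | succ k ih =>
    have hm := measurable_majorant A hD k
    set a := ∫⁻ ξ, eExp β ξ * D ξ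
    calc ∫⁻ ξ, eExp β ξ * majorant A D (k + 1) ξ
        = a + A * ∫⁻ ξ, eExp β ξ * (majorant A D k ⋆ₗ majorant A D k) ξ := by
          rw [← lintegral_const_mul' _ _ hA, ← lintegral_add_left (by fun_prop)]
          refine lintegral_congr fun ξ => ?_
          simp only [majorant]
          ring
      _ ≤ a + A * ((2 * a) * (2 * a)) := by
          rw [lintegral_eExp_mul_lconvolution β hm hm]
          gcongr
      _ = a + A * (4 * a) * a := by ring
      _ ≤ a + 1 * a := by gcongr
      _ = 2 * a := by ring

/-- The tame estimate turns the `L²` bound `2b` of one iterate into `b + A·2^r·8a·b` for the next.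
The smallness condition thus involves only the weighted `L¹` norm `a` of `D`. -/
theorem eLpNorm_majorant_le (β : ℝ) {r : ℝ} (hr : 0 ≤ r) {A : ℝ≥0∞} {D : V n → ℝ≥0∞}
    (hD : Measurable D) (hA : A ≠ ∞)
    (h : A * (ENNReal.ofReal (2 ^ r) * (8 * ∫⁻ ξ, eExp β ξ * D ξ)) ≤ 1) (k : ℕ) :
    eLpNorm (fun ξ => eJap r ξ * (eExp β ξ * majorant A D k ξ)) 2 volume ≤
      2 * eLpNorm (fun ξ => eJap r ξ * (eExp β ξ * D ξ)) 2 volume := by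
  have h4 : A * (4 * ∫⁻ ξ, eExp β ξ * D ξ) ≤ 1 := by
    refine le_trans ?_ h
    gcongr A * ?_
    calc 4 * ∫⁻ ξ, eExp β ξ * D ξ ≤ 1 * (8 * ∫⁻ ξ, eExp β ξ * D ξ) := by
          rw [one_mul]; gcongr; norm_num
      _ ≤ _ := by
          gcongr
          rw [← ENNReal.ofReal_one]
          exact ENNReal.ofReal_le_ofReal (Real.one_le_rpow (by norm_num) hr)
  induction k with
  | zero => simp [majorant]
  | succ k ih =>
    have hm := measurable_majorant A hD k
    have ha := lintegral_majorant_le β hA hD h4 k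
    set a := ∫⁻ ξ, eExp β ξ * D ξ
    set b := eLpNorm (fun ξ => eJap r ξ * (eExp β ξ * D ξ)) 2 volume
    have hconv : Measurable (majorant A D k ⋆ₗ majorant A D k) := measurable_lconvolution _ hm hm
    calc eLpNorm (fun ξ => eJap r ξ * (eExp β ξ * majorant A D (k + 1) ξ)) 2 volume
        = eLpNorm ((fun ξ => eJap r ξ * (eExp β ξ * D ξ)) + fun ξ =>
            A * (eJap r ξ * (eExp β ξ * (majorant A D k ⋆ₗ majorant A D k) ξ))) 2 volume := by
          congr 1
          ext ξ
          simp only [majorant, Pi.add_apply]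
          ring
      _ ≤ b + A * eLpNorm (fun ξ =>
            eJap r ξ * (eExp β ξ * (majorant A D k ⋆ₗ majorant A D k) ξ)) 2 volume := by
          rw [← eLpNorm_two_const_mul hA]
          exact eLpNorm_add_le (Measurable.aestronglyMeasurable (by fun_prop))
            (Measurable.aestronglyMeasurable (by fun_prop)) (by norm_num)
      _ ≤ b + A * (ENNReal.ofReal (2 ^ r) * (2 * ((2 * a) * (2 * b)))) := by
          gcongr
          refine (eLpNorm_weight_mul_lconvolution_self_le β hr hm).trans ?_
          gcongr
      _ = b + A * (ENNReal.ofReal (2 ^ r) * (8 * a)) * b := by ring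
      _ ≤ b + 1 * b := by gcongr
      _ = 2 * b := by ring

/-- The supremum of the iterates. -/
def majorantSup (A : ℝ≥0∞) (D : V n → ℝ≥0∞) (ξ : V n) : ℝ≥0∞ := ⨆ k, majorant A D k ξ

theorem measurable_majorantSup (A : ℝ≥0∞) {D : V n → ℝ≥0∞} (hD : Measurable D) :
    Measurable (majorantSup A D) :=
  Measurable.iSup fun k => measurable_majorant A hD k

theorem le_majorantSup (A : ℝ≥0∞) (D : V n → ℝ≥0∞) (k : ℕ) (ξ : V n) :
    majorant A D k ξ ≤ majorantSup A D ξ :=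
  le_iSup (fun k => majorant A D k ξ) k

/-- The iterates increase, so monotone convergence passes their uniform bounds to the supremum. -/
theorem majorantSup_bounds (β : ℝ) {r : ℝ} (hr : 0 ≤ r) {A : ℝ≥0∞} {D : V n → ℝ≥0∞}
    (hD : Measurable D) (hA : A ≠ ∞)
    (h : A * (ENNReal.ofReal (2 ^ r) * (8 * ∫⁻ ξ, eExp β ξ * D ξ)) ≤ 1)
    (h1 : ∫⁻ ξ, eExp β ξ * D ξ < ∞)
    (h2 : ∫⁻ ξ, (eJap r ξ * (eExp β ξ * D ξ)) ^ 2 < ∞) :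
    ∫⁻ ξ, eExp β ξ * majorantSup A D ξ < ∞ ∧
      ∫⁻ ξ, (eJap r ξ * (eExp β ξ * majorantSup A D ξ)) ^ 2 < ∞ := by
  have h4 : A * (4 * ∫⁻ ξ, eExp β ξ * D ξ) ≤ 1 := by
    refine le_trans ?_ h
    gcongr A * ?_
    calc 4 * ∫⁻ ξ, eExp β ξ * D ξ ≤ 1 * (8 * ∫⁻ ξ, eExp β ξ * D ξ) := by
          rw [one_mul]; gcongr; norm_num
      _ ≤ _ := by
          gcongr
          rw [← ENNReal.ofReal_one]
          exact ENNReal.ofReal_le_ofReal (Real.one_le_rpow (by norm_num) hr)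
  have hm := measurable_majorant A hD
  have hmono := monotone_majorant A D
  constructor
  · simp only [majorantSup, ENNReal.mul_iSup]
    rw [lintegral_iSup (fun k => by fun_prop) fun i j hij ξ => by
      have := hmono hij ξ
      dsimp only
      gcongr]
    exact (iSup_le (lintegral_majorant_le β hA hD h4)).trans_lt (ENNReal.mul_lt_top (by simp) h1)
  · simp only [majorantSup, ENNReal.mul_iSup, ENNReal.iSup_pow]
    rw [lintegral_iSup (fun k => by fun_prop) fun i j hij ξ => by
      have := hmono hij ξ
      dsimp only
      gcongr]
    refine (iSup_le fun k => ?_).trans_lt (ENNReal.mul_lt_top (by simp : (2 : ℝ≥0∞) ^ 2 < ∞) h2)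
    have := pow_le_pow_left₀ zero_le (eLpNorm_majorant_le β hr hD hA h k) 2
    rw [mul_pow, eLpNorm_two_sq, eLpNorm_two_sq] at this
    simpa using this

end Majorant

end JMGT
end

noncomputable section

namespace JMGT

/-! ### The octant -/

section Octant

variable {n : ℕ}

theorem le_coordSum_of_mem_octant {R : ℝ} {ξ : V n} (h : ξ ∈ octant n R) : R ≤ coordSum ξ := by
  have h0 : 0 ≤ coordSum ξ := Finset.sum_nonneg fun i _ => h.1 i
  refine h.2.trans ((pi_norm_le_iff_of_nonneg h0).2 fun i => ?_)
  rw [Real.norm_eq_abs, abs_of_nonneg (h.1 i)]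
  exact Finset.single_le_sum (f := fun i => ξ i) (fun j _ => h.1 j) (Finset.mem_univ i)

theorem le_norm_of_mem_octant {R : ℝ} {ξ : V n} (h : ξ ∈ octant n R) : R ≤ ‖ξ‖ := by
  refine h.2.trans ((pi_norm_le_iff_of_nonneg (norm_nonneg _)).2 fun i => ?_)
  exact PiLp.norm_apply_le ξ i

/-- Adding nonnegative coordinates cannot lower the maximum norm. Only one summand has to be far
from the origin. -/
theorem add_mem_octant {R : ℝ} {η ζ : V n} (hη : η ∈ octant n R) (hζ : ∀ j, 0 ≤ ζ j) :
    η + ζ ∈ octant n R := by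
  refine ⟨fun j => add_nonneg (hη.1 j) (hζ j),
    hη.2.trans ((pi_norm_le_iff_of_nonneg (norm_nonneg _)).2 fun i => ?_)⟩
  refine le_trans ?_ (norm_le_pi_norm (WithLp.ofLp (η + ζ)) i)
  simp only [PiLp.add_apply, Real.norm_eq_abs]
  rw [abs_of_nonneg (hη.1 i), abs_of_nonneg (add_nonneg (hη.1 i) (hζ i))]
  linarith [hζ i]

theorem octant_anti {R R' : ℝ} (h : R ≤ R') : octant n R' ⊆ octant n R :=
  fun _ hξ => ⟨hξ.1, h.trans hξ.2⟩

theorem isClosed_octant (R : ℝ) : IsClosed (octant n R) := by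
  have : octant n R = (⋂ j, {ξ : V n | 0 ≤ ξ j}) ∩ {ξ : V n | R ≤ ‖WithLp.ofLp ξ‖} := by
    ext ξ; simp [octant]
  rw [this]
  refine (isClosed_iInter fun j => ?_).inter ?_
  · exact isClosed_le continuous_const (by fun_prop)
  · exact isClosed_le continuous_const (by fun_prop)

end Octant

/-! ### Picard iteration on the Fourier side -/

section Picard

variable {n : ℕ}

/-- The convolution square `ξ ↦ ∫ F(η) F(ξ - η) dη`. -/
def convSq (F : V n → ℂ) (ξ : V n) : ℂ := ∫ η, F η * F (ξ - η)

/-- Picard iterates of `V(t,ξ) = S(t,ξ) + ∫_0^t K(t-θ,ξ) (V(θ) ∗ V(θ))(ξ) dθ`. -/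
def picard (S K : ℝ → V n → ℂ) : ℕ → ℝ → V n → ℂ
  | 0 => fun _ _ => 0
  | k + 1 => fun t ξ => S t ξ + ∫ θ in Ioc 0 t, K (t - θ) ξ * convSq (picard S K k θ) ξ

/-- The standing assumptions on source and kernel: support in the octant and exponential decay. -/
structure IsDamped (S K : ℝ → V n → ℂ) (c B : ℝ) (D : V n → ℝ≥0∞) : Prop where
  c_pos : 0 < c
  B_pos : 0 < B
  measurable_D : Measurable D
  measurable_S : Measurable (Function.uncurry S)
  measurable_K : Measurable (Function.uncurry K)
  S_eq_zero : ∀ t ξ, ξ ∉ octant n 1 → S t ξ = 0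
  K_eq_zero : ∀ t ξ, ξ ∉ octant n 1 → K t ξ = 0
  S_le : ∀ t ξ, 0 ≤ t → ‖S t ξ‖ₑ ≤ ENNReal.ofReal (Real.exp (-(c * t))) * D ξ
  K_le : ∀ t ξ, 0 ≤ t → ‖K t ξ‖ₑ ≤ ENNReal.ofReal (B * Real.exp (-(c * t)))
  continuous_S : ∀ ξ, Continuous fun t => S t ξ
  continuous_K : ∀ ξ, Continuous fun t => K t ξ

/-- The fixed point of the Picard iteration: at each frequency the iterates become stationary. -/
def picardLim (S K : ℝ → V n → ℂ) (t : ℝ) (ξ : V n) : ℂ := picard S K ⌊coordSum ξ⌋₊ t ξ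

theorem measurable_convSq {F : ℝ → V n → ℂ} (hF : Measurable (Function.uncurry F)) :
    Measurable (Function.uncurry fun θ ξ => convSq (F θ) ξ) := by
  have h : Measurable fun p : (ℝ × V n) × V n => F p.1.1 p.2 * F p.1.1 (p.1.2 - p.2) := by
    refine Measurable.mul ?_ ?_
    · exact hF.comp ((measurable_fst.comp measurable_fst).prodMk measurable_snd)
    · exact hF.comp ((measurable_fst.comp measurable_fst).prodMk
        ((measurable_snd.comp measurable_fst).sub measurable_snd))
  exact (h.stronglyMeasurable.integral_prod_right' (ν := volume)).measurable

theorem measurable_duhamel {K Q : ℝ → V n → ℂ} (hK : Measurable (Function.uncurry K))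
    (hQ : Measurable (Function.uncurry Q)) :
    Measurable (Function.uncurry fun t ξ => ∫ θ in Ioc 0 t, K (t - θ) ξ * Q θ ξ) := by
  have h : Measurable fun p : (ℝ × V n) × ℝ =>
      Set.indicator {p : (ℝ × V n) × ℝ | p.2 ∈ Ioc 0 p.1.1}
        (fun p => K (p.1.1 - p.2) p.1.2 * Q p.2 p.1.2) p := by
    refine Measurable.indicator (Measurable.mul ?_ ?_) ?_
    · exact hK.comp (((measurable_fst.comp measurable_fst).sub measurable_snd).prodMk
        (measurable_snd.comp measurable_fst))
    · exact hQ.comp (measurable_snd.prodMk (measurable_snd.comp measurable_fst))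
    · exact (measurableSet_lt measurable_const measurable_snd).inter
        (measurableSet_le measurable_snd (measurable_fst.comp measurable_fst))
  have h2 := (h.stronglyMeasurable.integral_prod_right' (ν := volume)).measurable
  convert! h2 using 1
  ext ⟨t, ξ⟩
  simp only [Function.uncurry]
  rw [← integral_indicator measurableSet_Ioc]
  rfl

theorem convSq_eq_zero {F : V n → ℂ} {R : ℝ} (hF : ∀ ξ, ξ ∉ octant n R → F ξ = 0)
    {ξ : V n} (hξ : ξ ∉ octant n R) : convSq F ξ = 0 := by
  rw [convSq, ← integral_zero (V n) ℂ]
  congr 1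
  ext η
  by_cases h1 : η ∈ octant n R
  · by_cases h2 : ξ - η ∈ octant n R
    · exact absurd (by simpa using add_mem_octant h1 h2.1) hξ
    · rw [hF _ h2, mul_zero]
  · rw [hF _ h1, zero_mul]

theorem enorm_convSq_le {F : V n → ℂ} {M : V n → ℝ≥0∞} {a : ℝ≥0∞} (ha : a ≠ ∞)
    (h : ∀ ξ, ‖F ξ‖ₑ ≤ a * M ξ) (ξ : V n) : ‖convSq F ξ‖ₑ ≤ a * a * (M ⋆ₗ M) ξ := by
  rw [convSq, lconvolution_def, ← lintegral_const_mul' _ _ (ENNReal.mul_ne_top ha ha)]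
  refine (enorm_integral_le_lintegral_enorm _).trans (lintegral_mono fun η => ?_)
  rw [enorm_mul, neg_add_eq_sub]
  calc _ ≤ (a * M η) * (a * M (ξ - η)) := mul_le_mul' (h _) (h _)
    _ = _ := by ring

theorem lintegral_exp_neg {c : ℝ} (hc : 0 < c) :
    ∫⁻ θ in Ioi (0 : ℝ), ENNReal.ofReal (Real.exp (-(c * θ))) = ENNReal.ofReal (1 / c) := by
  have h := exp_neg_integrableOn_Ioi 0 hc
  simp only [neg_mul] at h
  rw [← ofReal_integral_eq_lintegral_ofReal h (Eventually.of_forall fun _ => (Real.exp_pos _).le)]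
  congr 1
  have := integral_exp_mul_Ioi (a := -c) (by linarith) 0
  simpa using this

/-! ### Stationarity, exponential bounds and time continuity of the Picard iterates -/

namespace IsDamped

variable {S K : ℝ → V n → ℂ} {c B : ℝ} {D : V n → ℝ≥0∞}

theorem measurable_picard (h : IsDamped S K c B D) (k : ℕ) :
    Measurable (Function.uncurry (picard S K k)) := by
  induction k with
  | zero => exact measurable_const
  | succ k ih => exact h.measurable_S.add (measurable_duhamel h.measurable_K (measurable_convSq ih))

theorem picard_eq_zero (h : IsDamped S K c B D) (k : ℕ) (t : ℝ) {ξ : V n}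
    (hξ : ξ ∉ octant n 1) : picard S K k t ξ = 0 := by
  cases k with
  | zero => rfl
  | succ k => simp [picard, h.S_eq_zero t ξ hξ, h.K_eq_zero _ ξ hξ]

/-- Causality in frequency: if `η` and `ξ - η` both lie in the octant, each has coordinate sum at
least one, hence at most `coordSum ξ - 1`. -/
theorem convSq_congr {F G : V n → ℂ} (hF : ∀ ξ, ξ ∉ octant n 1 → F ξ = 0)
    (hG : ∀ ξ, ξ ∉ octant n 1 → G ξ = 0) {ξ : V n}
    (h : ∀ η, coordSum η ≤ coordSum ξ - 1 → F η = G η) : convSq F ξ = convSq G ξ := by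
  rw [convSq, convSq]
  congr 1
  ext η
  by_cases h1 : η ∈ octant n 1
  · by_cases h2 : ξ - η ∈ octant n 1
    · have e := coordSum_add η (ξ - η)
      rw [add_sub_cancel] at e
      have e1 := le_coordSum_of_mem_octant h1
      have e2 := le_coordSum_of_mem_octant h2
      rw [h η (by linarith), h (ξ - η) (by linarith)]
    · rw [hF _ h2, hG _ h2, mul_zero, mul_zero]
  · rw [hF _ h1, hG _ h1, zero_mul, zero_mul]

/-- Each iteration settles one more unit of `coordSum`. The start is empty, because a coordinate sum
below one excludes the octant. -/
theorem picard_succ_eq (h : IsDamped S K c B D) (k : ℕ) (t : ℝ) {ξ : V n}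
    (hξ : coordSum ξ < k + 1) : picard S K (k + 1) t ξ = picard S K k t ξ := by
  induction k generalizing t ξ with
  | zero =>
    have : ξ ∉ octant n 1 := fun h' => by
      have := le_coordSum_of_mem_octant h'
      push_cast at hξ
      linarith
    rw [h.picard_eq_zero _ _ this, h.picard_eq_zero _ _ this]
  | succ k ih =>
    have : ∀ θ, convSq (picard S K (k + 1) θ) ξ = convSq (picard S K k θ) ξ := fun θ =>
      convSq_congr (fun _ => h.picard_eq_zero _ _) (fun _ => h.picard_eq_zero _ _)
        fun η hη => ih θ (by push_cast at hξ; linarith)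
    change S t ξ + ∫ θ in Ioc 0 t, K (t - θ) ξ * convSq (picard S K (k + 1) θ) ξ =
      S t ξ + ∫ θ in Ioc 0 t, K (t - θ) ξ * convSq (picard S K k θ) ξ
    simp only [this]

theorem picard_eq_picardLim (h : IsDamped S K c B D) {k : ℕ} (t : ℝ) {ξ : V n}
    (hξ : coordSum ξ < k + 1) : picard S K k t ξ = picardLim S K t ξ := by
  have h1 : ⌊coordSum ξ⌋₊ ≤ k := by
    rcases lt_or_ge (coordSum ξ) 0 with h0 | h0
    · rw [Nat.floor_of_nonpos h0.le]; exact Nat.zero_le k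
    · exact Nat.lt_succ_iff.1 ((Nat.floor_lt h0).2 (by push_cast; exact hξ))
  clear hξ
  induction k, h1 using Nat.le_induction with
  | base => rfl
  | succ k hk ih =>
    rw [← ih, h.picard_succ_eq]
    exact (Nat.lt_floor_add_one _).trans_le (by gcongr)

/-- The index of the iterate in `picardLim` varies with `ξ`, so measurability is taken from the
pointwise limit of the iterates, which are eventually constant. -/
theorem measurable_picardLim (h : IsDamped S K c B D) :
    Measurable (Function.uncurry (picardLim S K)) := by
  refine measurable_of_tendsto_metrizable (f := fun k => Function.uncurry (picard S K k))
    h.measurable_picard (tendsto_pi_nhds.2 ?_)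
  rintro ⟨t, ξ⟩
  refine tendsto_const_nhds.congr' ?_
  filter_upwards [eventually_ge_atTop ⌊coordSum ξ⌋₊] with k hk
  exact (h.picard_eq_picardLim t ((Nat.lt_floor_add_one _).trans_le (by gcongr))).symm

theorem picardLim_eq_zero (h : IsDamped S K c B D) (t : ℝ) {ξ : V n}
    (hξ : ξ ∉ octant n 1) : picardLim S K t ξ = 0 := h.picard_eq_zero _ t hξ

theorem picardLim_eq (h : IsDamped S K c B D) (t : ℝ) (ξ : V n) :
    picardLim S K t ξ = S t ξ + ∫ θ in Ioc 0 t, K (t - θ) ξ * convSq (picardLim S K θ) ξ := by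
  have h1 := h.picard_succ_eq ⌊coordSum ξ⌋₊ t (Nat.lt_floor_add_one (coordSum ξ))
  rw [picardLim, ← h1, picard]
  have : ∀ θ, convSq (picard S K ⌊coordSum ξ⌋₊ θ) ξ = convSq (picardLim S K θ) ξ := fun θ =>
    convSq_congr (fun _ => h.picard_eq_zero _ _) (fun _ => h.picardLim_eq_zero _)
      fun η hη => h.picard_eq_picardLim θ (by have := Nat.lt_floor_add_one (coordSum ξ); linarith)
  simp only [this]

/-- The product of two solutions decays like `e^{-2cθ}`, so the Duhamel integrand carries
`e^{-c(t-θ)} e^{-2cθ} = e^{-ct} e^{-cθ}`. Integrating `e^{-cθ}` gives the coefficient `A = B/c` of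
the majorant equation. -/
theorem enorm_picard_le (h : IsDamped S K c B D) (k : ℕ) (t : ℝ) (ht : 0 ≤ t) (ξ : V n) :
    ‖picard S K k t ξ‖ₑ ≤
      ENNReal.ofReal (Real.exp (-(c * t))) * majorant (ENNReal.ofReal (B / c)) D k ξ := by
  induction k generalizing t ξ with
  | zero => simp [picard]
  | succ k ih =>
    set M := majorant (ENNReal.ofReal (B / c)) D k
    have hB := h.B_pos
    have hc := h.c_pos
    rw [picard, majorant, mul_add]
    refine (enorm_add_le _ _).trans (add_le_add (h.S_le t ξ ht) ?_)
    refine (enorm_integral_le_lintegral_enorm _).trans ?_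
    calc ∫⁻ θ in Ioc 0 t, ‖K (t - θ) ξ * convSq (picard S K k θ) ξ‖ₑ
        ≤ ∫⁻ θ in Ioc 0 t, ENNReal.ofReal (B * Real.exp (-(c * t))) * (M ⋆ₗ M) ξ *
            ENNReal.ofReal (Real.exp (-(c * θ))) := by
          refine setLIntegral_mono' measurableSet_Ioc fun θ hθ => ?_
          rw [enorm_mul]
          refine (mul_le_mul' (h.K_le (t - θ) ξ (by linarith [hθ.2]))
            (enorm_convSq_le ENNReal.ofReal_ne_top (ih θ hθ.1.le) ξ)).trans_eq ?_
          rw [← ENNReal.ofReal_mul (by positivity), ← mul_assoc, ← ENNReal.ofReal_mul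
            (by positivity), mul_right_comm (ENNReal.ofReal (B * Real.exp (-(c * t)))) ((M ⋆ₗ M) ξ),
            ← ENNReal.ofReal_mul (by positivity)]
          congr 2
          rw [← Real.exp_add, mul_assoc, mul_assoc, ← Real.exp_add, ← Real.exp_add]
          ring_nf
      _ ≤ ∫⁻ θ in Ioi 0, ENNReal.ofReal (B * Real.exp (-(c * t))) * (M ⋆ₗ M) ξ *
            ENNReal.ofReal (Real.exp (-(c * θ))) := lintegral_mono_set Ioc_subset_Ioi_self
      _ = ENNReal.ofReal (B * Real.exp (-(c * t))) * (M ⋆ₗ M) ξ * ENNReal.ofReal (1 / c) := by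
          rw [lintegral_const_mul _ (by fun_prop), lintegral_exp_neg hc]
      _ = _ := by
          rw [mul_right_comm, ← ENNReal.ofReal_mul (by positivity), ← mul_assoc,
            ← ENNReal.ofReal_mul (by positivity)]
          congr 2
          ring

theorem enorm_picardLim_le (h : IsDamped S K c B D) (t : ℝ) (ht : 0 ≤ t) (ξ : V n) :
    ‖picardLim S K t ξ‖ₑ ≤
      ENNReal.ofReal (Real.exp (-(c * t))) * majorantSup (ENNReal.ofReal (B / c)) D ξ :=
  (h.enorm_picard_le _ t ht ξ).trans (mul_le_mul_right (le_majorantSup _ _ _ _) _)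

theorem enorm_convSq_picardLim_le (h : IsDamped S K c B D) (t : ℝ) (ht : 0 ≤ t) (ξ : V n) :
    ‖convSq (picardLim S K t) ξ‖ₑ ≤ ENNReal.ofReal (Real.exp (-(c * t))) *
      (majorantSup (ENNReal.ofReal (B / c)) D ⋆ₗ majorantSup (ENNReal.ofReal (B / c)) D) ξ := by
  refine (enorm_convSq_le ENNReal.ofReal_ne_top (h.enorm_picardLim_le t ht) ξ).trans ?_
  refine mul_le_mul_left (mul_le_of_le_one_left' ?_) _
  rw [← ENNReal.ofReal_one]
  refine ENNReal.ofReal_le_ofReal (Real.exp_le_one_iff.2 ?_)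
  have := mul_nonneg h.c_pos.le ht
  linarith

theorem continuousOn_picardLim (h : IsDamped S K c B D) {ξ : V n}
    (hξ : (majorantSup (ENNReal.ofReal (B / c)) D ⋆ₗ majorantSup (ENNReal.ofReal (B / c)) D) ξ ≠ ∞) :
    ContinuousOn (fun t => picardLim S K t ξ) (Ici 0) := by
  set X := (majorantSup (ENNReal.ofReal (B / c)) D ⋆ₗ majorantSup (ENNReal.ofReal (B / c)) D) ξ
  have hQm : Measurable fun θ => convSq (picardLim S K θ) ξ :=
    (measurable_convSq h.measurable_picardLim).comp (measurable_id.prodMk measurable_const)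
  have hKm : Measurable fun θ => K θ ξ :=
    h.measurable_K.comp (measurable_id.prodMk measurable_const)
  have hB := h.B_pos
  have hbd : ∀ t, 0 ≤ t → ∀ θ ∈ Ioc 0 t, ‖K (t - θ) ξ * convSq (picardLim S K θ) ξ‖ ≤
      B * (Real.exp (-(c * θ)) * X.toReal) := by
    intro t ht θ hθ
    rw [norm_mul]
    refine mul_le_mul ?_ ?_ (norm_nonneg _) hB.le
    · have h1 := h.K_le (t - θ) ξ (by linarith [hθ.2])
      rw [← ofReal_norm, ENNReal.ofReal_le_ofReal_iff (by positivity)] at h1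
      refine h1.trans (mul_le_of_le_one_right hB.le (Real.exp_le_one_iff.2 ?_))
      have := mul_nonneg h.c_pos.le (sub_nonneg.2 hθ.2)
      linarith
    · have h1 := h.enorm_convSq_picardLim_le θ hθ.1.le ξ
      change _ ≤ _ * X at h1
      rw [← ofReal_norm, ← ENNReal.ofReal_toReal hξ,
        ← ENNReal.ofReal_mul (by positivity), ENNReal.ofReal_le_ofReal_iff (by positivity)] at h1
      exact h1
  intro t₀ ht₀
  -- The moving endpoint is put into an indicator, so that dominated convergence applies on a fixed
  -- domain. At fixed `θ` the indicator jumps only when `t = θ`, which is a null set of `θ` for the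
  -- given `t₀`.
  have hrep : ∀ t, picardLim S K t ξ = S t ξ + ∫ θ, (Ioc 0 t).indicator
      (fun θ => K (t - θ) ξ * convSq (picardLim S K θ) ξ) θ := fun t => by
    rw [integral_indicator measurableSet_Ioc]; exact h.picardLim_eq t ξ
  simp only [hrep]
  refine (h.continuous_S ξ).continuousWithinAt.add ?_
  refine continuousWithinAt_of_dominated
    (bound := (Ioi (0 : ℝ)).indicator fun θ => B * (Real.exp (-(c * θ)) * X.toReal))
    ?_ ?_ ?_ ?_
  · refine Eventually.of_forall fun t => Measurable.aestronglyMeasurable ?_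
    exact ((hKm.comp (measurable_const.sub measurable_id)).mul hQm).indicator measurableSet_Ioc
  · filter_upwards [self_mem_nhdsWithin] with t ht
    refine Eventually.of_forall fun θ => ?_
    by_cases hθ : θ ∈ Ioc 0 t
    · rw [Set.indicator_of_mem hθ, Set.indicator_of_mem (mem_Ioi.2 hθ.1)]
      exact hbd t ht θ hθ
    · rw [Set.indicator_of_notMem hθ, norm_zero]
      exact Set.indicator_nonneg (fun _ _ => by positivity) _
  · rw [integrable_indicator_iff measurableSet_Ioi]
    have := exp_neg_integrableOn_Ioi 0 h.c_pos
    simp only [neg_mul] at this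
    exact (this.mul_const _).const_mul _
  · have hne : ∀ᵐ θ : ℝ, θ ≠ t₀ := by
      simp [ae_iff]
    filter_upwards [hne] with θ hθ
    rcases lt_or_gt_of_ne hθ with hlt | hgt
    · by_cases h0 : 0 < θ
      · have : ContinuousAt (fun t => K (t - θ) ξ * convSq (picardLim S K θ) ξ) t₀ := by
          have := h.continuous_K ξ
          fun_prop
        refine ContinuousAt.continuousWithinAt (this.congr ?_)
        filter_upwards [eventually_gt_nhds hlt] with t ht
        rw [Set.indicator_of_mem]
        exact ⟨h0, ht.le⟩
      · have : ∀ t, (Ioc 0 t).indicator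
            (fun θ => K (t - θ) ξ * convSq (picardLim S K θ) ξ) θ = 0 := fun t =>
          Set.indicator_of_notMem (fun h' => h0 h'.1) _
        simp only [this]
        exact continuousWithinAt_const
    · have : ContinuousAt (fun _ : ℝ => (0 : ℂ)) t₀ := continuousAt_const
      refine ContinuousAt.continuousWithinAt (this.congr ?_)
      filter_upwards [eventually_lt_nhds hgt] with t ht
      rw [Set.indicator_of_notMem]
      exact fun h' => absurd h'.2 (not_le.2 ht)

end IsDamped

end Picard

end JMGT
end

noncomputable section

namespace JMGT

open scoped SchwartzMap

/-! ### Regular distributions with exponentially weighted integrable symbols -/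

section Symbols

variable {n : ℕ}

/-- Gelfand–Shilov test functions decay faster than every `expWeight β`. The summand one keeps the
rate positive when `β = 0`. -/
theorem exp_neg_le_expWeight (β : ℝ) (ξ : V n) :
    Real.exp (-((|β| * n + 1) * ‖ξ‖)) ≤ expWeight β ξ := by
  rw [expWeight, Real.rpow_def_of_pos (by norm_num), Real.exp_le_exp]
  have h1 := abs_coordSum_le ξ
  have h2 : |Real.log 2 * (β * coordSum ξ)| ≤ 1 * (|β| * (n * ‖ξ‖)) := by
    rw [abs_mul, abs_mul, abs_of_pos (Real.log_pos (by norm_num))]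
    gcongr
    linarith [Real.log_two_lt_d9]
  have h3 := (abs_le.1 h2).1
  nlinarith [norm_nonneg ξ]

theorem expIntegrable_of_enorm_le {F : V n → ℂ} (hF : AEStronglyMeasurable F) (β : ℝ)
    {G : V n → ℝ≥0∞} (h : ∀ᵐ ξ, ‖F ξ‖ₑ ≤ G ξ) (hG : ∫⁻ ξ, eExp β ξ * G ξ < ∞) :
    ExpIntegrable F := by
  refine ⟨|β| * n + 1, by positivity, ?_, ?_⟩
  · exact (Continuous.aestronglyMeasurable (by fun_prop)).mul hF
  · refine lt_of_le_of_lt (lintegral_mono_ae ?_) hG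
    filter_upwards [h] with ξ hξ
    rw [enorm_mul]
    refine mul_le_mul' ?_ hξ
    rw [← ofReal_norm, Complex.norm_real, Real.norm_eq_abs, Real.abs_exp]
    exact ENNReal.ofReal_le_ofReal (exp_neg_le_expWeight β ξ)

theorem GS.exists_enorm_le (φ : GS n) (β : ℝ) :
    ∃ C : ℝ≥0∞, C ≠ ∞ ∧ ∀ ξ, ‖(φ : 𝓢(V n, ℂ)) ξ‖ₑ ≤ C * eExp β ξ := by
  have ha : 0 < |β| * n + 1 := by positivity
  refine ⟨ENNReal.ofReal (gsNorm (|β| * n + 1) (φ : 𝓢(V n, ℂ))), by simp, fun ξ => ?_⟩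
  rw [eExp, ← ENNReal.ofReal_mul (gsNorm_nonneg _ _), ← ofReal_norm]
  refine ENNReal.ofReal_le_ofReal ((GS.norm_le φ ha ξ).trans ?_)
  exact mul_le_mul_of_nonneg_left (exp_neg_le_expWeight β ξ) (gsNorm_nonneg _ _)

theorem hasFourier_mult {m : ℝ → ℝ} {f : GSDual n} {F : V n → ℂ} (hf : fhat f =ᵐ[volume] F)
    (h : ExpIntegrable fun ξ => (m ‖ξ‖ : ℂ) * F ξ) :
    HasFourier (mult m f) fun ξ => (m ‖ξ‖ : ℂ) * F ξ := by
  have h1 : (fun ξ => (m ‖ξ‖ : ℂ) * F ξ) =ᵐ[volume] fun ξ => (m ‖ξ‖ : ℂ) * fhat f ξ := by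
    filter_upwards [hf] with ξ hξ
    rw [hξ]
  obtain ⟨a, ha, hi⟩ := h
  have h2 : ExpIntegrable fun ξ => (m ‖ξ‖ : ℂ) * fhat f ξ := by
    refine ⟨a, ha, hi.congr ?_⟩
    filter_upwards [h1] with ξ hξ
    rw [hξ]
  exact h2.ofFourier.congr h1.symm

theorem convSq_congr_ae {F G : V n → ℂ} (h : F =ᵐ[volume] G) (ξ : V n) :
    convSq F ξ = convSq G ξ := by
  refine integral_congr_ae ?_
  have h2 := (Measure.measurePreserving_sub_left (volume : Measure (V n))
    ξ).quasiMeasurePreserving.ae_eq_comp h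
  filter_upwards [h, h2] with η h1 h2
  simp only [Function.comp_apply] at h2
  rw [h1, h2]

/-- The convolution integral at every single frequency ignores null sets, so the argument of
`ofFourier` is replaced by an equal function and not just by an equivalent one. -/
theorem mul_self_eq {f : GSDual n} {F : V n → ℂ} (hf : fhat f =ᵐ[volume] F) :
    mul f f = ofFourier fun ξ => (fourierConst n : ℂ) * convSq F ξ := by
  rw [mul]
  congr 1
  ext ξ
  congr 1
  exact convSq_congr_ae hf ξ

theorem fourierConst_pos (n : ℕ) : 0 < fourierConst n := Real.rpow_pos_of_pos Real.two_pi_pos _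

/-- `F` is a Borel representative of `f̂` that vanishes outside the octant. -/
structure IsRep (R : ℝ) (f : GSDual n) (F : V n → ℂ) : Prop where
  measurable : Measurable F
  eq_zero : ∀ ξ, ξ ∉ octant n R → F ξ = 0
  ae_eq : fhat f =ᵐ[volume] F

theorem exists_isRep {R : ℝ} {f : GSDual n} (hf : HasFourier f (fhat f))
    (hs : FourierSupportedIn (octant n R) f) : ∃ F, IsRep R f F := by
  have hm := hf.aestronglyMeasurable
  refine ⟨(octant n R).indicator (hm.mk (fhat f)),
    hm.stronglyMeasurable_mk.measurable.indicator (isClosed_octant R).measurableSet,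
    fun ξ hξ => Set.indicator_of_notMem hξ _, ?_⟩
  filter_upwards [hs, hm.ae_eq_mk] with ξ h1 h2
  by_cases hξ : ξ ∈ octant n R
  · rw [Set.indicator_of_mem hξ, h2]
  · rw [Set.indicator_of_notMem hξ]
    by_contra h0
    exact hξ (h1 h0)

end Symbols

/-! ### The solution -/

section Solution

variable {n : ℕ}

/-- The symbol of the linear part of the mild formulation. -/
def source (τ δ σ c₀ : ℝ) (f₀ f₁ f₂ f₃ : V n → ℂ) (t : ℝ) (ξ : V n) : ℂ :=
  (kernel τ δ σ 1 0 t ‖ξ‖ : ℂ) * f₀ ξ + (kernel τ δ σ 1 1 t ‖ξ‖ : ℂ) * f₁ ξ +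
    (kernel τ δ σ 1 2 t ‖ξ‖ : ℂ) * f₂ ξ - (c₀ : ℂ) * ((kernel τ δ σ 1 2 t ‖ξ‖ : ℂ) * f₃ ξ)

/-- The symbol of the Duhamel kernel, restricted to the octant. -/
def duhamelSymbol (τ δ σ c₀ : ℝ) (t : ℝ) (ξ : V n) : ℂ :=
  (octant n 1).indicator
    (fun ξ => ((c₀ * (fourierConst n * kernel τ δ σ 2 2 t ‖ξ‖) : ℝ) : ℂ)) ξ

/-- A time-independent bound for `source`. -/
def sourceBound (σ c₀ C : ℝ) (f₀ f₁ f₂ f₃ : V n → ℂ) (ξ : V n) : ℝ≥0∞ :=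
  ENNReal.ofReal C * (‖f₀ ξ‖ₑ + ‖f₁ ξ‖ₑ + ENNReal.ofReal (‖ξ‖ ^ (-σ)) * ‖f₂ ξ‖ₑ +
    ENNReal.ofReal c₀ * (ENNReal.ofReal (‖ξ‖ ^ (-σ)) * ‖f₃ ξ‖ₑ))

/-- The decay estimates of the kernels at frequencies `≥ 1`. -/
def KernelDecay (τ δ σ C c : ℝ) : Prop :=
  ∀ t r : ℝ, 0 ≤ t → 1 ≤ r →
    |kernel τ δ σ 1 0 t r| ≤ C * Real.exp (-(c * t)) ∧
    |kernel τ δ σ 1 1 t r| ≤ C * Real.exp (-(c * t)) ∧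
    r ^ σ * |kernel τ δ σ 1 2 t r| ≤ C * Real.exp (-(c * t)) ∧
    |kernel τ δ σ 2 2 t r| ≤ C * Real.exp (-(c * t))

variable {τ δ σ c₀ C c : ℝ}

theorem enorm_kernel_mul_le {m j : Fin 3} {t : ℝ} (hC : 0 ≤ C) {f : V n → ℂ}
    (hf : ∀ ξ, ξ ∉ octant n 1 → f ξ = 0) {w : V n → ℝ} (h : ∀ ξ : V n, 1 ≤ ‖ξ‖ → 0 ≤ w ξ ∧
      |kernel τ δ σ m j t ‖ξ‖| ≤ C * Real.exp (-(c * t)) * w ξ) (ξ : V n) :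
    ‖(kernel τ δ σ m j t ‖ξ‖ : ℂ) * f ξ‖ₑ ≤ ENNReal.ofReal (Real.exp (-(c * t))) *
      (ENNReal.ofReal C * (ENNReal.ofReal (w ξ) * ‖f ξ‖ₑ)) := by
  by_cases hξ : ξ ∈ octant n 1
  · obtain ⟨hw, hk⟩ := h ξ (le_norm_of_mem_octant hξ)
    rw [enorm_mul, ← mul_assoc, ← mul_assoc, ← ENNReal.ofReal_mul (by positivity),
      ← ENNReal.ofReal_mul (by positivity)]
    gcongr
    rw [← ofReal_norm, Complex.norm_real, Real.norm_eq_abs]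
    refine ENNReal.ofReal_le_ofReal (hk.trans_eq ?_)
    ring
  · simp [hf ξ hξ]

theorem KernelDecay.abs_le (hk : KernelDecay τ δ σ C c) {t r : ℝ} (ht : 0 ≤ t) (hr : 1 ≤ r) :
    |kernel τ δ σ 1 2 t r| ≤ C * Real.exp (-(c * t)) * r ^ (-σ) := by
  have h := (hk t r ht hr).2.2.1
  have hr0 : 0 < r := by linarith
  rw [Real.rpow_neg hr0.le, ← div_eq_mul_inv, le_div_iff₀ (by positivity), mul_comm]
  exact h

theorem source_terms_le (hC : 0 ≤ C) (hk : KernelDecay τ δ σ C c) {f : V n → ℂ}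
    (hf : ∀ ξ, ξ ∉ octant n 1 → f ξ = 0) {t : ℝ} (ht : 0 ≤ t) (ξ : V n) :
    ‖(kernel τ δ σ 1 0 t ‖ξ‖ : ℂ) * f ξ‖ₑ ≤ ENNReal.ofReal (Real.exp (-(c * t))) *
      (ENNReal.ofReal C * ‖f ξ‖ₑ) ∧
    ‖(kernel τ δ σ 1 1 t ‖ξ‖ : ℂ) * f ξ‖ₑ ≤ ENNReal.ofReal (Real.exp (-(c * t))) *
      (ENNReal.ofReal C * ‖f ξ‖ₑ) ∧
    ‖(kernel τ δ σ 1 2 t ‖ξ‖ : ℂ) * f ξ‖ₑ ≤ ENNReal.ofReal (Real.exp (-(c * t))) *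
      (ENNReal.ofReal C * (ENNReal.ofReal (‖ξ‖ ^ (-σ)) * ‖f ξ‖ₑ)) := by
  refine ⟨?_, ?_, ?_⟩
  · have := enorm_kernel_mul_le (w := fun _ => 1) hC hf
      (fun ξ h => ⟨zero_le_one, by rw [mul_one]; exact (hk t ‖ξ‖ ht h).1⟩) ξ
    simpa using this
  · have := enorm_kernel_mul_le (w := fun _ => 1) hC hf
      (fun ξ h => ⟨zero_le_one, by rw [mul_one]; exact (hk t ‖ξ‖ ht h).2.1⟩) ξ
    simpa using this
  · exact enorm_kernel_mul_le hC hf (fun ξ h => ⟨by positivity, hk.abs_le ht h⟩) ξ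

/-- The constant `c₀ (fourierConst n * C)` collects the coefficient of the nonlinearity, the
normalisation of the product and the kernel bound. -/
theorem isDamped_source (hσ : 0 < σ) (hc : 0 < c) (hC : 0 < C) (hc₀ : 0 < c₀)
    (hk : KernelDecay τ δ σ C c) {ψ₀ ψ₁ ψ₂ ψ₃ : GSDual n} {f₀ f₁ f₂ f₃ : V n → ℂ}
    (h₀ : IsRep 1 ψ₀ f₀) (h₁ : IsRep 1 ψ₁ f₁) (h₂ : IsRep 1 ψ₂ f₂) (h₃ : IsRep 1 ψ₃ f₃) :
    IsDamped (source τ δ σ c₀ f₀ f₁ f₂ f₃) (duhamelSymbol (n := n) τ δ σ c₀) c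
      (c₀ * (fourierConst n * C)) (sourceBound σ c₀ C f₀ f₁ f₂ f₃) := by
  have hfc := fourierConst_pos n
  have hkm : ∀ m j, Measurable fun p : ℝ × V n => (kernel τ δ σ m j p.1 ‖p.2‖ : ℂ) := fun m j =>
    Complex.measurable_ofReal.comp
      ((continuous_kernel τ δ hσ m j).measurable.comp (measurable_fst.prodMk measurable_snd.norm))
  have hkc : ∀ m j (r : ℝ), Continuous fun t => (kernel τ δ σ m j t r : ℂ) := fun m j r =>
    Complex.continuous_ofReal.comp
      ((continuous_kernel τ δ hσ m j).comp (continuous_id.prodMk continuous_const))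
  have hm : ∀ {ψ : GSDual n} {f : V n → ℂ}, IsRep 1 ψ f → Measurable fun p : ℝ × V n => f p.2 :=
    fun h => h.measurable.comp measurable_snd
  refine ⟨hc, by positivity, ?_, ?_, ?_, ?_, ?_, ?_, ?_, ?_, ?_⟩
  · have := h₀.measurable
    have := h₁.measurable
    have := h₂.measurable
    have := h₃.measurable
    unfold sourceBound
    fun_prop
  · exact ((((hkm 1 0).mul (hm h₀)).add ((hkm 1 1).mul (hm h₁))).add
      ((hkm 1 2).mul (hm h₂))).sub (((hkm 1 2).mul (hm h₃)).const_mul _)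
  · have : Measurable fun p : ℝ × V n =>
        (c₀ : ℂ) * ((fourierConst n : ℂ) * (kernel τ δ σ 2 2 p.1 ‖p.2‖ : ℂ)) :=
      ((hkm 2 2).const_mul _).const_mul _
    have h2 := this.indicator (measurable_snd (isClosed_octant 1).measurableSet :
      MeasurableSet ((fun p : ℝ × V n => p.2) ⁻¹' octant n 1))
    convert! h2 using 1
    ext ⟨t, ξ⟩
    simp [Function.uncurry, duhamelSymbol, Set.indicator]
    rfl
  · intro t ξ hξ
    simp [source, h₀.eq_zero ξ hξ, h₁.eq_zero ξ hξ, h₂.eq_zero ξ hξ, h₃.eq_zero ξ hξ]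
  · intro t ξ hξ
    exact Set.indicator_of_notMem hξ _
  · intro t ξ ht
    have e0 := (source_terms_le hC.le hk h₀.eq_zero ht ξ).1
    have e1 := (source_terms_le hC.le hk h₁.eq_zero ht ξ).2.1
    have e2 := (source_terms_le hC.le hk h₂.eq_zero ht ξ).2.2
    have e3 := (source_terms_le hC.le hk h₃.eq_zero ht ξ).2.2
    have e3' : ‖(c₀ : ℂ) * ((kernel τ δ σ 1 2 t ‖ξ‖ : ℂ) * f₃ ξ)‖ₑ ≤ ENNReal.ofReal c₀ *
        (ENNReal.ofReal (Real.exp (-(c * t))) *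
      (ENNReal.ofReal C * (ENNReal.ofReal (‖ξ‖ ^ (-σ)) * ‖f₃ ξ‖ₑ))) := by
      rw [enorm_mul]
      refine mul_le_mul' (le_of_eq ?_) e3
      rw [← ofReal_norm, Complex.norm_real, Real.norm_of_nonneg hc₀.le]
    unfold source sourceBound
    refine (enorm_sub_le.trans (add_le_add ((enorm_add_le _ _).trans (add_le_add
      ((enorm_add_le _ _).trans (add_le_add e0 e1)) e2)) e3')).trans_eq ?_
    ring
  · intro t ξ ht
    by_cases hξ : ξ ∈ octant n 1
    · rw [duhamelSymbol, Set.indicator_of_mem hξ, ← ofReal_norm, Complex.norm_real,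
        Real.norm_eq_abs, abs_mul, abs_mul, abs_of_pos hc₀, abs_of_pos hfc]
      refine ENNReal.ofReal_le_ofReal ?_
      rw [mul_assoc, mul_assoc]
      have := (hk t ‖ξ‖ ht (le_norm_of_mem_octant hξ)).2.2.2
      gcongr
    · rw [duhamelSymbol, Set.indicator_of_notMem hξ]
      simp
  · intro ξ
    exact ((((hkc 1 0 _).mul continuous_const).add ((hkc 1 1 _).mul continuous_const)).add
      ((hkc 1 2 _).mul continuous_const)).sub
        (continuous_const.mul ((hkc 1 2 _).mul continuous_const))
  · intro ξ
    by_cases hξ : ξ ∈ octant n 1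
    · simp only [duhamelSymbol, Set.indicator_of_mem hξ, Complex.ofReal_mul]
      exact continuous_const.mul (continuous_const.mul (hkc 2 2 _))
    · simp only [duhamelSymbol, Set.indicator_of_notMem hξ]
      exact continuous_const

theorem hasFourier_dataTerm (hC : 0 < C) (hc : 0 < c) (hσ : 0 < σ) (hc₀ : 0 < c₀)
    (hk : KernelDecay τ δ σ C c) {ψ₀ ψ₁ ψ₂ : GSDual n} {f₀ f₁ f₂ f₃ : V n → ℂ}
    (h₀ : IsRep 1 ψ₀ f₀) (h₁ : IsRep 1 ψ₁ f₁) (h₂ : IsRep 1 ψ₂ f₂)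
    (h₃ : IsRep 1 (mul ψ₁ ψ₁) f₃) {β : ℝ}
    (hD : ∫⁻ ξ, eExp β ξ * sourceBound σ c₀ C f₀ f₁ f₂ f₃ ξ < ∞) {t : ℝ} (ht : 0 ≤ t) :
    HasFourier (dataTerm τ δ σ c₀ ψ₀ ψ₁ ψ₂ t) (source τ δ σ c₀ f₀ f₁ f₂ f₃ t) := by
  have hkm : ∀ m j, Measurable fun ξ : V n => (kernel τ δ σ m j t ‖ξ‖ : ℂ) := fun m j =>
    Complex.measurable_ofReal.comp
      ((continuous_kernel τ δ hσ m j).measurable.comp (measurable_const.prodMk measurable_norm))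
  have hexp : ENNReal.ofReal (Real.exp (-(c * t))) ≤ 1 := by
    rw [← ENNReal.ofReal_one]
    refine ENNReal.ofReal_le_ofReal (Real.exp_le_one_iff.2 ?_)
    have := mul_nonneg hc.le ht
    linarith
  have key : ∀ {ψ : GSDual n} {f : V n → ℂ} {m j : Fin 3} {G : V n → ℝ≥0∞}, IsRep 1 ψ f →
      (∀ ξ, ‖(kernel τ δ σ m j t ‖ξ‖ : ℂ) * f ξ‖ₑ ≤ ENNReal.ofReal (Real.exp (-(c * t))) * G ξ) →
      ∫⁻ ξ, eExp β ξ * G ξ < ∞ →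
      HasFourier (mult (kernel τ δ σ m j t) ψ) fun ξ => (kernel τ δ σ m j t ‖ξ‖ : ℂ) * f ξ :=
    fun h hle hG => hasFourier_mult h.ae_eq (expIntegrable_of_enorm_le
      ((hkm _ _).mul h.measurable).aestronglyMeasurable β
      (Eventually.of_forall fun ξ => (hle ξ).trans (mul_le_of_le_one_left' hexp)) hG)
  have hle : ∀ {G : V n → ℝ≥0∞}, (∀ ξ, G ξ ≤ sourceBound σ c₀ C f₀ f₁ f₂ f₃ ξ) →
      ∫⁻ ξ, eExp β ξ * G ξ < ∞ := fun hG =>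
    (lintegral_mono fun ξ => mul_le_mul_right (hG ξ) _).trans_lt hD
  have H0 := key h₀ (fun ξ => (source_terms_le hC.le hk h₀.eq_zero ht ξ).1) (hle fun ξ => by
    unfold sourceBound
    gcongr
    exact le_add_right (le_add_right (le_add_right le_rfl)))
  have H1 := key h₁ (fun ξ => (source_terms_le hC.le hk h₁.eq_zero ht ξ).2.1) (hle fun ξ => by
    unfold sourceBound
    gcongr
    exact le_add_right (le_add_right (le_add_left le_rfl)))
  have H2 := key h₂ (fun ξ => (source_terms_le hC.le hk h₂.eq_zero ht ξ).2.2) (hle fun ξ => by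
    unfold sourceBound
    gcongr
    exact le_add_right (le_add_left le_rfl))
  -- `sourceBound` controls this term only with the factor `c₀`, which is removed at the end because
  -- `c₀ > 0`.
  have H3 := key h₃ (fun ξ => (source_terms_le hC.le hk h₃.eq_zero ht ξ).2.2) (by
    have h3 : ∫⁻ ξ, eExp β ξ * (ENNReal.ofReal c₀ *
        (ENNReal.ofReal C * (ENNReal.ofReal (‖ξ‖ ^ (-σ)) * ‖f₃ ξ‖ₑ))) < ∞ := hle fun ξ => by
      unfold sourceBound
      rw [mul_left_comm]
      gcongr
      exact le_add_left le_rfl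
    simp only [mul_left_comm _ (ENNReal.ofReal c₀)] at h3
    rw [lintegral_const_mul' _ _ (by simp)] at h3
    by_contra hcon
    rw [not_lt, top_le_iff] at hcon
    rw [hcon, ENNReal.mul_top (by simpa using hc₀)] at h3
    exact lt_irrefl _ h3)
  exact ((H0.add H1).add H2).sub (H3.smul (c₀ : ℂ))

end Solution

end JMGT
end

noncomputable section

namespace JMGT

open scoped SchwartzMap

/-! ### The Picard limit as an element of the solution space and as a mild solution -/

section Existence

variable {n : ℕ} {S K : ℝ → V n → ℂ} {c B : ℝ} {D : V n → ℝ≥0∞}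

/-- Since `coordSum ξ ≤ n‖ξ‖` and `β ≤ 0`, passing back from the coordinate sum to the norm costs
the factor `n` in the exponent. This is where `α₀ = nβ` comes from. -/
theorem weight_le_japWeight_mul_expWeight {α₀ β r : ℝ} (hβ : β ≤ 0) (hα : α₀ ≤ n * β) (ξ : V n) :
    weight α₀ r ξ ≤ japWeight r ξ * expWeight β ξ := by
  unfold weight japWeight expWeight
  refine mul_le_mul_of_nonneg_left (Real.rpow_le_rpow_of_exponent_le (by norm_num) ?_)
    (by positivity)
  · have h1 := (abs_le.1 (abs_coordSum_le ξ)).2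
    have h2 := mul_le_mul_of_nonneg_right hα (norm_nonneg ξ)
    nlinarith

theorem enorm_weight_mul (α r : ℝ) (ξ : V n) (z : ℂ) :
    ‖(weight α r ξ : ℂ) * z‖ₑ = ENNReal.ofReal (weight α r ξ) * ‖z‖ₑ := by
  rw [enorm_mul, ← ofReal_norm, Complex.norm_real, Real.norm_of_nonneg (weight_pos α r ξ).le]

theorem ofReal_weight_le {α₀ β r : ℝ} (hβ : β ≤ 0) (hα : α₀ ≤ n * β) (ξ : V n) :
    ENNReal.ofReal (weight α₀ r ξ) ≤ eJap r ξ * eExp β ξ := by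
  rw [eJap, eExp, ← ENNReal.ofReal_mul (japWeight_pos r ξ).le]
  exact ENNReal.ofReal_le_ofReal (weight_le_japWeight_mul_expWeight hβ hα ξ)

theorem normE_eq {α r : ℝ} {f : GSDual n} {F : V n → ℂ} (hF : fhat f =ᵐ[volume] F) :
    normE α r f = (∫⁻ ξ, (ENNReal.ofReal (weight α r ξ) * ‖F ξ‖ₑ) ^ 2) ^ (1 / 2 : ℝ) := by
  have h : normE α r f ^ 2 = ∫⁻ ξ, (ENNReal.ofReal (weight α r ξ) * ‖F ξ‖ₑ) ^ 2 := by
    rw [normE, eLpNorm_two_sq]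
    refine lintegral_congr_ae ?_
    filter_upwards [hF] with ξ hξ
    rw [enorm_weight_mul, hξ]
  rw [← h, ← ENNReal.rpow_natCast, ← ENNReal.rpow_mul]
  norm_num

theorem memE_of_lintegral {α r : ℝ} {f : GSDual n} {F : V n → ℂ} (hF : HasFourier f F)
    (h : ∫⁻ ξ, (ENNReal.ofReal (weight α r ξ) * ‖F ξ‖ₑ) ^ 2 < ∞) : MemE α r f := by
  refine ⟨hF.fhat, ?_, ?_⟩
  · exact (Complex.continuous_ofReal.comp (continuous_weight α r)).aestronglyMeasurable.mul
      hF.fhat.aestronglyMeasurable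
  · change normE α r f < ∞
    rw [normE_eq hF.fhat_ae]
    exact ENNReal.rpow_lt_top_of_nonneg (by norm_num) h.ne

namespace IsDamped

theorem measurable_picardLim_apply (h : IsDamped S K c B D) (t : ℝ) :
    Measurable (picardLim S K t) :=
  h.measurable_picardLim.comp (measurable_const.prodMk measurable_id)

theorem exp_le_one (h : IsDamped S K c B D) {t : ℝ} (ht : 0 ≤ t) :
    ENNReal.ofReal (Real.exp (-(c * t))) ≤ 1 := by
  rw [← ENNReal.ofReal_one]
  refine ENNReal.ofReal_le_ofReal (Real.exp_le_one_iff.2 ?_)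
  have := mul_nonneg h.c_pos.le ht
  linarith

variable {β r : ℝ}

theorem hasFourier_picardLim (h : IsDamped S K c B D)
    (hM : ∫⁻ ξ, eExp β ξ * majorantSup (ENNReal.ofReal (B / c)) D ξ < ∞) {t : ℝ} (ht : 0 ≤ t) :
    HasFourier (ofFourier (picardLim S K t)) (picardLim S K t) := by
  refine (expIntegrable_of_enorm_le (h.measurable_picardLim_apply t).aestronglyMeasurable β
    (Eventually.of_forall fun ξ => ?_) hM).ofFourier
  exact (h.enorm_picardLim_le t ht ξ).trans (mul_le_of_le_one_left' (h.exp_le_one ht))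

theorem lintegral_conv_lt_top (h : IsDamped S K c B D)
    (hM : ∫⁻ ξ, eExp β ξ * majorantSup (ENNReal.ofReal (B / c)) D ξ < ∞) :
    ∫⁻ ξ, eExp β ξ * (majorantSup (ENNReal.ofReal (B / c)) D ⋆ₗ
      majorantSup (ENNReal.ofReal (B / c)) D) ξ < ∞ := by
  have hm := measurable_majorantSup (ENNReal.ofReal (B / c)) h.measurable_D
  rw [lintegral_eExp_mul_lconvolution β hm hm]
  exact ENNReal.mul_lt_top hM hM

theorem ae_conv_ne_top (h : IsDamped S K c B D)
    (hM : ∫⁻ ξ, eExp β ξ * majorantSup (ENNReal.ofReal (B / c)) D ξ < ∞) :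
    ∀ᵐ ξ, (majorantSup (ENNReal.ofReal (B / c)) D ⋆ₗ
      majorantSup (ENNReal.ofReal (B / c)) D) ξ ≠ ∞ := by
  have hm := measurable_majorantSup (ENNReal.ofReal (B / c)) h.measurable_D
  filter_upwards [ae_lt_top ((measurable_eExp β).mul (measurable_lconvolution _ hm hm))
    (h.lintegral_conv_lt_top hM).ne] with ξ hξ hcon
  simp only [Pi.mul_apply, hcon] at hξ
  rw [ENNReal.mul_top (by simpa [eExp] using expWeight_pos β ξ)] at hξ
  exact lt_irrefl _ hξ

/-- The time-independent majorant does everything: with `e^{-ct}` it bounds the two mixed norms, and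
`2M` dominates the differences in the proof of continuity in time. -/
theorem inSolutionSpace (h : IsDamped S K c B D) (hβ : β ≤ 0) (hr : 0 ≤ r) {α₀ : ℝ}
    (hα : α₀ ≤ n * β)
    (hM : ∫⁻ ξ, eExp β ξ * majorantSup (ENNReal.ofReal (B / c)) D ξ < ∞)
    (hM2 : ∫⁻ ξ, (eJap r ξ * (eExp β ξ * majorantSup (ENNReal.ofReal (B / c)) D ξ)) ^ 2 < ∞) :
    InSolutionSpace α₀ r fun t => ofFourier (picardLim S K t) := by
  set M := majorantSup (ENNReal.ofReal (B / c)) D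
  have hw : ∀ ξ, ENNReal.ofReal (weight α₀ r ξ) * M ξ ≤ eJap r ξ * (eExp β ξ * M ξ) := fun ξ => by
    rw [← mul_assoc]
    exact mul_le_mul_left (ofReal_weight_le hβ hα ξ) _
  have hwM : ∫⁻ ξ, (ENNReal.ofReal (weight α₀ r ξ) * M ξ) ^ 2 < ∞ :=
    (lintegral_mono fun ξ => pow_le_pow_left₀ zero_le (hw ξ) 2).trans_lt hM2
  have hle : ∀ t, 0 ≤ t → ∀ ξ, ‖picardLim S K t ξ‖ₑ ≤ M ξ := fun t ht ξ =>
    (h.enorm_picardLim_le t ht ξ).trans (mul_le_of_le_one_left' (h.exp_le_one ht))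
  have hF := fun t (ht : 0 ≤ t) => h.hasFourier_picardLim hM ht
  have ht := normTilde_lt_top hr h.c_pos hwM
    (fun t ht => (hF t ht).fhat.aestronglyMeasurable) fun t ht => by
      filter_upwards [(hF t ht).fhat_ae] with ξ hξ
      rw [hξ]
      exact h.enorm_picardLim_le t ht ξ
  refine ⟨fun t ht => memE_of_lintegral (hF t ht) ?_, fun t₀ ht₀ => ?_, ht.1, ht.2⟩
  · refine (lintegral_mono fun ξ => pow_le_pow_left₀ zero_le ?_ 2).trans_lt hwM
    exact mul_le_mul_right (hle t ht ξ) _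
  · have hE : ∀ᶠ t in 𝓝[Ici 0] t₀, (∫⁻ ξ, (ENNReal.ofReal (weight α₀ r ξ) *
        ‖picardLim S K t ξ - picardLim S K t₀ ξ‖ₑ) ^ 2) ^ (1 / 2 : ℝ) =
        normE α₀ r (ofFourier (picardLim S K t) - ofFourier (picardLim S K t₀)) := by
      filter_upwards [self_mem_nhdsWithin] with t ht
      exact (normE_eq ((hF t ht).sub (hF t₀ ht₀)).fhat_ae).symm
    refine Tendsto.congr' hE ?_
    have hz : (0 : ℝ≥0∞) = 0 ^ (1 / 2 : ℝ) := by simp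
    rw [hz]
    refine Tendsto.ennrpow_const _ ?_
    have hz2 : (0 : ℝ≥0∞) = ∫⁻ _ : V n, 0 := by simp
    rw [hz2]
    refine tendsto_lintegral_filter_of_dominated_convergence
      (fun ξ => 2 ^ 2 * (ENNReal.ofReal (weight α₀ r ξ) * M ξ) ^ 2) ?_ ?_ ?_ ?_
    · refine Eventually.of_forall fun t => ?_
      exact (((continuous_weight α₀ r).measurable.ennreal_ofReal).mul
        ((h.measurable_picardLim_apply t).sub (h.measurable_picardLim_apply t₀)).enorm).pow_const 2
    · filter_upwards [self_mem_nhdsWithin] with t ht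
      refine Eventually.of_forall fun ξ => ?_
      rw [← mul_pow, mul_left_comm]
      refine pow_le_pow_left₀ zero_le (mul_le_mul_right ?_ _) 2
      rw [two_mul]
      exact enorm_sub_le.trans (add_le_add (hle t ht ξ) (hle t₀ ht₀ ξ))
    · rw [lintegral_const_mul' _ _ (by simp)]
      exact ENNReal.mul_ne_top (by simp) hwM.ne
    -- Pointwise continuity in time holds where `M ∗ M` is finite, that is, almost everywhere.
    · filter_upwards [h.ae_conv_ne_top hM] with ξ hξ
      have hc := h.continuousOn_picardLim hξ t₀ ht₀
      have h1 : Tendsto (fun t => ‖picardLim S K t ξ - picardLim S K t₀ ξ‖ₑ) (𝓝[Ici 0] t₀)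
          (𝓝 0) := by
        have := (hc.sub (continuousWithinAt_const (b := picardLim S K t₀ ξ))).enorm
        simpa [ContinuousWithinAt] using this
      have h2 := ENNReal.Tendsto.const_mul (a := ENNReal.ofReal (weight α₀ r ξ)) h1
        (Or.inr ENNReal.ofReal_ne_top)
      have h3 := ((ENNReal.continuous_pow 2).tendsto _).comp h2
      simpa [Function.comp_def] using h3

theorem fourierSupportedIn (h : IsDamped S K c B D)
    (hM : ∫⁻ ξ, eExp β ξ * majorantSup (ENNReal.ofReal (B / c)) D ξ < ∞) {t : ℝ} (ht : 0 ≤ t) :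
    FourierSupportedIn (octant n 1) (ofFourier (picardLim S K t)) := by
  filter_upwards [(h.hasFourier_picardLim hM ht).fhat_ae] with ξ hξ h0
  by_contra hcon
  exact h0 (hξ.trans (h.picardLim_eq_zero t hcon))

theorem measurable_convSq_picardLim (h : IsDamped S K c B D) (t : ℝ) :
    Measurable (convSq (picardLim S K t)) :=
  (measurable_convSq h.measurable_picardLim).comp (measurable_const.prodMk measurable_id)

/-- The Duhamel term can be paired with test functions under the time integral. -/
theorem integrable_duhamel (h : IsDamped S K c B D)
    (hM : ∫⁻ ξ, eExp β ξ * majorantSup (ENNReal.ofReal (B / c)) D ξ < ∞) (t : ℝ) (φ : GS n) :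
    Integrable (Function.uncurry fun θ ξ => K (t - θ) ξ * convSq (picardLim S K θ) ξ *
      (φ : 𝓢(V n, ℂ)) ξ) ((volume.restrict (Ioc 0 t)).prod volume) := by
  set M := majorantSup (ENNReal.ofReal (B / c)) D
  have hQ := measurable_convSq h.measurable_picardLim
  have hm : Measurable (Function.uncurry fun θ ξ => K (t - θ) ξ * convSq (picardLim S K θ) ξ *
      (φ : 𝓢(V n, ℂ)) ξ) := by
    refine Measurable.mul (Measurable.mul ?_ hQ) ?_
    · exact h.measurable_K.comp ((measurable_const.sub measurable_fst).prodMk measurable_snd)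
    · exact (φ : 𝓢(V n, ℂ)).continuous.measurable.comp measurable_snd
  refine ⟨hm.aestronglyMeasurable, ?_⟩
  obtain ⟨C, hC, hφ⟩ := GS.exists_enorm_le φ β
  have hB := h.B_pos
  rw [hasFiniteIntegral_iff_enorm, lintegral_prod _ hm.enorm.aemeasurable]
  refine lt_of_le_of_lt (setLIntegral_mono' (g := fun _ => ∫⁻ ξ, ENNReal.ofReal B * C *
    (eExp β ξ * (M ⋆ₗ M) ξ)) measurableSet_Ioc fun θ hθ => lintegral_mono fun ξ => ?_) ?_
  · simp only [Function.uncurry, enorm_mul]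
    have h1 : ‖K (t - θ) ξ‖ₑ ≤ ENNReal.ofReal B := by
      refine (h.K_le (t - θ) ξ (by linarith [hθ.2])).trans (ENNReal.ofReal_le_ofReal ?_)
      refine mul_le_of_le_one_right hB.le (Real.exp_le_one_iff.2 ?_)
      have := mul_nonneg h.c_pos.le (sub_nonneg.2 hθ.2)
      linarith
    have h2 : ‖convSq (picardLim S K θ) ξ‖ₑ ≤ (M ⋆ₗ M) ξ :=
      (h.enorm_convSq_picardLim_le θ hθ.1.le ξ).trans
        (mul_le_of_le_one_left' (h.exp_le_one hθ.1.le))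
    calc _ ≤ ENNReal.ofReal B * (M ⋆ₗ M) ξ * (C * eExp β ξ) := by
          gcongr
          exact hφ ξ
      _ = _ := by ring
  · rw [setLIntegral_const, lintegral_const_mul' _ _ (ENNReal.mul_ne_top (by simp) hC)]
    exact ENNReal.mul_lt_top (ENNReal.mul_lt_top (ENNReal.mul_lt_top (by simp)
      (lt_top_iff_ne_top.2 hC)) (h.lintegral_conv_lt_top hM)) (by simp)

/-- Fubini moves the test function inside the time integral, turning the pointwise fixed point
equation into the weak one. -/
theorem integral_picardLim_mul (h : IsDamped S K c B D)
    (hM : ∫⁻ ξ, eExp β ξ * majorantSup (ENNReal.ofReal (B / c)) D ξ < ∞) (t : ℝ)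
    (φ : GS n) (hS : Integrable fun ξ => S t ξ * (φ : 𝓢(V n, ℂ)) ξ) :
    ∫ ξ, picardLim S K t ξ * (φ : 𝓢(V n, ℂ)) ξ = (∫ ξ, S t ξ * (φ : 𝓢(V n, ℂ)) ξ) +
      ∫ θ in Ioc 0 t, ∫ ξ, K (t - θ) ξ * convSq (picardLim S K θ) ξ * (φ : 𝓢(V n, ℂ)) ξ := by
  have hi := h.integrable_duhamel hM t φ
  rw [integral_integral_swap hi, ← integral_add hS (by exact hi.integral_prod_right)]
  refine integral_congr_ae (Eventually.of_forall fun ξ => ?_)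
  simp only
  rw [h.picardLim_eq t ξ, add_mul, integral_mul_const]

end IsDamped

theorem isMildSolution_picardLim {τ δ σ BA C c : ℝ} (hτ : 0 < τ) (hσ : 0 < σ) (hBA : 0 < BA)
    (hC : 0 < C) (hc : 0 < c) (hk : KernelDecay τ δ σ C c) {ψ₀ ψ₁ ψ₂ : GSDual n}
    {f₀ f₁ f₂ f₃ : V n → ℂ} (h₀ : IsRep 1 ψ₀ f₀) (h₁ : IsRep 1 ψ₁ f₁) (h₂ : IsRep 1 ψ₂ f₂)
    (h₃ : IsRep 1 (mul ψ₁ ψ₁) f₃) {c₀ β : ℝ} (hc₀ : c₀ = (1 + BA / 2) / τ)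
    (hD : ∫⁻ ξ, eExp β ξ * sourceBound σ c₀ C f₀ f₁ f₂ f₃ ξ < ∞)
    (hM : ∫⁻ ξ, eExp β ξ * majorantSup (ENNReal.ofReal (c₀ * (fourierConst n * C) / c))
      (sourceBound σ c₀ C f₀ f₁ f₂ f₃) ξ < ∞) :
    IsMildSolution τ δ σ BA ψ₀ ψ₁ ψ₂ fun t => ofFourier
      (picardLim (source τ δ σ c₀ f₀ f₁ f₂ f₃) (duhamelSymbol τ δ σ c₀) t) := by
  have hc₀p : 0 < c₀ := by rw [hc₀]; positivity
  have hd := isDamped_source hσ hc hC hc₀p hk h₀ h₁ h₂ h₃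
  set S := source τ δ σ c₀ f₀ f₁ f₂ f₃
  set K := duhamelSymbol (n := n) τ δ σ c₀
  set M := majorantSup (ENNReal.ofReal (c₀ * (fourierConst n * C) / c))
    (sourceBound σ c₀ C f₀ f₁ f₂ f₃)
  have hM2 := hd.lintegral_conv_lt_top hM
  rw [IsMildSolution, ← hc₀]
  intro t ht φ
  obtain ⟨Φ, rfl⟩ := gsHat_surjective n φ
  -- The cutoff in `duhamelSymbol` changes nothing, because the convolution square vanishes off the
  -- octant.
  have hKQ : ∀ θ, θ ∈ Icc 0 t → ∀ ξ, ((c₀ : ℂ)) * ((kernel τ δ σ 2 2 (t - θ) ‖ξ‖ : ℂ) *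
      ((fourierConst n : ℂ) * convSq (picardLim S K θ) ξ)) =
        K (t - θ) ξ * convSq (picardLim S K θ) ξ := by
    intro θ hθ ξ
    by_cases hξ : ξ ∈ octant n 1
    · simp only [K, duhamelSymbol, Set.indicator_of_mem hξ]
      push_cast
      ring
    · rw [convSq_eq_zero (fun _ => hd.picardLim_eq_zero θ) hξ]
      simp
  have hpair : ∀ θ, θ ∈ Icc 0 t → (c₀ : ℂ) * pair (mult (kernel τ δ σ 2 2 (t - θ))
      (mul (ofFourier (picardLim S K θ)) (ofFourier (picardLim S K θ)))) (gsHat Φ) =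
      ∫ ξ, K (t - θ) ξ * convSq (picardLim S K θ) ξ * (Φ : 𝓢(V n, ℂ)) ξ := by
    intro θ hθ
    have hQm := hd.measurable_convSq_picardLim θ
    have hQle : ∀ ξ, ‖convSq (picardLim S K θ) ξ‖ₑ ≤ (M ⋆ₗ M) ξ := fun ξ =>
      (hd.enorm_convSq_picardLim_le θ hθ.1 ξ).trans (mul_le_of_le_one_left' (hd.exp_le_one hθ.1))
    have hconst : ∀ a : ℝ≥0∞, a ≠ ∞ → ∫⁻ ξ, eExp β ξ * (a * (M ⋆ₗ M) ξ) < ∞ := fun a ha => by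
      simp only [mul_left_comm _ a]
      rw [lintegral_const_mul' _ _ ha]
      exact ENNReal.mul_lt_top (lt_top_iff_ne_top.2 ha) hM2
    have hmul : fhat (mul (ofFourier (picardLim S K θ)) (ofFourier (picardLim S K θ)))
        =ᵐ[volume] fun ξ => (fourierConst n : ℂ) * convSq (picardLim S K θ) ξ := by
      rw [mul_self_eq (hd.hasFourier_picardLim hM hθ.1).fhat_ae]
      refine HasFourier.fhat_ae (ExpIntegrable.ofFourier (expIntegrable_of_enorm_le
        (hQm.const_mul _).aestronglyMeasurable β (Eventually.of_forall fun ξ => ?_)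
        (hconst ‖(fourierConst n : ℂ)‖ₑ (by simp))))
      rw [enorm_mul]
      exact mul_le_mul_right (hQle ξ) _
    have hkm : Measurable fun ξ : V n => (kernel τ δ σ 2 2 (t - θ) ‖ξ‖ : ℂ) :=
      Complex.measurable_ofReal.comp
        ((continuous_kernel τ δ hσ 2 2).measurable.comp (measurable_const.prodMk measurable_norm))
    have hF := hasFourier_mult (m := kernel τ δ σ 2 2 (t - θ)) hmul
      (expIntegrable_of_enorm_le (hkm.mul (hQm.const_mul _)).aestronglyMeasurable β
        (G := fun ξ => ENNReal.ofReal C * ‖(fourierConst n : ℂ)‖ₑ * (M ⋆ₗ M) ξ)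
        (Eventually.of_forall fun ξ => by
          by_cases hξ : ξ ∈ octant n 1
          · rw [enorm_mul, enorm_mul, mul_assoc]
            refine mul_le_mul' ?_ (mul_le_mul_right (hQle ξ) _)
            rw [← ofReal_norm, Complex.norm_real, Real.norm_eq_abs]
            have ht' : 0 ≤ t - θ := by linarith [hθ.2]
            refine ENNReal.ofReal_le_ofReal
              (((hk (t - θ) ‖ξ‖ ht' (le_norm_of_mem_octant hξ)).2.2.2).trans
                (mul_le_of_le_one_right hC.le (Real.exp_le_one_iff.2 ?_)))
            have := mul_nonneg hc.le ht'
            linarith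
          · rw [convSq_eq_zero (fun _ => hd.picardLim_eq_zero θ) hξ]
            simp) (hconst _ (ENNReal.mul_ne_top (by simp) (by simp))))
    rw [← fourierDual_apply, (hF Φ).2, ← integral_const_mul]
    refine integral_congr_ae (Eventually.of_forall fun ξ => ?_)
    simp only
    rw [← hKQ θ hθ ξ]
    ring
  have hint : IntegrableOn (fun θ => (c₀ : ℂ) * pair (mult (kernel τ δ σ 2 2 (t - θ))
      (mul (ofFourier (picardLim S K θ)) (ofFourier (picardLim S K θ)))) (gsHat Φ)) (Ioc 0 t) := by
    refine IntegrableOn.congr_fun (hd.integrable_duhamel hM t Φ).integral_prod_left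
      (fun θ hθ => (hpair θ (Ioc_subset_Icc_self hθ)).symm) measurableSet_Ioc
  have hc₀' : (c₀ : ℂ) ≠ 0 := by exact_mod_cast hc₀p.ne'
  refine ⟨?_, ?_⟩
  · rw [intervalIntegrable_iff_integrableOn_Ioc_of_le ht]
    have := hint.const_mul (c₀ : ℂ)⁻¹
    simpa [IntegrableOn, ← mul_assoc, inv_mul_cancel₀ hc₀'] using this
  · have hS := hasFourier_dataTerm hC hc hσ hc₀p hk h₀ h₁ h₂ h₃ hD ht
    rw [← fourierDual_apply, ((hd.hasFourier_picardLim hM ht) Φ).2,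
      hd.integral_picardLim_mul hM t Φ (hS Φ).1, ← (hS Φ).2, fourierDual_apply,
      intervalIntegral.integral_of_le ht, ← integral_const_mul]
    congr 1
    refine setIntegral_congr_fun measurableSet_Ioc fun θ hθ => ?_
    exact (hpair θ (Ioc_subset_Icc_self hθ)).symm

end Existence

end JMGT
end

noncomputable section

namespace JMGT

open scoped SchwartzMap

/-! ### From weighted `L²` to weighted `L¹` on the octant -/

section Weighted

variable {n : ℕ}

theorem lintegral_mul_le_sqrt {X : Type*} [MeasurableSpace X] {μ : Measure X} {f g : X → ℝ≥0∞}
    (hf : AEMeasurable f μ) (hg : AEMeasurable g μ) :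
    ∫⁻ x, f x * g x ∂μ ≤ (∫⁻ x, f x ^ 2 ∂μ) ^ (1 / 2 : ℝ) * (∫⁻ x, g x ^ 2 ∂μ) ^ (1 / 2 : ℝ) := by
  have h := ENNReal.lintegral_mul_le_Lp_mul_Lq μ (p := 2) (q := 2)
    ⟨by norm_num, by norm_num, by norm_num⟩ hf hg
  simpa using h

/-- The square of the `L²` norm of `2^{-|ξ|}`. -/
def decayConst (n : ℕ) : ℝ≥0∞ := ∫⁻ ξ : V n, ENNReal.ofReal ((2 : ℝ) ^ (-‖ξ‖)) ^ 2

theorem decayConst_lt_top (n : ℕ) : decayConst n < ∞ := by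
  have hi : Integrable fun ξ : V n => (1 + ‖ξ‖) ^ (-((n : ℝ) + 1)) :=
    integrable_one_add_norm (by rw [finrank_euclideanSpace_fin]; linarith)
  have hi2 := (hi.const_mul ((n + 1).factorial * Real.exp 1)).lintegral_lt_top
  refine lt_of_le_of_lt (lintegral_mono fun ξ => ?_) hi2
  rw [← ENNReal.ofReal_pow (by positivity)]
  refine ENNReal.ofReal_le_ofReal ?_
  have h1 : ((2 : ℝ) ^ (-‖ξ‖)) ^ 2 ≤ Real.exp (-‖ξ‖) := by
    rw [← Real.rpow_natCast, ← Real.rpow_mul (by norm_num), Real.rpow_def_of_pos (by norm_num),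
      Real.exp_le_exp]
    have := Real.log_two_gt_d9
    push_cast
    nlinarith [norm_nonneg ξ]
  refine h1.trans ?_
  have h2 := Real.pow_div_factorial_le_exp (1 + ‖ξ‖) (by positivity) (n + 1)
  have h3 : (1 + ‖ξ‖) ^ (-((n : ℝ) + 1)) = ((1 + ‖ξ‖) ^ (n + 1))⁻¹ := by
    rw [Real.rpow_neg (by positivity), ← Nat.cast_succ, Real.rpow_natCast]
  rw [div_le_iff₀ (by positivity)] at h2
  rw [h3, ← div_eq_mul_inv, le_div_iff₀ (by positivity)]
  calc Real.exp (-‖ξ‖) * (1 + ‖ξ‖) ^ (n + 1)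
      ≤ Real.exp (-‖ξ‖) * (Real.exp (1 + ‖ξ‖) * (n + 1).factorial) := by gcongr
    _ = (n + 1).factorial * (Real.exp (-‖ξ‖) * Real.exp (1 + ‖ξ‖)) := by ring
    _ = _ := by rw [← Real.exp_add]; ring_nf

/-- The exponent `α - 1 - m` is spent in three ways: `α` reproduces the weight of the data, `-1`
leaves the square integrable `2^{-|ξ|}`, and `-m` yields the gain `2^{-mR}` that makes large data
small. -/
theorem eExp_le_of_mem_octant {α m r R : ℝ} (hα : α ≤ 0) (hm : 0 ≤ m) (hr : 0 ≤ r) {ξ : V n}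
    (hξ : ξ ∈ octant n R) :
    eExp (α - 1 - m) ξ ≤ ENNReal.ofReal ((2 : ℝ) ^ (-(m * R))) *
      (ENNReal.ofReal ((2 : ℝ) ^ (-‖ξ‖)) * ENNReal.ofReal (weight α r ξ)) := by
  rw [← ENNReal.ofReal_mul (by positivity), ← ENNReal.ofReal_mul (by positivity)]
  refine ENNReal.ofReal_le_ofReal ?_
  have h1 := norm_le_coordSum hξ.1
  have h2 := le_norm_of_mem_octant hξ
  have h3 : 1 ≤ Real.sqrt (1 + ‖ξ‖ ^ 2) ^ r :=
    Real.one_le_rpow (Real.one_le_sqrt.2 (by linarith [sq_nonneg ‖ξ‖])) hr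
  calc expWeight (α - 1 - m) ξ ≤ (2 : ℝ) ^ (-(m * R) + (-‖ξ‖ + α * ‖ξ‖)) := by
        refine Real.rpow_le_rpow_of_exponent_le (by norm_num) ?_
        have e1 : (α - 1 - m) * coordSum ξ ≤ (α - 1 - m) * ‖ξ‖ :=
          mul_le_mul_of_nonpos_left h1 (by linarith)
        have e2 := mul_le_mul_of_nonneg_left h2 hm
        linarith
    _ = (2 : ℝ) ^ (-(m * R)) * ((2 : ℝ) ^ (-‖ξ‖) * (1 * (2 : ℝ) ^ (α * ‖ξ‖))) := by
        rw [Real.rpow_add (by norm_num), Real.rpow_add (by norm_num), one_mul]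
    _ ≤ _ := by unfold weight; gcongr

theorem lintegral_eExp_le {α m r R : ℝ} (hα : α ≤ 0) (hm : 0 ≤ m) (hr : 0 ≤ r)
    {H : V n → ℝ≥0∞} (hH : AEMeasurable H) (hs : ∀ᵐ ξ, H ξ ≠ 0 → ξ ∈ octant n R) :
    ∫⁻ ξ, eExp (α - 1 - m) ξ * H ξ ≤ ENNReal.ofReal ((2 : ℝ) ^ (-(m * R))) *
      (decayConst n ^ (1 / 2 : ℝ) *
        (∫⁻ ξ, (ENNReal.ofReal (weight α r ξ) * H ξ) ^ 2) ^ (1 / 2 : ℝ)) := by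
  have hw := (continuous_weight (n := n) α r).measurable.ennreal_ofReal.aemeasurable (μ := volume)
  have hd : AEMeasurable (fun ξ : V n => ENNReal.ofReal ((2 : ℝ) ^ (-‖ξ‖))) := by fun_prop
  calc _ ≤ ∫⁻ ξ, ENNReal.ofReal ((2 : ℝ) ^ (-(m * R))) * (ENNReal.ofReal ((2 : ℝ) ^ (-‖ξ‖)) *
          (ENNReal.ofReal (weight α r ξ) * H ξ)) := by
        refine lintegral_mono_ae ?_
        filter_upwards [hs] with ξ hξ
        by_cases h0 : H ξ = 0
        · simp [h0]
        · refine (mul_le_mul_left (eExp_le_of_mem_octant hα hm hr (hξ h0)) _).trans_eq ?_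
          ring
    _ ≤ _ := by
        rw [lintegral_const_mul' _ _ (by simp)]
        exact mul_le_mul_right (lintegral_mul_le_sqrt hd (hw.mul hH)) _

end Weighted

/-! ### Convolution squares in `L¹` -/

section LOne

variable {n : ℕ}

theorem integrable_convSq {F : V n → ℂ} (hF : Integrable F) : Integrable (convSq F) :=
  hF.integrable_convolution (ContinuousLinearMap.mul ℂ ℂ) hF

/-- Bilinearity: `F∗F - G∗G = (F - G)∗F + G∗(F - G)`. -/
theorem lintegral_enorm_convSq_sub_le {F G : V n → ℂ} (hF : Integrable F) (hG : Integrable G) :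
    ∫⁻ ξ, ‖convSq F ξ - convSq G ξ‖ₑ ≤
      (∫⁻ ξ, ‖F ξ - G ξ‖ₑ) * ((∫⁻ ξ, ‖F ξ‖ₑ) + ∫⁻ ξ, ‖G ξ‖ₑ) := by
  have hf : AEMeasurable fun ξ => ‖F ξ‖ₑ := hF.1.enorm
  have hg : AEMeasurable fun ξ => ‖G ξ‖ₑ := hG.1.enorm
  have hd : AEMeasurable fun ξ => ‖F ξ - G ξ‖ₑ := (hF.1.sub hG.1).enorm
  have hle : ∀ᵐ ξ, ‖convSq F ξ - convSq G ξ‖ₑ ≤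
      ((fun ξ => ‖F ξ - G ξ‖ₑ) ⋆ₗ fun ξ => ‖F ξ‖ₑ) ξ +
        ((fun ξ => ‖G ξ‖ₑ) ⋆ₗ fun ξ => ‖F ξ - G ξ‖ₑ) ξ := by
    filter_upwards [hF.ae_convolution_exists (ContinuousLinearMap.mul ℂ ℂ) hF,
      hG.ae_convolution_exists (ContinuousLinearMap.mul ℂ ℂ) hG] with ξ h1 h2
    have h1' : Integrable fun η => F η * F (ξ - η) := h1
    have h2' : Integrable fun η => G η * G (ξ - η) := h2
    rw [convSq, convSq, ← integral_sub h1' h2', lconvolution_def, lconvolution_def]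
    refine (enorm_integral_le_lintegral_enorm _).trans ?_
    rw [← lintegral_add_left' (by fun_prop)]
    refine lintegral_mono fun η => ?_
    rw [neg_add_eq_sub, ← enorm_mul, ← enorm_mul]
    have : F η * F (ξ - η) - G η * G (ξ - η) =
        (F η - G η) * F (ξ - η) + G η * (F (ξ - η) - G (ξ - η)) := by ring
    rw [this]
    exact enorm_add_le _ _
  refine (lintegral_mono_ae hle).trans_eq ?_
  rw [lintegral_add_left' (aemeasurable_lconvolution hd hf), lintegral_lconvolution hd hf,
    lintegral_lconvolution hg hd]
  ring

/-- The space `L¹` of frequency-side functions. -/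
abbrev LOne (n : ℕ) : Type := Lp ℂ 1 (volume : Measure (V n))

theorem LOne.integrable (a : LOne n) : Integrable (a : V n → ℂ) := L1.integrable_coeFn a

theorem LOne.enorm_eq (a : LOne n) : ‖a‖ₑ = ∫⁻ ξ, ‖a ξ‖ₑ := by
  rw [Lp.enorm_def, eLpNorm_one_eq_lintegral_enorm]

theorem LOne.enorm_sub_eq {a b : LOne n} {F G : V n → ℂ} (ha : a =ᵐ[volume] F)
    (hb : b =ᵐ[volume] G) : ‖a - b‖ₑ = ∫⁻ ξ, ‖F ξ - G ξ‖ₑ := by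
  rw [LOne.enorm_eq]
  refine lintegral_congr_ae ?_
  filter_upwards [Lp.coeFn_sub a b, ha, hb] with ξ h1 h2 h3
  rw [h1, Pi.sub_apply, h2, h3]

theorem enorm_le_of_bound {a b : LOne n} {C x : ℝ} (hC : 0 ≤ C)
    (h : ‖a‖ₑ ≤ ENNReal.ofReal C * (‖b‖ₑ * ENNReal.ofReal x)) (hx : 0 ≤ x) :
    ‖a‖ ≤ C * (‖b‖ * x) := by
  rw [← ofReal_norm, ← ofReal_norm, ← ENNReal.ofReal_mul (norm_nonneg _),
    ← ENNReal.ofReal_mul hC, ENNReal.ofReal_le_ofReal_iff (by positivity)] at h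
  exact h

/-- A bounded, pointwise continuous family of multipliers applied to the convolution squares of a
continuous curve in `L¹` gives a continuous curve in `L¹`. -/
theorem exists_curve_mul_convSq {k : ℝ → V n → ℂ} {I : Set ℝ} {C : ℝ}
    (hkm : ∀ θ, Measurable (k θ)) (hkb : ∀ θ ∈ I, ∀ ξ, ‖k θ ξ‖ ≤ C)
    (hkc : ∀ ξ, ContinuousOn (fun θ => k θ ξ) I) {a : ℝ → LOne n} (ha : ContinuousOn a I) :
    ∃ P : ℝ → LOne n, ContinuousOn P I ∧
      ∀ θ ∈ I, P θ =ᵐ[volume] fun ξ => k θ ξ * convSq (a θ) ξ := by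
  classical
  have hi : ∀ θ ∈ I, Integrable fun ξ => k θ ξ * convSq (a θ) ξ := fun θ hθ =>
    (integrable_convSq (a θ).integrable).bdd_mul (hkm θ).aestronglyMeasurable
      (Eventually.of_forall (hkb θ hθ))
  let P : ℝ → LOne n := fun θ => if h : Integrable fun ξ => k θ ξ * convSq (a θ) ξ then
    h.toL1 _ else 0
  have hP : ∀ θ ∈ I, P θ =ᵐ[volume] fun ξ => k θ ξ * convSq (a θ) ξ := fun θ hθ => by
    simp only [P, dif_pos (hi θ hθ)]
    exact Integrable.coeFn_toL1 _
  have hkb' : ∀ θ ∈ I, ∀ ξ, ‖k θ ξ‖ₑ ≤ ENNReal.ofReal C := fun θ hθ ξ => by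
    rw [← ofReal_norm]
    exact ENNReal.ofReal_le_ofReal (hkb θ hθ ξ)
  refine ⟨P, fun θ₀ hθ₀ => ?_, hP⟩
  rw [ContinuousWithinAt, tendsto_iff_edist_tendsto_0]
  have hbound : ∀ θ ∈ I, edist (P θ) (P θ₀) ≤
      ENNReal.ofReal C * (‖a θ - a θ₀‖ₑ * (‖a θ‖ₑ + ‖a θ₀‖ₑ)) +
        ∫⁻ ξ, ‖(k θ ξ - k θ₀ ξ) * convSq (a θ₀) ξ‖ₑ := by
    intro θ hθ
    rw [edist_eq_enorm_sub, LOne.enorm_sub_eq (hP θ hθ) (hP θ₀ hθ₀),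
      LOne.enorm_sub_eq (ae_eq_refl _) (ae_eq_refl _), LOne.enorm_eq, LOne.enorm_eq]
    refine le_trans ?_ (add_le_add_left (mul_le_mul_right
      (lintegral_enorm_convSq_sub_le (a θ).integrable (a θ₀).integrable) _) _)
    rw [← lintegral_const_mul' _ _ (by simp), ← lintegral_add_left']
    · refine lintegral_mono fun ξ => ?_
      have : k θ ξ * convSq (a θ) ξ - k θ₀ ξ * convSq (a θ₀) ξ =
          k θ ξ * (convSq (a θ) ξ - convSq (a θ₀) ξ) + (k θ ξ - k θ₀ ξ) * convSq (a θ₀) ξ := by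
        ring
      rw [this]
      refine (enorm_add_le _ _).trans (add_le_add_left ?_ _)
      rw [enorm_mul]
      exact mul_le_mul_left (hkb' θ hθ ξ) _
    · exact ((integrable_convSq (a θ).integrable).1.sub
        (integrable_convSq (a θ₀).integrable).1).enorm.const_mul _
  have h1 : Tendsto (fun θ => ENNReal.ofReal C * (‖a θ - a θ₀‖ₑ * (‖a θ‖ₑ + ‖a θ₀‖ₑ)))
      (𝓝[I] θ₀) (𝓝 0) := by
    have e1 : Tendsto (fun θ => ‖a θ - a θ₀‖ₑ) (𝓝[I] θ₀) (𝓝 0) := by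
      have := ((ha θ₀ hθ₀).sub (continuousWithinAt_const (b := a θ₀))).enorm
      simpa [ContinuousWithinAt] using this
    have e2 : Tendsto (fun θ => ‖a θ‖ₑ + ‖a θ₀‖ₑ) (𝓝[I] θ₀) (𝓝 (‖a θ₀‖ₑ + ‖a θ₀‖ₑ)) :=
      (ha θ₀ hθ₀).enorm.add tendsto_const_nhds
    have e3 := ENNReal.Tendsto.mul e1 (Or.inr (by simp)) e2 (Or.inr (by simp))
    have e4 := ENNReal.Tendsto.const_mul (a := ENNReal.ofReal C) e3 (Or.inr (by simp))
    simpa using e4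
  -- The multiplier is continuous in `θ` only pointwise in `ξ`, so dominated convergence is applied
  -- with the convolution square frozen at `θ₀`.
  have h2 : Tendsto (fun θ => ∫⁻ ξ, ‖(k θ ξ - k θ₀ ξ) * convSq (a θ₀) ξ‖ₑ) (𝓝[I] θ₀) (𝓝 0) := by
    have hz : (0 : ℝ≥0∞) = ∫⁻ _ : V n, 0 := by simp
    rw [hz]
    refine tendsto_lintegral_filter_of_dominated_convergence'
      (fun ξ => 2 * ENNReal.ofReal C * ‖convSq (a θ₀) ξ‖ₑ) ?_ ?_ ?_ ?_
    · refine Eventually.of_forall fun θ => ?_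
      exact (((hkm θ).sub (hkm θ₀)).aestronglyMeasurable.mul
        (integrable_convSq (a θ₀).integrable).1).enorm
    · filter_upwards [self_mem_nhdsWithin] with θ hθ
      refine Eventually.of_forall fun ξ => ?_
      rw [enorm_mul]
      refine mul_le_mul_left (enorm_sub_le.trans ?_) _
      rw [two_mul]
      exact add_le_add (hkb' θ hθ ξ) (hkb' θ₀ hθ₀ ξ)
    · rw [lintegral_const_mul' _ _ (ENNReal.mul_ne_top (by simp) (by simp))]
      exact ENNReal.mul_ne_top (ENNReal.mul_ne_top (by simp) (by simp))
        (integrable_convSq (a θ₀).integrable).2.ne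
    · refine Eventually.of_forall fun ξ => ?_
      have := (((hkc ξ θ₀ hθ₀).sub (continuousWithinAt_const (b := k θ₀ ξ))).mul
        (continuousWithinAt_const (b := convSq (a θ₀) ξ))).enorm
      simpa [ContinuousWithinAt] using this
  refine tendsto_of_tendsto_of_tendsto_of_le_of_le' tendsto_const_nhds
    (by have := h1.add h2; rwa [add_zero] at this) (Eventually.of_forall fun _ => zero_le) ?_
  filter_upwards [self_mem_nhdsWithin] with θ hθ
  exact hbound θ hθ

theorem norm_sub_mul_convSq_le {k : V n → ℂ} {C : ℝ} (hC : 0 ≤ C) (hk : ∀ ξ, ‖k ξ‖ ≤ C)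
    {a b P Q : LOne n} (hP : P =ᵐ[volume] fun ξ => k ξ * convSq a ξ)
    (hQ : Q =ᵐ[volume] fun ξ => k ξ * convSq b ξ) :
    ‖P - Q‖ ≤ C * (‖a - b‖ * (‖a‖ + ‖b‖)) := by
  refine enorm_le_of_bound hC ?_ (by positivity)
  rw [LOne.enorm_sub_eq hP hQ, LOne.enorm_sub_eq (ae_eq_refl _) (ae_eq_refl _),
    ENNReal.ofReal_add (norm_nonneg _) (norm_nonneg _), ofReal_norm, ofReal_norm, LOne.enorm_eq,
    LOne.enorm_eq]
  refine le_trans ?_ (mul_le_mul_right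
    (lintegral_enorm_convSq_sub_le a.integrable b.integrable) _)
  rw [← lintegral_const_mul' _ _ (by simp)]
  refine lintegral_mono fun ξ => ?_
  rw [← mul_sub, enorm_mul]
  refine mul_le_mul_left ?_ _
  rw [← ofReal_norm]
  exact ENNReal.ofReal_le_ofReal (hk ξ)

/-- Integration against a bounded function as a continuous functional on `L¹`. -/
def pairLOne (Ψ : V n → ℂ) (hm : AEStronglyMeasurable Ψ) (C : ℝ) (hΨ : ∀ ξ, ‖Ψ ξ‖ ≤ C) :
    LOne n →L[ℂ] ℂ :=
  have hi : ∀ g : LOne n, Integrable fun ξ => g ξ * Ψ ξ := fun g =>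
    g.integrable.mul_bdd hm (Eventually.of_forall hΨ)
  LinearMap.mkContinuous
    { toFun := fun g => ∫ ξ, g ξ * Ψ ξ
      map_add' := fun f g => by
        rw [← integral_add (hi f) (hi g)]
        refine integral_congr_ae ?_
        filter_upwards [Lp.coeFn_add f g] with ξ hξ
        rw [hξ, Pi.add_apply, add_mul]
      map_smul' := fun c g => by
        rw [RingHom.id_apply, smul_eq_mul, ← integral_const_mul]
        refine integral_congr_ae ?_
        filter_upwards [Lp.coeFn_smul c g] with ξ hξ
        rw [hξ, Pi.smul_apply, smul_eq_mul, mul_assoc] } C fun g => by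
    have : ‖g‖ = ∫ ξ, ‖g ξ‖ := L1.norm_eq_integral_norm g
    rw [this, ← integral_const_mul]
    refine norm_integral_le_of_norm_le (g.integrable.norm.const_mul C)
      (Eventually.of_forall fun ξ => ?_)
    rw [norm_mul, mul_comm]
    exact mul_le_mul_of_nonneg_right (hΨ ξ) (norm_nonneg _)

theorem pairLOne_apply (Ψ : V n → ℂ) (hm : AEStronglyMeasurable Ψ) (C : ℝ)
    (hΨ : ∀ ξ, ‖Ψ ξ‖ ≤ C) (g : LOne n) : pairLOne Ψ hm C hΨ g = ∫ ξ, g ξ * Ψ ξ := rfl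

end LOne

/-- A continuous function dominated by a multiple of its primitive vanishes. -/
theorem eq_zero_of_le_mul_integral {N : ℝ → ℝ} {T C : ℝ} (hT : 0 ≤ T)
    (hN : ContinuousOn N (Icc 0 T)) (h0 : ∀ t ∈ Icc 0 T, 0 ≤ N t)
    (h : ∀ t ∈ Icc 0 T, N t ≤ C * ∫ θ in (0 : ℝ)..t, N θ) : ∀ t ∈ Icc 0 T, N t = 0 := by
  -- A constant extension makes `N` continuous on the line, so its primitive is differentiable
  -- everywhere and the differential form of Gronwall applies.
  let N' : ℝ → ℝ := IccExtend hT ((Icc 0 T).domRestrict N)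
  have hN' : Continuous N' := (continuousOn_iff_continuous_domRestrict.1 hN).Icc_extend'
  have heq : ∀ t ∈ Icc 0 T, N' t = N t := fun t ht => by
    simp only [N', IccExtend_of_mem hT _ ht]
    rfl
  let F : ℝ → ℝ := fun t => ∫ θ in (0 : ℝ)..t, N' θ
  have hF : ∀ t, HasDerivAt F (N' t) t := fun t =>
    intervalIntegral.integral_hasDerivAt_right (hN'.intervalIntegrable _ _)
      (hN'.stronglyMeasurableAtFilter _ _) hN'.continuousAt
  have hint : ∀ t ∈ Icc 0 T, ∫ θ in (0 : ℝ)..t, N θ = F t := fun t ht => by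
    refine intervalIntegral.integral_congr fun θ hθ => ?_
    rw [uIcc_of_le ht.1] at hθ
    exact (heq θ ⟨hθ.1, hθ.2.trans ht.2⟩).symm
  have hz : ∀ t ∈ Icc 0 T, F t = 0 := by
    refine eq_zero_of_abs_deriv_le_mul_abs_self_of_eq_zero_right (K := |C|) (f' := N')
      (fun t _ => (hF t).continuousAt.continuousWithinAt)
      (fun t _ => (hF t).hasDerivWithinAt) (by simp [F]) fun t ht => ?_
    have ht' := Ico_subset_Icc_self ht
    rw [heq t ht', Real.norm_eq_abs, Real.norm_eq_abs, abs_of_nonneg (h0 t ht')]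
    refine (h t ht').trans ?_
    rw [hint t ht', ← abs_mul]
    exact le_abs_self _
  intro t ht
  have := h t ht
  rw [hint t ht, hz t ht, mul_zero] at this
  exact le_antisymm this (h0 t ht)

end JMGT
end

noncomputable section

namespace JMGT

open scoped SchwartzMap

/-! ### Uniqueness -/

section Uniqueness

variable {n : ℕ}

theorem ofReal_expWeight_ne_zero (β : ℝ) (ξ : V n) : (expWeight β ξ : ℂ) ≠ 0 := by
  exact_mod_cast (expWeight_pos β ξ).ne'

theorem enorm_expWeight (β : ℝ) (ξ : V n) : ‖(expWeight β ξ : ℂ)‖ₑ = eExp β ξ := by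
  rw [← ofReal_norm, Complex.norm_real, Real.norm_of_nonneg (expWeight_pos β ξ).le, eExp]

theorem continuous_inv_expWeight (β : ℝ) :
    Continuous fun ξ : V n => (expWeight β ξ : ℂ)⁻¹ :=
  (Complex.continuous_ofReal.comp (continuous_expWeight β)).inv₀ (ofReal_expWeight_ne_zero β)

theorem expIntegrable_of_integrable (β : ℝ) {g : V n → ℂ} (hg : Integrable g) :
    ExpIntegrable fun ξ => (expWeight β ξ : ℂ)⁻¹ * g ξ := by
  refine expIntegrable_of_enorm_le
    ((continuous_inv_expWeight β).aestronglyMeasurable.mul hg.1) β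
    (Eventually.of_forall fun _ => le_rfl) ?_
  refine lt_of_le_of_lt (lintegral_mono fun ξ => ?_) hg.2
  rw [← enorm_expWeight, ← enorm_mul, mul_inv_cancel_left₀ (ofReal_expWeight_ne_zero β ξ)]

/-- Test functions, divided by an exponential weight, act on `L¹`. -/
theorem exists_pairing (β : ℝ) (Φ : GS n) : ∃ ℓ : LOne n →L[ℂ] ℂ,
    ∀ g : LOne n, ℓ g = ∫ ξ, g ξ * ((expWeight β ξ : ℂ)⁻¹ * (Φ : 𝓢(V n, ℂ)) ξ) := by
  obtain ⟨C, hC, h⟩ := GS.exists_enorm_le Φ β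
  have hb : ∀ ξ, ‖(expWeight β ξ : ℂ)⁻¹ * (Φ : 𝓢(V n, ℂ)) ξ‖ ≤ C.toReal := fun ξ => by
    have h1 := ENNReal.toReal_mono (ENNReal.mul_ne_top hC (by simp [eExp])) (h ξ)
    rw [toReal_enorm, ENNReal.toReal_mul, eExp, ENNReal.toReal_ofReal (expWeight_pos β ξ).le] at h1
    rw [norm_mul, norm_inv, Complex.norm_real, Real.norm_of_nonneg (expWeight_pos β ξ).le,
      inv_mul_le_iff₀ (expWeight_pos β ξ), mul_comm]
    exact h1
  exact ⟨pairLOne _ ((continuous_inv_expWeight β).mul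
    (Φ : 𝓢(V n, ℂ)).continuous).aestronglyMeasurable _ hb, pairLOne_apply _ _ _ hb⟩

/-- After division by the weight both functions are symbols of one distribution, and
`HasFourier.ae_eq` applies. -/
theorem LOne.eq_of_pairing (β : ℝ) {g h : LOne n}
    (H : ∀ Φ : GS n, ∫ ξ, g ξ * ((expWeight β ξ : ℂ)⁻¹ * (Φ : 𝓢(V n, ℂ)) ξ) =
      ∫ ξ, h ξ * ((expWeight β ξ : ℂ)⁻¹ * (Φ : 𝓢(V n, ℂ)) ξ)) : g = h := by
  have hg := (expIntegrable_of_integrable β g.integrable).ofFourier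
  obtain ⟨a, ha, hi⟩ := expIntegrable_of_integrable β h.integrable
  have e : ∀ (g : LOne n) (Φ : GS n), (∫ ξ, (expWeight β ξ : ℂ)⁻¹ * g ξ * (Φ : 𝓢(V n, ℂ)) ξ) =
      ∫ ξ, g ξ * ((expWeight β ξ : ℂ)⁻¹ * (Φ : 𝓢(V n, ℂ)) ξ) := fun g Φ => by
    congr 1
    ext ξ
    ring
  have hh : HasFourier (ofFourier fun ξ => (expWeight β ξ : ℂ)⁻¹ * g ξ)
      fun ξ => (expWeight β ξ : ℂ)⁻¹ * h ξ := fun Φ => by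
    refine ⟨(ExpIntegrable.integrable_mul ha hi Φ).1, ?_⟩
    rw [(hg Φ).2, e, e, H Φ]
  refine Lp.ext ?_
  filter_upwards [hg.ae_eq hh] with ξ hξ
  exact mul_left_cancel₀ (inv_ne_zero (ofReal_expWeight_ne_zero β ξ)) hξ

theorem lintegral_eExp_mul_fhat_le {α r : ℝ} (hα : α ≤ 0) (hr : 0 ≤ r) {f : GSDual n}
    (hf : HasFourier f (fhat f)) (hs : FourierSupportedIn (octant n 0) f) :
    ∫⁻ ξ, eExp (α - 1) ξ * ‖fhat f ξ‖ₑ ≤ decayConst n ^ (1 / 2 : ℝ) * normE α r f := by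
  -- With `m = 0` there is no gain and none is needed: this is only the embedding of `E^α_r` on the
  -- octant into weighted `L¹`.
  have h := lintegral_eExp_le (R := 0) hα le_rfl hr hf.aestronglyMeasurable.enorm
    (hs.mono fun ξ h h0 => h (by simpa using h0))
  rw [normE_eq (ae_eq_refl _)]
  simpa using h

theorem integrable_expWeight_mul_fhat {α r : ℝ} (hα : α ≤ 0) (hr : 0 ≤ r) {f : GSDual n}
    (hf : MemE α r f) (hs : FourierSupportedIn (octant n 0) f) :
    Integrable fun ξ => (expWeight (α - 1) ξ : ℂ) * fhat f ξ := by
  refine ⟨(Complex.continuous_ofReal.comp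
    (continuous_expWeight (α - 1))).aestronglyMeasurable.mul hf.1.aestronglyMeasurable, ?_⟩
  rw [hasFiniteIntegral_iff_enorm]
  simp only [enorm_mul, enorm_expWeight]
  exact (lintegral_eExp_mul_fhat_le hα hr hf.1 hs).trans_lt (ENNReal.mul_lt_top
    (ENNReal.rpow_lt_top_of_nonneg (by norm_num) (decayConst_lt_top n).ne) hf.2.2)

/-- Continuity in `E^α_r` becomes continuity in a Banach space where the square is locally
Lipschitz, since differences of the curve stay supported in the octant. -/
theorem exists_curve {α r : ℝ} (hα : α ≤ 0) (hr : 0 ≤ r) {u : ℝ → GSDual n}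
    (hu : InSolutionSpace α r u)
    (hs : ∀ t, 0 ≤ t → FourierSupportedIn (octant n 0) (u t)) :
    ∃ a : ℝ → LOne n, ContinuousOn a (Ici 0) ∧
      ∀ t, 0 ≤ t → a t =ᵐ[volume] fun ξ => (expWeight (α - 1) ξ : ℂ) * fhat (u t) ξ := by
  classical
  have hF := fun t ht => (hu.mem t ht).1
  have hd : decayConst n ^ (1 / 2 : ℝ) ≠ ∞ :=
    (ENNReal.rpow_lt_top_of_nonneg (by norm_num) (decayConst_lt_top n).ne).ne
  have hi := fun t ht => integrable_expWeight_mul_fhat hα hr (hu.mem t ht) (hs t ht)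
  let a : ℝ → LOne n := fun t =>
    if h : Integrable fun ξ => (expWeight (α - 1) ξ : ℂ) * fhat (u t) ξ then h.toL1 _ else 0
  have ha : ∀ t, 0 ≤ t → a t =ᵐ[volume] fun ξ => (expWeight (α - 1) ξ : ℂ) * fhat (u t) ξ :=
    fun t ht => by
      simp only [a, dif_pos (hi t ht)]
      exact Integrable.coeFn_toL1 _
  refine ⟨a, fun t₀ ht₀ => ?_, ha⟩
  rw [ContinuousWithinAt, tendsto_iff_edist_tendsto_0]
  have h1 := ENNReal.Tendsto.const_mul (hu.cont t₀ ht₀) (Or.inr hd)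
  rw [mul_zero] at h1
  refine tendsto_of_tendsto_of_tendsto_of_le_of_le' tendsto_const_nhds h1
    (Eventually.of_forall fun _ => zero_le) ?_
  filter_upwards [self_mem_nhdsWithin] with t ht
  have hsub := ((hF t ht).sub (hF t₀ ht₀))
  have hsupp : FourierSupportedIn (octant n 0) (u t - u t₀) := by
    filter_upwards [hs t ht, hs t₀ ht₀, hsub.fhat_ae] with ξ e1 e2 e3 h0
    by_contra hcon
    refine h0 ?_
    rw [e3, Pi.sub_apply, not_not.1 (mt e1 hcon), not_not.1 (mt e2 hcon), sub_zero]
  refine le_trans (le_of_eq ?_) (lintegral_eExp_mul_fhat_le hα hr hsub.fhat hsupp)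
  rw [edist_eq_enorm_sub, LOne.enorm_sub_eq (ha t ht) (ha t₀ ht₀)]
  refine lintegral_congr_ae ?_
  filter_upwards [hsub.fhat_ae] with ξ hξ
  rw [hξ, ← mul_sub, enorm_mul, enorm_expWeight, Pi.sub_apply]

theorem convSq_inv_expWeight_mul (β : ℝ) (g : V n → ℂ) (ξ : V n) :
    convSq (fun ξ => (expWeight β ξ : ℂ)⁻¹ * g ξ) ξ = (expWeight β ξ : ℂ)⁻¹ * convSq g ξ := by
  rw [convSq, convSq, ← integral_const_mul]
  congr 1
  ext η
  have h : (expWeight β ξ : ℂ) = expWeight β η * expWeight β (ξ - η) := by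
    rw [← Complex.ofReal_mul, ← expWeight_add, add_sub_cancel]
  rw [h, mul_inv]
  ring

theorem hasFourier_mul_self {β : ℝ} {f : GSDual n} {g : V n → ℂ} (hg : Integrable g)
    (hf : fhat f =ᵐ[volume] fun ξ => (expWeight β ξ : ℂ)⁻¹ * g ξ) :
    HasFourier (mul f f)
      fun ξ => (expWeight β ξ : ℂ)⁻¹ * ((fourierConst n : ℂ) * convSq g ξ) := by
  rw [mul_self_eq hf]
  simp only [convSq_inv_expWeight_mul, mul_left_comm (fourierConst n : ℂ)]
  exact (expIntegrable_of_integrable β ((integrable_convSq hg).const_mul _)).ofFourier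

theorem pair_mult_mul_self {β C : ℝ} {f : GSDual n} {a : LOne n} {m : ℝ → ℝ} (hm : Measurable m)
    (hC : ∀ r, 0 ≤ r → |m r| ≤ C)
    (ha : a =ᵐ[volume] fun ξ => (expWeight β ξ : ℂ) * fhat f ξ) (Φ : GS n) :
    pair (mult m (mul f f)) (gsHat Φ) =
      ∫ ξ, (m ‖ξ‖ : ℂ) * ((fourierConst n : ℂ) * convSq a ξ) *
        ((expWeight β ξ : ℂ)⁻¹ * (Φ : 𝓢(V n, ℂ)) ξ) := by
  have hf : fhat f =ᵐ[volume] fun ξ => (expWeight β ξ : ℂ)⁻¹ * a ξ := by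
    filter_upwards [ha] with ξ hξ
    rw [hξ, inv_mul_cancel_left₀ (ofReal_expWeight_ne_zero β ξ)]
  have hq := (integrable_convSq a.integrable).const_mul (fourierConst n : ℂ)
  have hmm : Measurable fun ξ : V n => (m ‖ξ‖ : ℂ) :=
    Complex.measurable_ofReal.comp (hm.comp measurable_norm)
  have h1 := (hasFourier_mul_self a.integrable hf).fhat_ae
  have hq2 := hq.bdd_mul hmm.aestronglyMeasurable (c := C) (Eventually.of_forall fun ξ => by
    rw [Complex.norm_real]
    exact hC _ (norm_nonneg ξ))
  have h2 := expIntegrable_of_integrable β hq2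
  simp only [mul_left_comm (_⁻¹) (m _ : ℂ)] at h2
  rw [← fourierDual_apply, (hasFourier_mult h1 h2 Φ).2]
  congr 1
  ext ξ
  ring

/-- The Duhamel formula in `L¹`, tested against `ℓ`. -/
theorem IsMildSolution.exists_duhamel {τ δ σ BA : ℝ} (hσ : 0 < σ)
    {ψ₀ ψ₁ ψ₂ : GSDual n} {u : ℝ → GSDual n} (hu : IsMildSolution τ δ σ BA ψ₀ ψ₁ ψ₂ u)
    {β t C : ℝ} (ht : 0 ≤ t)
    (hC : ∀ s r : ℝ, 0 ≤ s → s ≤ t → 0 ≤ r → |kernel τ δ σ 2 2 s r| ≤ C)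
    (hF : HasFourier (u t) (fhat (u t))) {a : ℝ → LOne n} (hac : ContinuousOn a (Ici 0))
    (ha : ∀ t, 0 ≤ t → a t =ᵐ[volume] fun ξ => (expWeight β ξ : ℂ) * fhat (u t) ξ) :
    ∃ P : ℝ → LOne n, ContinuousOn P (Icc 0 t) ∧
      (∀ θ ∈ Icc 0 t, P θ =ᵐ[volume] fun ξ =>
        ((kernel τ δ σ 2 2 (t - θ) ‖ξ‖ * fourierConst n : ℝ) : ℂ) * convSq (a θ) ξ) ∧
      ∀ (Φ : GS n) (ℓ : LOne n →L[ℂ] ℂ),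
        (∀ g : LOne n, ℓ g = ∫ ξ, g ξ * ((expWeight β ξ : ℂ)⁻¹ * (Φ : 𝓢(V n, ℂ)) ξ)) →
        ℓ (a t) = pair (dataTerm τ δ σ ((1 + BA / 2) / τ) ψ₀ ψ₁ ψ₂ t) (gsHat Φ) +
          (((1 + BA / 2) / τ : ℝ) : ℂ) * ℓ (∫ θ in (0 : ℝ)..t, P θ) := by
  have hfc := fourierConst_pos n
  have hkm : ∀ θ, Measurable (kernel τ δ σ 2 2 (t - θ)) := fun θ =>
    (continuous_kernel τ δ hσ 2 2).measurable.comp (measurable_const.prodMk measurable_id)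
  obtain ⟨P, hPc, hP⟩ := exists_curve_mul_convSq (n := n) (I := Icc 0 t)
    (k := fun θ ξ => ((kernel τ δ σ 2 2 (t - θ) ‖ξ‖ * fourierConst n : ℝ) : ℂ))
    (C := C * fourierConst n)
    (fun θ => Complex.measurable_ofReal.comp (((hkm θ).comp measurable_norm).mul_const _))
    (fun θ hθ ξ => by
      rw [Complex.norm_real, Real.norm_eq_abs, abs_mul, abs_of_pos hfc]
      exact mul_le_mul_of_nonneg_right
        (hC _ _ (sub_nonneg.2 hθ.2) (by linarith [hθ.1]) (norm_nonneg ξ)) hfc.le)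
    (fun ξ => (Complex.continuous_ofReal.comp (((continuous_kernel τ δ hσ 2 2).comp
      ((continuous_const.sub continuous_id).prodMk continuous_const)).mul
        continuous_const)).continuousOn)
    (hac.mono Icc_subset_Ici_self)
  refine ⟨P, hPc, hP, fun Φ ℓ hℓ => ?_⟩
  have h1 : ℓ (a t) = pair (u t) (gsHat Φ) := by
    rw [hℓ, ← fourierDual_apply, (hF Φ).2]
    refine integral_congr_ae ?_
    filter_upwards [ha t ht] with ξ hξ
    rw [hξ, mul_comm (expWeight β ξ : ℂ), mul_assoc,
      mul_inv_cancel_left₀ (ofReal_expWeight_ne_zero β ξ)]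
  rw [h1, (hu t ht (gsHat Φ)).2, ← ContinuousLinearMap.intervalIntegral_comp_comm ℓ
    (ContinuousOn.intervalIntegrable (by rwa [uIcc_of_le ht]))]
  congr 2
  refine intervalIntegral.integral_congr fun θ hθ => ?_
  rw [uIcc_of_le ht] at hθ
  rw [hℓ, pair_mult_mul_self (hkm θ) (fun r hr => hC _ _ (sub_nonneg.2 hθ.2)
    (by linarith [hθ.1]) hr) (ha θ hθ.1)]
  refine integral_congr_ae ?_
  filter_upwards [hP θ hθ] with ξ hξ
  rw [hξ]
  push_cast
  ring

/-- In weighted `L¹` both curves are bounded on `[0, T]` by continuity, so the difference of the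
Duhamel terms is at most a constant times the time integral of the difference of the curves.
Gronwall then forces it to vanish. -/
theorem IsMildSolution.unique {τ δ σ BA : ℝ} (hτ : 0 < τ) (hδ : 0 < δ) (hσ : 0 < σ)
    (hBA : 0 < BA) {ψ₀ ψ₁ ψ₂ : GSDual n} {v w : ℝ → GSDual n}
    (hv : IsMildSolution τ δ σ BA ψ₀ ψ₁ ψ₂ v) (hw : IsMildSolution τ δ σ BA ψ₀ ψ₁ ψ₂ w)
    {α r : ℝ} (hα : α ≤ 0) (hr : 0 ≤ r) (hvs : InSolutionSpace α r v)
    (hws : InSolutionSpace α r w)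
    (hvo : ∀ t, 0 ≤ t → FourierSupportedIn (octant n 0) (v t))
    (hwo : ∀ t, 0 ≤ t → FourierSupportedIn (octant n 0) (w t)) {T : ℝ} (hT : 0 ≤ T) :
    w T = v T := by
  obtain ⟨a, hac, ha⟩ := exists_curve hα hr hws hwo
  obtain ⟨b, hbc, hb⟩ := exists_curve hα hr hvs hvo
  obtain ⟨C, hC0, hC⟩ := kernel_bounded hτ hδ hσ T
  have hfc := fourierConst_pos n
  set c₀ : ℝ := (1 + BA / 2) / τ
  have hc₀ : 0 < c₀ := by positivity
  have hacT := hac.mono (Icc_subset_Ici_self : Icc 0 T ⊆ Ici 0)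
  have hbcT := hbc.mono (Icc_subset_Ici_self : Icc 0 T ⊆ Ici 0)
  obtain ⟨M, hM⟩ := isCompact_Icc.exists_bound_of_continuousOn (hacT.norm.add hbcT.norm)
  have hM' : ∀ θ ∈ Icc 0 T, ‖a θ‖ + ‖b θ‖ ≤ M := fun θ hθ => (le_abs_self _).trans (hM θ hθ)
  have key : ∀ t ∈ Icc 0 T, ‖a t - b t‖ ≤
      (c₀ * (C * fourierConst n * M)) * ∫ θ in (0 : ℝ)..t, ‖a θ - b θ‖ := by
    intro t ht
    have hCt : ∀ s r : ℝ, 0 ≤ s → s ≤ t → 0 ≤ r → |kernel τ δ σ 2 2 s r| ≤ C :=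
      fun s r hs hst => hC s r hs (hst.trans ht.2)
    obtain ⟨P, hPc, hP, hPℓ⟩ := hw.exists_duhamel hσ ht.1 hCt (hws.mem t ht.1).1 hac ha
    obtain ⟨Q, hQc, hQ, hQℓ⟩ := hv.exists_duhamel hσ ht.1 hCt (hvs.mem t ht.1).1 hbc hb
    have hPi : IntervalIntegrable P volume 0 t :=
      ContinuousOn.intervalIntegrable (by rwa [uIcc_of_le ht.1])
    have hQi : IntervalIntegrable Q volume 0 t :=
      ContinuousOn.intervalIntegrable (by rwa [uIcc_of_le ht.1])
    -- The weak formulas, tested on all `Φ`, become an identity of Bochner integrals in `L¹`; the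
    -- data terms cancel.
    have heq : a t - b t = (c₀ : ℂ) • ∫ θ in (0 : ℝ)..t, (P θ - Q θ) := by
      refine LOne.eq_of_pairing (α - 1) fun Φ => ?_
      obtain ⟨ℓ, hℓ⟩ := exists_pairing (α - 1) Φ
      rw [← hℓ, ← hℓ, intervalIntegral.integral_sub hPi hQi, map_sub, map_smul, map_sub,
        hPℓ Φ ℓ hℓ, hQℓ Φ ℓ hℓ, smul_eq_mul]
      ring
    have hsubset : Icc 0 t ⊆ Icc 0 T := Icc_subset_Icc_right ht.2
    have hNi : IntervalIntegrable (fun θ => C * fourierConst n * M * ‖a θ - b θ‖) volume 0 t := by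
      refine ContinuousOn.intervalIntegrable ?_
      rw [uIcc_of_le ht.1]
      exact continuousOn_const.mul ((hacT.mono hsubset).sub (hbcT.mono hsubset)).norm
    rw [heq, norm_smul, Complex.norm_real, Real.norm_of_nonneg hc₀.le, mul_assoc,
      ← intervalIntegral.integral_const_mul]
    refine mul_le_mul_of_nonneg_left ?_ hc₀.le
    refine intervalIntegral.norm_integral_le_of_norm_le ht.1
      (Eventually.of_forall fun θ hθ => ?_) hNi
    have hθ' := Ioc_subset_Icc_self hθ
    refine (norm_sub_mul_convSq_le (C := C * fourierConst n) (by positivity) (fun ξ => ?_)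
      (hP θ hθ') (hQ θ hθ')).trans ?_
    · rw [Complex.norm_real, Real.norm_eq_abs, abs_mul, abs_of_pos hfc]
      exact mul_le_mul_of_nonneg_right
        (hCt _ _ (sub_nonneg.2 hθ'.2) (by linarith [hθ'.1]) (norm_nonneg ξ)) hfc.le
    · rw [mul_assoc (C * fourierConst n), mul_comm M]
      have := hM' θ (hsubset hθ')
      gcongr
  have hz := eq_zero_of_le_mul_integral hT (hacT.sub hbcT).norm (fun _ _ => norm_nonneg _) key T
    ⟨hT, le_rfl⟩
  have hab : a T = b T := sub_eq_zero.1 (norm_eq_zero.1 hz)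
  refine (hws.mem T hT).1.eq ((hvs.mem T hT).1.congr ?_)
  have h1 := ha T hT
  rw [hab] at h1
  filter_upwards [h1, hb T hT] with ξ e1 e2
  exact mul_left_cancel₀ (ofReal_expWeight_ne_zero (α - 1) ξ) (e2.symm.trans e1)

end Uniqueness

end JMGT
end

noncomputable section

namespace JMGT

/-! ### The size of the source and global existence -/

section Data

variable {n : ℕ}

theorem lintegral_sq_rpow {X : Type*} [MeasurableSpace X] {μ : Measure X} (f : X → ℝ≥0∞) :
    (∫⁻ x, f x ^ 2 ∂μ) ^ (1 / 2 : ℝ) = eLpNorm f 2 μ := by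
  have h := eLpNorm_two_sq f μ
  simp only [enorm_eq_self] at h
  rw [← h, ← ENNReal.rpow_natCast, ← ENNReal.rpow_mul]
  norm_num

/-- As `⟨ξ⟩ ≤ 2|ξ|` when `|ξ| ≥ 1`, the gain `|ξ|^{-σ}` of `∂_t K₂` pays for the `σ` extra
derivatives demanded of the solution. -/
theorem weight_add_mul_rpow_neg_le {α s σ : ℝ} (hσ : 0 ≤ σ) {ξ : V n} (hξ : 1 ≤ ‖ξ‖) :
    weight α (s + σ) ξ * ‖ξ‖ ^ (-σ) ≤ 2 ^ σ * weight α s ξ := by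
  have h0 : 0 < ‖ξ‖ := by linarith
  have h1 : 0 < Real.sqrt (1 + ‖ξ‖ ^ 2) := Real.sqrt_pos.2 (by positivity)
  have h2 : Real.sqrt (1 + ‖ξ‖ ^ 2) ^ σ ≤ 2 ^ σ * ‖ξ‖ ^ σ := by
    rw [← Real.mul_rpow (by norm_num) h0.le]
    refine Real.rpow_le_rpow h1.le ?_ hσ
    rw [Real.sqrt_le_left (by positivity)]
    nlinarith
  have h3 : ‖ξ‖ ^ σ * ‖ξ‖ ^ (-σ) = 1 := by
    rw [← Real.rpow_add h0, add_neg_cancel, Real.rpow_zero]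
  unfold weight
  rw [Real.rpow_add h1]
  calc _ = Real.sqrt (1 + ‖ξ‖ ^ 2) ^ s * 2 ^ (α * ‖ξ‖) * ‖ξ‖ ^ (-σ) *
        Real.sqrt (1 + ‖ξ‖ ^ 2) ^ σ := by ring
    _ ≤ Real.sqrt (1 + ‖ξ‖ ^ 2) ^ s * 2 ^ (α * ‖ξ‖) * ‖ξ‖ ^ (-σ) * (2 ^ σ * ‖ξ‖ ^ σ) := by
        gcongr
    _ = 2 ^ σ * (Real.sqrt (1 + ‖ξ‖ ^ 2) ^ s * 2 ^ (α * ‖ξ‖)) * (‖ξ‖ ^ σ * ‖ξ‖ ^ (-σ)) := by ring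
    _ = _ := by rw [h3, mul_one]

theorem weight_mul_sourceBound_le {α s σ c₀ C : ℝ} (hσ : 0 ≤ σ) {f₀ f₁ f₂ f₃ : V n → ℂ}
    {ξ : V n} (hξ : 1 ≤ ‖ξ‖) :
    ENNReal.ofReal (weight α (s + σ) ξ) * sourceBound σ c₀ C f₀ f₁ f₂ f₃ ξ ≤
      ENNReal.ofReal C * ((1 + ENNReal.ofReal c₀) * (1 + ENNReal.ofReal (2 ^ σ))) *
      (ENNReal.ofReal (weight α (s + σ) ξ) * ‖f₀ ξ‖ₑ + ENNReal.ofReal (weight α (s + σ) ξ) * ‖f₁ ξ‖ₑ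
        + ENNReal.ofReal (weight α s ξ) * ‖f₂ ξ‖ₑ + ENNReal.ofReal (weight α s ξ) * ‖f₃ ξ‖ₑ) := by
  have h : ENNReal.ofReal (weight α (s + σ) ξ) * ENNReal.ofReal (‖ξ‖ ^ (-σ)) ≤
      ENNReal.ofReal (2 ^ σ) * ENNReal.ofReal (weight α s ξ) := by
    rw [← ENNReal.ofReal_mul (weight_pos _ _ _).le, ← ENNReal.ofReal_mul (by positivity)]
    exact ENNReal.ofReal_le_ofReal (weight_add_mul_rpow_neg_le hσ hξ)
  unfold sourceBound
  generalize ENNReal.ofReal (weight α (s + σ) ξ) = w at *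
  generalize ENNReal.ofReal (weight α s ξ) = w' at *
  generalize ENNReal.ofReal (‖ξ‖ ^ (-σ)) = x at *
  generalize ENNReal.ofReal ((2 : ℝ) ^ σ) = y at *
  generalize ENNReal.ofReal c₀ = e
  -- One crude factor dominates the coefficients `1`, `1`, `y` and `e y` of the four data terms.
  have h1 : (1 : ℝ≥0∞) ≤ (1 + e) * (1 + y) :=
    one_le_mul (le_add_right le_rfl) (le_add_right le_rfl)
  have h2 : y ≤ (1 + e) * (1 + y) :=
    (le_add_left le_rfl).trans (le_mul_of_one_le_left' (le_add_right le_rfl))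
  have h3 : e * y ≤ (1 + e) * (1 + y) := mul_le_mul' (le_add_left le_rfl) (le_add_left le_rfl)
  generalize (1 + e) * (1 + y) = z at *
  calc _ = ENNReal.ofReal C * (1 * (w * ‖f₀ ξ‖ₑ) + 1 * (w * ‖f₁ ξ‖ₑ) + w * x * ‖f₂ ξ‖ₑ +
        e * (w * x) * ‖f₃ ξ‖ₑ) := by ring
    _ ≤ ENNReal.ofReal C * (z * (w * ‖f₀ ξ‖ₑ) + z * (w * ‖f₁ ξ‖ₑ) + y * w' * ‖f₂ ξ‖ₑ +
        e * (y * w') * ‖f₃ ξ‖ₑ) := by gcongr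
    _ = ENNReal.ofReal C * (z * (w * ‖f₀ ξ‖ₑ) + z * (w * ‖f₁ ξ‖ₑ) + y * (w' * ‖f₂ ξ‖ₑ) +
        (e * y) * (w' * ‖f₃ ξ‖ₑ)) := by ring
    _ ≤ ENNReal.ofReal C * (z * (w * ‖f₀ ξ‖ₑ) + z * (w * ‖f₁ ξ‖ₑ) + z * (w' * ‖f₂ ξ‖ₑ) +
        z * (w' * ‖f₃ ξ‖ₑ)) := by gcongr
    _ = _ := by ring

theorem sourceBound_eq_zero {σ c₀ C : ℝ} {ψ₀ ψ₁ ψ₂ ψ₃ : GSDual n} {f₀ f₁ f₂ f₃ : V n → ℂ}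
    (h₀ : IsRep 1 ψ₀ f₀) (h₁ : IsRep 1 ψ₁ f₁) (h₂ : IsRep 1 ψ₂ f₂) (h₃ : IsRep 1 ψ₃ f₃)
    {ξ : V n} (hξ : ξ ∉ octant n 1) : sourceBound σ c₀ C f₀ f₁ f₂ f₃ ξ = 0 := by
  simp [sourceBound, h₀.eq_zero ξ hξ, h₁.eq_zero ξ hξ, h₂.eq_zero ξ hξ, h₃.eq_zero ξ hξ]

theorem eLpNorm_sourceBound_le {α s σ c₀ C : ℝ} (hσ : 0 ≤ σ) {ψ₀ ψ₁ ψ₂ : GSDual n}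
    {f₀ f₁ f₂ f₃ : V n → ℂ} (h₀ : IsRep 1 ψ₀ f₀) (h₁ : IsRep 1 ψ₁ f₁) (h₂ : IsRep 1 ψ₂ f₂)
    (h₃ : IsRep 1 (mul ψ₁ ψ₁) f₃) :
    eLpNorm (fun ξ => ENNReal.ofReal (weight α (s + σ) ξ) * sourceBound σ c₀ C f₀ f₁ f₂ f₃ ξ) 2
        volume ≤
      ENNReal.ofReal C * ((1 + ENNReal.ofReal c₀) * (1 + ENNReal.ofReal (2 ^ σ))) *
        dataSize α s σ ψ₀ ψ₁ ψ₂ := by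
  have hm : ∀ (r : ℝ) {ψ : GSDual n} {f : V n → ℂ}, IsRep 1 ψ f →
      AEStronglyMeasurable fun ξ => ENNReal.ofReal (weight α r ξ) * ‖f ξ‖ₑ := fun r ψ f h =>
    ((continuous_weight α r).measurable.ennreal_ofReal.mul h.measurable.enorm).aestronglyMeasurable
  let G : V n → ℝ≥0∞ := fun ξ =>
    ENNReal.ofReal C * ((1 + ENNReal.ofReal c₀) * (1 + ENNReal.ofReal (2 ^ σ))) *
      (ENNReal.ofReal (weight α (s + σ) ξ) * ‖f₀ ξ‖ₑ + ENNReal.ofReal (weight α (s + σ) ξ) * ‖f₁ ξ‖ₑ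
        + ENNReal.ofReal (weight α s ξ) * ‖f₂ ξ‖ₑ + ENNReal.ofReal (weight α s ξ) * ‖f₃ ξ‖ₑ)
  have hle : ∀ ξ, ENNReal.ofReal (weight α (s + σ) ξ) * sourceBound σ c₀ C f₀ f₁ f₂ f₃ ξ ≤
      G ξ := by
    intro ξ
    by_cases hξ : ξ ∈ octant n 1
    · exact weight_mul_sourceBound_le hσ (le_norm_of_mem_octant hξ)
    · rw [sourceBound_eq_zero h₀ h₁ h₂ h₃ hξ, mul_zero]
      exact zero_le
  refine (eLpNorm_mono_enorm (g := G) fun ξ => hle ξ).trans ?_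
  simp only [G]
  rw [eLpNorm_two_const_mul (ENNReal.mul_ne_top (by simp) (ENNReal.mul_ne_top (by simp) (by simp)))]
  refine mul_le_mul_right ?_ _
  unfold dataSize
  rw [normE_eq h₀.ae_eq, normE_eq h₁.ae_eq, normE_eq h₂.ae_eq, normE_eq h₃.ae_eq,
    lintegral_sq_rpow, lintegral_sq_rpow, lintegral_sq_rpow, lintegral_sq_rpow]
  refine (eLpNorm_add_le (((hm _ h₀).add (hm _ h₁)).add (hm _ h₂)) (hm _ h₃) (by norm_num)).trans
    (add_le_add ?_ le_rfl)
  refine (eLpNorm_add_le ((hm _ h₀).add (hm _ h₁)) (hm _ h₂) (by norm_num)).trans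
    (add_le_add ?_ le_rfl)
  exact eLpNorm_add_le (hm _ h₀) (hm _ h₁) (by norm_num)

theorem dataSize_lt_top {α s σ : ℝ} {ψ₀ ψ₁ ψ₂ : GSDual n} (h₀ : MemE α (s + σ) ψ₀)
    (h₁ : MemE α (s + σ) ψ₁) (h₂ : MemE α s ψ₂) (h₃ : MemE α s (mul ψ₁ ψ₁)) :
    dataSize α s σ ψ₀ ψ₁ ψ₂ < ∞ :=
  ENNReal.add_lt_top.2 ⟨ENNReal.add_lt_top.2 ⟨ENNReal.add_lt_top.2 ⟨h₀.2.2, h₁.2.2⟩, h₂.2.2⟩,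
    h₃.2.2⟩

/-- The support of `ψ₁²` comes from that of `ψ₁`, so it is not an assumption on the data. -/
theorem fourierSupportedIn_mul_self {α r R : ℝ} (hα : α ≤ 0) (hr : 0 ≤ r) (hR : 0 ≤ R)
    {f : GSDual n} (hf : MemE α r f) (hs : FourierSupportedIn (octant n R) f) :
    FourierSupportedIn (octant n R) (mul f f) := by
  obtain ⟨F, hF⟩ := exists_isRep hf.1 hs
  have hi : Integrable fun ξ => (expWeight (α - 1) ξ : ℂ) * F ξ := by
    refine (integrable_expWeight_mul_fhat hα hr hf
      (hs.mono fun ξ h h0 => octant_anti hR (h h0))).congr ?_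
    filter_upwards [hF.ae_eq] with ξ hξ
    rw [hξ]
  have h := hasFourier_mul_self (f := f) (β := α - 1) hi (by
    filter_upwards [hF.ae_eq] with ξ hξ
    rw [hξ, inv_mul_cancel_left₀ (ofReal_expWeight_ne_zero _ ξ)])
  filter_upwards [h.fhat_ae] with ξ hξ h0
  by_contra hcon
  refine h0 (hξ.trans ?_)
  rw [convSq_eq_zero (fun η hη => by rw [hF.eq_zero η hη, mul_zero]) hcon, mul_zero, mul_zero]

/-- The counterpart of `ofReal_weight_le` for the data: on the octant `‖ξ‖ ≤ coordSum ξ`, so here no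
factor `n` is lost. -/
theorem eJap_mul_eExp_le {α β r R : ℝ} (hβ : β ≤ 0) (hβα : β ≤ α) {ξ : V n}
    (hξ : ξ ∈ octant n R) : eJap r ξ * eExp β ξ ≤ ENNReal.ofReal (weight α r ξ) := by
  rw [eJap, eExp, ← ENNReal.ofReal_mul (japWeight_pos r ξ).le]
  refine ENNReal.ofReal_le_ofReal ?_
  unfold weight japWeight expWeight
  refine mul_le_mul_of_nonneg_left (Real.rpow_le_rpow_of_exponent_le (by norm_num) ?_)
    (by positivity)
  exact (mul_le_mul_of_nonpos_left (norm_le_coordSum hξ.1) hβ).trans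
    (mul_le_mul_of_nonneg_right hβα (norm_nonneg ξ))

/-- The square of the `L²` norm of `⟨ξ⟩^{-r}`. -/
def japConst (n : ℕ) (r : ℝ) : ℝ≥0∞ := ∫⁻ ξ : V n, eJap (-r) ξ ^ 2

theorem japConst_lt_top {r : ℝ} (hr : (n : ℝ) / 2 < r) : japConst n r < ∞ := by
  have hi : Integrable fun ξ : V n => (1 + ‖ξ‖ ^ 2) ^ (-(2 * r) / 2) :=
    integrable_rpow_neg_one_add_norm_sq (by rw [finrank_euclideanSpace_fin]; linarith)
  refine lt_of_le_of_lt (lintegral_mono fun ξ => ?_) hi.lintegral_lt_top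
  rw [eJap, ← ENNReal.ofReal_pow (japWeight_pos _ ξ).le]
  refine ENNReal.ofReal_le_ofReal (le_of_eq ?_)
  have h1 : 0 ≤ 1 + ‖ξ‖ ^ 2 := by positivity
  rw [japWeight, Real.sqrt_eq_rpow, ← Real.rpow_natCast, ← Real.rpow_mul h1, ← Real.rpow_mul h1]
  congr 1
  push_cast
  ring

/-- Cauchy–Schwarz against `⟨ξ⟩^{-r}` reaches unweighted `L¹`, so `β = 0` is available. The constant
is finite for `r > n/2`, which explains the strict inequality on `s`. -/
theorem lintegral_le_japConst {r : ℝ} {H : V n → ℝ≥0∞} (hH : AEMeasurable H) :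
    ∫⁻ ξ, eExp 0 ξ * H ξ ≤ japConst n r ^ (1 / 2 : ℝ) *
      eLpNorm (fun ξ => ENNReal.ofReal (weight 0 r ξ) * H ξ) 2 volume := by
  have hw := (continuous_weight (n := n) 0 r).measurable.ennreal_ofReal.aemeasurable (μ := volume)
  rw [← lintegral_sq_rpow]
  refine le_trans (le_of_eq (lintegral_congr fun ξ => ?_))
    (lintegral_mul_le_sqrt (measurable_eJap (-r)).aemeasurable (hw.mul hH))
  have h : eJap (-r) ξ * ENNReal.ofReal (weight 0 r ξ) = 1 := by
    rw [eJap, ← ENNReal.ofReal_mul (japWeight_pos _ ξ).le, ← ENNReal.ofReal_one]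
    congr 1
    rw [japWeight, weight, zero_mul, Real.rpow_zero, mul_one,
      ← Real.rpow_add (Real.sqrt_pos.2 (by positivity)), neg_add_cancel, Real.rpow_zero]
  have h0 : eExp 0 ξ = 1 := by simp [eExp, expWeight]
  change _ = eJap (-r) ξ * (ENNReal.ofReal (weight 0 r ξ) * H ξ)
  rw [← mul_assoc, h, h0]

theorem exists_rpow_neg_mul_le_one {L : ℝ≥0∞} (hL : L ≠ ∞) :
    ∃ m : ℝ, 0 ≤ m ∧ L * ENNReal.ofReal ((2 : ℝ) ^ (-m)) ≤ 1 := by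
  obtain ⟨k, hk⟩ := pow_unbounded_of_one_lt L.toReal (by norm_num : (1 : ℝ) < 2)
  refine ⟨k, by positivity, ?_⟩
  rw [← ENNReal.ofReal_toReal hL, ← ENNReal.ofReal_mul ENNReal.toReal_nonneg,
    ← ENNReal.ofReal_one]
  refine ENNReal.ofReal_le_ofReal ?_
  rw [Real.rpow_neg (by norm_num), Real.rpow_natCast, ← div_eq_mul_inv,
    div_le_one (by positivity)]
  exact hk.le

/-- Global well-posedness as soon as the weighted `L¹` norm of the source is small. -/
theorem exists_unique_solution {τ δ σ BA C c α β s c₀ : ℝ} (hτ : 0 < τ) (hδ : 0 < δ) (hσ : 0 < σ)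
    (hBA : 0 < BA) (hC : 0 < C) (hc : 0 < c) (hk : KernelDecay τ δ σ C c)
    (hc₀ : c₀ = (1 + BA / 2) / τ) (hβ : β ≤ 0) (hβα : β ≤ α) (hs : 0 ≤ s + σ)
    {ψ₀ ψ₁ ψ₂ : GSDual n} {f₀ f₁ f₂ f₃ : V n → ℂ} (h₀ : IsRep 1 ψ₀ f₀) (h₁ : IsRep 1 ψ₁ f₁)
    (h₂ : IsRep 1 ψ₂ f₂) (h₃ : IsRep 1 (mul ψ₁ ψ₁) f₃)
    (hfin : dataSize α s σ ψ₀ ψ₁ ψ₂ < ∞)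
    (hD : ∫⁻ ξ, eExp β ξ * sourceBound σ c₀ C f₀ f₁ f₂ f₃ ξ < ∞)
    (hsmall : ENNReal.ofReal (c₀ * (fourierConst n * C) / c) * (ENNReal.ofReal (2 ^ (s + σ)) *
      (8 * ∫⁻ ξ, eExp β ξ * sourceBound σ c₀ C f₀ f₁ f₂ f₃ ξ)) ≤ 1) :
    ∃ v : ℝ → GSDual n, IsMildSolution τ δ σ BA ψ₀ ψ₁ ψ₂ v ∧
      InSolutionSpace (n * β) (s + σ) v ∧
      (∀ t, 0 ≤ t → FourierSupportedIn (octant n 1) (v t)) ∧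
      ∀ w : ℝ → GSDual n, IsMildSolution τ δ σ BA ψ₀ ψ₁ ψ₂ w →
        InSolutionSpace (n * β) (s + σ) w →
        (∀ t, 0 ≤ t → FourierSupportedIn (octant n 0) (w t)) → ∀ t, 0 ≤ t → w t = v t := by
  have hc₀p : 0 < c₀ := by rw [hc₀]; positivity
  have hd := isDamped_source hσ hc hC hc₀p hk h₀ h₁ h₂ h₃
  have h2 : ∫⁻ ξ, (eJap (s + σ) ξ * (eExp β ξ * sourceBound σ c₀ C f₀ f₁ f₂ f₃ ξ)) ^ 2 < ∞ := by
    have hN : eLpNorm (fun ξ => ENNReal.ofReal (weight α (s + σ) ξ) *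
        sourceBound σ c₀ C f₀ f₁ f₂ f₃ ξ) 2 volume < ∞ :=
      (eLpNorm_sourceBound_le hσ.le h₀ h₁ h₂ h₃).trans_lt (ENNReal.mul_lt_top (lt_top_iff_ne_top.2
        (ENNReal.mul_ne_top (by simp) (ENNReal.mul_ne_top (by simp) (by simp)))) hfin)
    refine lt_of_le_of_lt (lintegral_mono fun ξ => ?_)
      ((eLpNorm_two_sq _ _).symm.trans_lt (ENNReal.pow_lt_top hN))
    rw [enorm_eq_self]
    refine pow_le_pow_left₀ zero_le ?_ 2
    by_cases hξ : ξ ∈ octant n 1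
    · rw [← mul_assoc]
      exact mul_le_mul_left (eJap_mul_eExp_le hβ hβα hξ) _
    · simp [sourceBound_eq_zero h₀ h₁ h₂ h₃ hξ]
  obtain ⟨hM, hM2⟩ := majorantSup_bounds β hs hd.measurable_D (by simp) hsmall hD h2
  have hsol := isMildSolution_picardLim hτ hσ hBA hC hc hk h₀ h₁ h₂ h₃ hc₀ hD hM
  have hspace := hd.inSolutionSpace hβ hs le_rfl hM hM2
  refine ⟨_, hsol, hspace, fun t ht => hd.fourierSupportedIn hM ht, fun w hw hws hwo t ht => ?_⟩
  exact hsol.unique hτ hδ hσ hBA hw (mul_nonpos_of_nonneg_of_nonpos n.cast_nonneg hβ) hs hspace hws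
    (fun t ht => (hd.fourierSupportedIn hM ht).mono fun ξ h h0 => octant_anti zero_le_one (h h0))
    hwo ht

end Data

end JMGT
end

/-! ### Choice of the weight and of the smallness threshold -/

theorem theorem2p1 (τ δ σ : ℝ) (hτ : 0 < τ) (hδ : 0 < δ) (hσ : 0 < σ) :
    ∃ N₀ : ℝ, 0 < N₀ ∧
      ∀ (n : ℕ) (_ : 1 ≤ n) (BA : ℝ) (_ : 0 < BA) (α s : ℝ) (_ : α ≤ 0) (_ : (n : ℝ) / 2 - σ ≤ s),
        ∃ ε : ENNReal, 0 < ε ∧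
          ∀ ψ₀ ψ₁ ψ₂ : JMGT.GSDual n,
            JMGT.MemE α (s + σ) ψ₀ → JMGT.MemE α (s + σ) ψ₁ → JMGT.MemE α s ψ₂ →
            JMGT.FourierSupportedIn (JMGT.octant n N₀) ψ₀ →
            JMGT.FourierSupportedIn (JMGT.octant n N₀) ψ₁ →
            JMGT.FourierSupportedIn (JMGT.octant n N₀) ψ₂ →
            JMGT.MemE α s (JMGT.mul ψ₁ ψ₁) →
            (α < 0 ∨ α = 0 ∧ JMGT.dataSize α s σ ψ₀ ψ₁ ψ₂ ≤ ε) →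
            ∃ α₀ : ℝ, α₀ ≤ α ∧ (α = 0 → (n : ℝ) / 2 - σ < s → α₀ = 0) ∧
              ∃ v : ℝ → JMGT.GSDual n,
                JMGT.IsMildSolution τ δ σ BA ψ₀ ψ₁ ψ₂ v ∧
                JMGT.InSolutionSpace α₀ (s + σ) v ∧
                (∀ t, 0 ≤ t → JMGT.FourierSupportedIn (JMGT.octant n N₀) (v t)) ∧
                ∀ w : ℝ → JMGT.GSDual n,
                  JMGT.IsMildSolution τ δ σ BA ψ₀ ψ₁ ψ₂ w →
                  JMGT.InSolutionSpace α₀ (s + σ) w →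
                  (∀ t, 0 ≤ t → JMGT.FourierSupportedIn (JMGT.octant n 0) (w t)) →
                  ∀ t, 0 ≤ t → w t = v t := by
  obtain ⟨C, c, hC, hc, hk⟩ := JMGT.kernel_decay hτ hδ hσ
  refine ⟨1, one_pos, fun n hn BA hBA α s hα hs => ?_⟩
  have hn' : (1 : ℝ) ≤ n := by exact_mod_cast hn
  have hr : 0 ≤ s + σ := by linarith
  set c₀ : ℝ := (1 + BA / 2) / τ with hc₀
  set A : ℝ≥0∞ := ENNReal.ofReal (c₀ * (JMGT.fourierConst n * C) / c)
  set Z : ℝ≥0∞ := ENNReal.ofReal C * ((1 + ENNReal.ofReal c₀) * (1 + ENNReal.ofReal (2 ^ σ)))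
    with hZ
  have hZt : Z ≠ ∞ := ENNReal.mul_ne_top (by simp) (ENNReal.mul_ne_top (by simp) (by simp))
  set ρ : ℝ≥0∞ := ENNReal.ofReal (2 ^ (s + σ))
  set J : ℝ≥0∞ := JMGT.japConst n (s + σ) ^ (1 / 2 : ℝ) with hJ
  -- In the strict case the threshold is the reciprocal of the constant in the majorant condition
  -- for `β = 0`. Otherwise its value is irrelevant, because smallness comes from the weight.
  set E : ℝ≥0∞ := if (n : ℝ) / 2 - σ < s then (A * (ρ * (8 * (J * Z))))⁻¹ else 1 with hE
  have hJt : (n : ℝ) / 2 - σ < s → J ≠ ∞ := fun h => (ENNReal.rpow_lt_top_of_nonneg (by norm_num)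
    (JMGT.japConst_lt_top (by linarith)).ne).ne
  refine ⟨E, ?_, fun ψ₀ ψ₁ ψ₂ m₀ m₁ m₂ s₀ s₁ s₂ m₃ hsize => ?_⟩
  · rw [hE]
    split_ifs with h
    · exact ENNReal.inv_pos.2 (ENNReal.mul_ne_top (by simp [A]) (ENNReal.mul_ne_top (by simp [ρ])
        (ENNReal.mul_ne_top (by simp) (ENNReal.mul_ne_top (hJt h) hZt))))
    · exact one_pos
  have hfin := JMGT.dataSize_lt_top m₀ m₁ m₂ m₃
  obtain ⟨f₀, h₀⟩ := JMGT.exists_isRep m₀.1 s₀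
  obtain ⟨f₁, h₁⟩ := JMGT.exists_isRep m₁.1 s₁
  obtain ⟨f₂, h₂⟩ := JMGT.exists_isRep m₂.1 s₂
  obtain ⟨f₃, h₃⟩ := JMGT.exists_isRep m₃.1
    (JMGT.fourierSupportedIn_mul_self hα hr zero_le_one m₁ s₁)
  have hDm := (JMGT.isDamped_source hσ hc hC (by positivity : 0 < c₀) hk h₀ h₁ h₂ h₃).measurable_D
  have hN := JMGT.eLpNorm_sourceBound_le (α := α) (s := s) (c₀ := c₀) (C := C) hσ.le h₀ h₁ h₂ h₃
  rw [← hZ] at hN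
  by_cases hcase : α = 0 ∧ (n : ℝ) / 2 - σ < s
  · obtain ⟨rfl, hs'⟩ := hcase
    have hle := (JMGT.lintegral_le_japConst (r := s + σ) hDm.aemeasurable).trans
      (mul_le_mul_right hN _)
    rw [← hJ] at hle
    have hD := hle.trans_lt (ENNReal.mul_lt_top (lt_top_iff_ne_top.2 (hJt hs'))
      (ENNReal.mul_lt_top (lt_top_iff_ne_top.2 hZt) hfin))
    have hsz : JMGT.dataSize 0 s σ ψ₀ ψ₁ ψ₂ ≤ E := by simpa using hsize
    -- Here `β = 0`, hence `α₀ = n * 0 = 0`.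
    refine ⟨n * 0, by simp, by simp, JMGT.exists_unique_solution hτ hδ hσ hBA hC hc hk hc₀ le_rfl
      le_rfl hr h₀ h₁ h₂ h₃ hfin hD ?_⟩
    calc _ ≤ A * (ρ * (8 * (J * (Z * E)))) := by gcongr; exact hle.trans (by gcongr)
      _ = A * (ρ * (8 * (J * Z))) * E := by ring
      _ ≤ 1 := by
        rw [hE, if_pos hs']
        exact ENNReal.mul_inv_le_one _
  -- This covers `α < 0` and also the endpoint `α = 0`, `s = n/2 - σ`. The shift `m` depends on the
  -- data and makes their weighted `L¹` norm small whatever their size.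
  · set d : ℝ≥0∞ := JMGT.decayConst n ^ (1 / 2 : ℝ) with hd
    have hdt : d ≠ ∞ :=
      (ENNReal.rpow_lt_top_of_nonneg (by norm_num) (JMGT.decayConst_lt_top n).ne).ne
    set S := Z * JMGT.dataSize α s σ ψ₀ ψ₁ ψ₂
    have hSt : S ≠ ∞ := ENNReal.mul_ne_top hZt hfin.ne
    obtain ⟨m, hm, hmle⟩ := JMGT.exists_rpow_neg_mul_le_one (L := A * (ρ * (8 * (d * S))))
      (ENNReal.mul_ne_top (by simp [A]) (ENNReal.mul_ne_top (by simp [ρ])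
        (ENNReal.mul_ne_top (by simp) (ENNReal.mul_ne_top hdt hSt))))
    have hle := JMGT.lintegral_eExp_le (R := 1) hα hm hr hDm.aemeasurable
      (Eventually.of_forall fun ξ h => by
        by_contra hcon
        exact h (JMGT.sourceBound_eq_zero h₀ h₁ h₂ h₃ hcon))
    rw [JMGT.lintegral_sq_rpow, mul_one, ← hd] at hle
    replace hle := hle.trans (mul_le_mul_right (mul_le_mul_right hN _) _)
    have hβ : α - 1 - m ≤ 0 := by linarith
    refine ⟨n * (α - 1 - m), ?_, fun e1 e2 => absurd ⟨e1, e2⟩ hcase,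
      JMGT.exists_unique_solution hτ hδ hσ hBA hC hc hk hc₀ hβ (by linarith) hr h₀ h₁ h₂ h₃ hfin
        (hle.trans_lt ?_) ?_⟩
    -- `n(α - 1 - m) ≤ α - 1 - m ≤ α`, since `n ≥ 1` and the factor is nonpositive.
    · nlinarith
    · exact ENNReal.mul_lt_top (by simp) (ENNReal.mul_lt_top (lt_top_iff_ne_top.2 hdt)
        (lt_top_iff_ne_top.2 hSt))
    · calc _ ≤ A * (ρ * (8 * (ENNReal.ofReal (2 ^ (-m)) * (d * S)))) := by gcongr
        _ = A * (ρ * (8 * (d * S))) * ENNReal.ofReal (2 ^ (-m)) := by ring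
        _ ≤ 1 := hmle
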